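/- **Setting.** Let $n\ge 1$, let $\Theta\subset\mathbb R^n$ be compact, and let $H$, $\mathcal H$ be separable complex Hilbert spaces with $H$ compactly and densely embedded in $\mathcal H$. For $\theta\in\Theta$ let $a_\theta,b_\theta$ be non-negative sesquilinear forms on $H$ such that $(\cdot,\cdot)_\theta:=a_\theta+b_\theta$ are inner products on $H$ equivalent to the given one, with norms satisfying $\|u\|_{\theta_1}\le K\|u\|_{\theta_2}$ for all $\theta_1,\theta_2\in\Theta$, and let $|a_{\theta_1}(u,\tilde u)-a_{\theta_2}(u,\tilde u)|\le L_a|\theta_1-\theta_2|\,\|u\|_{\theta_1}\|\tilde u\|_{\theta_1}$. Let $d_\theta$, $\theta\in\Theta$, be inner products on $\mathcal H$ equivalent to the given one, with $d_{\theta_1}[u]\le K_d\,d_{\theta_2}[u]$, and let $d_\theta[u]\le b_\theta[u]$ for $u\in H$. Here $s[u]:=s(u,u)$. For $0<\varepsilon<1$ let $\mathcal L_{\varepsilon,\theta}$ be the self-adjoint operator in $(\mathcal H,d_\theta)$ generated by the form $\varepsilon^{-2}a_\theta+b_\theta$ with form domain $H$. Put $V_\theta:=\{v\in H: a_\theta[v]=0\}$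 and $W_\theta:=\{w\in H:(w,v)_\theta=0\ \forall v\in V_\theta\}$. **Assumptions.** * (H1) For each $\theta\in\Theta$ there is $\nu_\theta>0$ with $a_\theta[w]\ge\nu_\theta\|w\|_\theta^2$ for all $w\in W_\theta$. * (H2) There are a closed subspace $V_\star\subset H$ and $L_\star\ge0$ such that, with $V^\star_\theta:=V_\theta$ for $\theta\ne0$ and $V^\star_0:=V_\star$, one has $\inf_{v_2\in V^\star_{\theta_2}}\|v_1-v_2\|_{\theta_2}\le L_\star|\theta_1-\theta_2|\,\|v_1\|_{\theta_1}$ for all $\theta_1,\theta_2\in\Theta$, $v_1\in V^\star_{\theta_1}$. Moreover $Z$ is a closed subspace of $V_0$ with $V_0=V_\star\dotplus Z$ (direct sum) and $|(v,z)_0|\le K_Z\|v\|_0\|z\|_0$ for $v\in V_\star$, $z\in Z$, for some $0\le K_Z<1$. * (H3) For some $\gamma>0$, $a_\theta[w]\ge\gamma|\theta|^2\|w\|_\theta^2$ for all $\theta\in\Theta$, $w\in W_\theta$. * (H4) $0$ is an interior point of $\Theta$, and there are sesquilinear maps $a_0':V_0\times H\to\mathbb C^n$, $a_0'':V_0\times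 V_0\to\mathbb C^{n\times n}$ and constants $K',K''\ge0$ with $|a_\theta(v,u)-a_0'(v,u)\cdot\theta|\le K'|\theta|^2\|v\|_0\|u\|_0$ and $|a_\theta(v,\tilde v)-a_0''(v,\tilde v)\theta\cdot\theta|\le K''|\theta|^3\|v\|_0\|\tilde v\|_0$ for all $v,\tilde v\in V_0$, $u\in H$, $\theta\in\Theta$. * (H5) $\Theta$ is connected and, for some $L_b\ge0$, $|b_\theta(v,\tilde v)-b_0(v,\tilde v)|\le L_b|\theta|\,\|v\|_0\|\tilde v\|_\theta$ for all $v,\tilde v\in V_0$, $\theta\in\Theta$. * (H6) For $\theta\in\Theta$ there are linear bijections $\mathcal E_\theta$ of $\mathcal H$ that map $V_\star$ bijectively onto $V^\star_\theta$ and satisfy, with constants $K_b,K_e\ge0$: $b_\theta(\mathcal E_\theta v,\mathcal E_\theta\tilde v)=b_0(v,\tilde v)$ and $|b_\theta(\mathcal E_\theta v,z)-b_0(v,z)|\le K_b|\theta|\,\|v\|_0\|z\|_0$ for $v,\tilde v\in V_\star$, $z\in Z$; $d_\theta(\mathcal E_\theta u,\mathcal E_\theta\tilde u)=d_0(u,\tilde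 u)$ for $u,\tilde u\in\mathcal H$; $\mathcal E_0=I$; and $d_{\theta_1}^{1/2}[\mathcal E_{\theta_1}u-\mathcal E_{\theta_2}u]\le K_e|\theta_1-\theta_2|\,d_0^{1/2}[u]$ for $\theta_1,\theta_2\in\Theta$, $u\in\mathcal H$. **The approximating operator.** For $\xi\in\mathbb R^n$ let $N_\xi:V_0\to W_0$ be the linear map with $a_0(N_\xi v,w)=-a_0'(v,w)\cdot\xi$ for all $w\in W_0$, and set $a^{\rm h}_\xi(v,\tilde v):=a_0''(v,\tilde v)\xi\cdot\xi-a_0(N_\xi v,N_\xi\tilde v)$ on $V_0$. Let $\mathcal H_0$ be the closure of $V_\star\dotplus Z$ in $\mathcal H$, let $P$ be the $d_0$-orthogonal projection of $\mathcal H$ onto $\mathcal H_0$, and let $\mathbb L_\xi$ be the self-adjoint operator in $(\mathcal H_0,d_0)$ generated by the form $\mathbb S_\xi(v+z,\tilde v+\tilde z):=a^{\rm h}_\xi(z,\tilde z)+b_0(v+z,\tilde v+\tilde z)$ with form domain $V_\star\dotplus Z$. Let $\lambda^{(1)}_{\varepsilon,\theta}\le\lambda^{(2)}_{\varepsilon,\theta}\le\dots$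 and $\lambda^{(1)}_\xi\le\lambda^{(2)}_\xi\le\dots$ be the eigenvalues of $\mathcal L_{\varepsilon,\theta}$ and $\mathbb L_\xi$, repeated according to multiplicity. **Theorem.** Assume (H1)–(H6). There is a constant $C>0$, independent of $\varepsilon$, $\theta$ and of the index of the eigenvalues, such that for all $0<\varepsilon<1$ and all $\theta\in\Theta$ the following holds. 1. $\mathcal L_{\varepsilon,\theta}$ and $\mathbb L_{\theta/\varepsilon}$ have everywhere defined inverses, and $$\big\|\mathcal L_{\varepsilon,\theta}^{-1}-\mathcal E_\theta\,\mathbb L_{\theta/\varepsilon}^{-1}\,P\,\mathcal E_\theta^{-1}\big\|_{(\mathcal H,d_\theta)\to(\mathcal H,d_\theta)}\le C\varepsilon .$$ 2. If $\dim(V_\star\dotplus Z)=\infty$, then $\big|1/\lambda^{(k)}_{\varepsilon,\theta}-1/\lambda^{(k)}_{\theta/\varepsilon}\big|\le C\varepsilon$ for all $k\ge1$. 3. If $\dim(V_\star\dotplus Z)=N<\infty$, then $\big|1/\lambda^{(k)}_{\varepsilon,\theta}-1/\lambda^{(k)}_{\theta/\varepsilon}\big|\le C\varepsilon$ for $1\le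 k\le N$, and $\big|1/\lambda^{(p)}_{\varepsilon,\theta}\big|\le C\varepsilon$ for all $p\ge N+1$ (with $p\le\dim\mathcal H$, so that $\lambda^{(p)}_{\varepsilon,\theta}$ exists). -/

import Mathlib

open scoped Matrix

namespace AbstractHom

noncomputable section

/-- The parameter space `ℝⁿ` with its Euclidean norm. -/
abbrev Param (n : ℕ) := EuclideanSpace ℝ (Fin n)

/-- Sesquilinear forms: linear in the first and conjugate-linear in the second argument. -/
abbrev SesqForm (X : Type*) [AddCommGroup X] [Module ℂ X] := X →ₗ[ℂ] X →ₗ⋆[ℂ] ℂ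

/-- The form `(x, x') ↦ s (f x, f x')`. -/
def SesqForm.pullback {X Y : Type*} [AddCommGroup X] [Module ℂ X] [AddCommGroup Y] [Module ℂ Y]
    (s : SesqForm Y) (f : X →ₗ[ℂ] Y) : SesqForm X :=
  LinearMap.mk₂'ₛₗ (RingHom.id ℂ) (starRingEnd ℂ) (fun x x' => s (f x) (f x'))
    (by intros; simp) (by intros; simp) (by intros; simp) (by intros; simp)

/-- Non-negative sesquilinear forms: `s[u] = s(u, u)` is real and non-negative for every `u`. -/
structure NonnegForm (X : Type*) [AddCommGroup X] [Module ℂ X] where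
  toForm : SesqForm X
  re_nonneg : ∀ u, 0 ≤ (toForm u u).re
  im_eq_zero : ∀ u, (toForm u u).im = 0

namespace NonnegForm

variable {X : Type*} [AddCommGroup X] [Module ℂ X]

/-- `s[u] = s(u, u)`, as a real number. -/
def quad (s : NonnegForm X) (u : X) : ℝ := (s.toForm u u).re

/-- `s[u]^{1/2}`. -/
def nrm (s : NonnegForm X) (u : X) : ℝ := √(s.quad u)

instance : Add (NonnegForm X) where
  add s t :=
    { toForm := s.toForm + t.toForm
      re_nonneg := fun u => by
        simpa using add_nonneg (s.re_nonneg u) (t.re_nonneg u)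
      im_eq_zero := fun u => by
        simp [s.im_eq_zero u, t.im_eq_zero u] }

/-- For a non-negative form, `s[u] = 0` forces `s(u, v) = 0` for all `v`. -/
theorem apply_eq_zero (s : NonnegForm X) {u : X} (hu : s.toForm u u = 0) (v : X) :
    s.toForm u v = 0 ∧ s.toForm v u = 0 := by
  have key : ∀ c : ℂ, 0 ≤ (c * s.toForm u v + (starRingEnd ℂ) c * s.toForm v u
      + s.toForm v v).re ∧ (c * s.toForm u v + (starRingEnd ℂ) c * s.toForm v u
      + s.toForm v v).im = 0 := by
    intro c
    have e : s.toForm (c • u + v) (c • u + v) = c * s.toForm u v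
        + (starRingEnd ℂ) c * s.toForm v u + s.toForm v v := by
      simp [hu]; ring
    exact ⟨e ▸ s.re_nonneg _, e ▸ s.im_eq_zero _⟩
  have h0 := s.im_eq_zero v
  set p := s.toForm u v
  set q := s.toForm v u
  set r := s.toForm v v
  have k1 := (key 1).2
  have k2 := (key Complex.I).2
  simp [h0] at k1 k2
  have hre : q.re = p.re := by linarith
  have him : q.im = -p.im := by linarith
  have hr : 0 ≤ r.re := s.re_nonneg v
  have m (t : ℝ) : 0 ≤ -(2 * t * (p.re ^ 2 + p.im ^ 2)) + r.re := by
    have h := (key ((t : ℂ) * -(starRingEnd ℂ) p)).1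
    simp [hre, him] at h
    linarith
  have hsq : p.re ^ 2 + p.im ^ 2 = 0 := by
    by_contra hne
    have h := m ((r.re + 1) / (p.re ^ 2 + p.im ^ 2))
    rw [mul_assoc, div_mul_cancel₀ _ hne] at h
    linarith
  have hpre : p.re = 0 := by nlinarith [sq_nonneg p.re, sq_nonneg p.im]
  have hpim : p.im = 0 := by nlinarith [sq_nonneg p.re, sq_nonneg p.im]
  exact ⟨Complex.ext hpre hpim, Complex.ext (by simp [hre, hpre]) (by simp [him, hpim])⟩

/-- The degeneracy subspace `{v | s[v] = 0}` of a non-negative form. -/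
def nullSpace (s : NonnegForm X) : Submodule ℂ X where
  carrier := {v | s.toForm v v = 0}
  add_mem' := by
    intro u v hu hv
    have hu' := s.apply_eq_zero hu v
    simp only [Set.mem_ofPred_eq] at hu hv ⊢
    simp [hu, hv, hu'.1, hu'.2]
  zero_mem' := by simp
  smul_mem' := by
    intro c u hu
    simp only [Set.mem_ofPred_eq] at hu ⊢
    simp [hu]

/-- `s[·]^{1/2}` is a norm equivalent to the given norm. -/
def IsEquivNorm {X : Type*} [NormedAddCommGroup X] [Module ℂ X] (s : NonnegForm X) : Prop :=
  ∃ c > 0, ∃ C > 0, ∀ u, c * ‖u‖ ≤ s.nrm u ∧ s.nrm u ≤ C * ‖u‖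

end NonnegForm

section Operators

variable {X Y : Type*} [AddCommGroup X] [Module ℂ X] [AddCommGroup Y] [Module ℂ Y]

/-- The graph of the operator generated in `(Y, d)` by the form `s`, whose form domain `X` sits in
`Y` by `j`: the pairs `(j x, g)` with `s(x, x') = d(g, j x')` for all `x'`. -/
def formGraph (s : SesqForm X) (j : X →ₗ[ℂ] Y) (d : SesqForm Y) : Submodule ℂ (Y × Y) where
  carrier := {p | ∃ x, j x = p.1 ∧ ∀ x', s x x' = d p.2 (j x')}
  add_mem' := by
    rintro p q ⟨x, hx, hx'⟩ ⟨y, hy, hy'⟩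
    exact ⟨x + y, by simp [hx, hy], fun x' => by simp [hx', hy']⟩
  zero_mem' := ⟨0, by simp, by simp⟩
  smul_mem' := by
    rintro c p ⟨x, hx, hx'⟩
    exact ⟨c • x, by simp [hx], fun x' => by simp [hx']⟩

/-- The (unbounded) operator generated in `(Y, d)` by the form `s` with form domain `X`. -/
def formOperator (s : SesqForm X) (j : X →ₗ[ℂ] Y) (d : SesqForm Y) : Y →ₗ.[ℂ] Y :=
  (formGraph s j d).toLinearPMap

/-- `R` is the everywhere defined inverse of the operator `T`. -/
def IsInverse (T : Y →ₗ.[ℂ] Y) (R : Y →ₗ[ℂ] Y) : Prop :=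
  ∀ g u : Y, R g = u ↔ ∃ h : u ∈ T.domain, T ⟨u, h⟩ = g

/-- `P` is the projection onto the subspace `U` that is orthogonal with respect to `d`. -/
def IsOrthProj (d : SesqForm Y) (U : Submodule ℂ Y) (P : Y →ₗ[ℂ] U) : Prop :=
  ∀ g : Y, ∀ q ∈ U, d (g - P g) q = 0

/-- The eigenspace `{y ∈ dom T | T y = μ y}`. -/
def eigenspace (T : Y →ₗ.[ℂ] Y) (μ : ℂ) : Submodule ℂ Y :=
  (LinearMap.ker (T.toFun - μ • T.domain.subtype)).map T.domain.subtype

/-- The `k`-th (`k = 1, 2, …`) of the real eigenvalues of `T`, in ascending order and repeated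
according to multiplicity: the smallest `t` such that the eigenspaces for eigenvalues `≤ t` have
total dimension at least `k`. -/
def eigenvalue (T : Y →ₗ.[ℂ] Y) (k : ℕ) : ℝ :=
  sInf {t : ℝ | (k : Cardinal) ≤
    Module.rank ℂ ↥(⨆ μ : Set.Iic t, eigenspace T (((μ : ℝ) : ℂ)))}

end Operators

/-- The vector of `ℂⁿ` with the same (real) entries as `θ`. -/
def cvec {n : ℕ} (θ : Param n) : Fin n → ℂ := fun i => ((θ i : ℝ) : ℂ)

/-- The standing setting: the parameter set `Θ`, the forms `a_θ`, `b_θ` on `H`, the inner products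
`d_θ` on `𝓗`, and the compact dense embedding `ι` of `H` in `𝓗`. The values of the forms at
parameters outside `Θ` play no role. -/
structure Setting (n : ℕ) (H 𝓗 : Type*)
    [NormedAddCommGroup H] [InnerProductSpace ℂ H]
    [NormedAddCommGroup 𝓗] [InnerProductSpace ℂ 𝓗] where
  Θ : Set (Param n)
  isCompact_Θ : IsCompact Θ
  a : Param n → NonnegForm H
  b : Param n → NonnegForm H
  /-- Each `(·,·)_θ = a_θ + b_θ` is an equivalent inner product of `H`, … -/
  isEquivNorm_add : ∀ θ ∈ Θ, (a θ + b θ).IsEquivNorm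
  /-- … uniformly in `θ`: `‖u‖_{θ₁} ≤ K ‖u‖_{θ₂}`. -/
  uniform_equiv : ∃ K > 0, ∀ θ₁ ∈ Θ, ∀ θ₂ ∈ Θ, ∀ u,
    (a θ₁ + b θ₁).nrm u ≤ K * (a θ₂ + b θ₂).nrm u
  /-- Lipschitz continuity of `a_θ` in `θ`. -/
  lipschitz_a : ∃ L > 0, ∀ θ₁ ∈ Θ, ∀ θ₂ ∈ Θ, ∀ u v,
    ‖(a θ₁).toForm u v - (a θ₂).toForm u v‖ ≤
      L * ‖θ₁ - θ₂‖ * (a θ₁ + b θ₁).nrm u * (a θ₁ + b θ₁).nrm v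
  ι : H →L[ℂ] 𝓗
  injective_ι : Function.Injective ι
  isCompactOperator_ι : IsCompactOperator ι
  denseRange_ι : DenseRange ι
  d : Param n → NonnegForm 𝓗
  isEquivNorm_d : ∀ θ ∈ Θ, (d θ).IsEquivNorm
  uniform_equiv_d : ∃ K > 0, ∀ θ₁ ∈ Θ, ∀ θ₂ ∈ Θ, ∀ u, (d θ₁).quad u ≤ K * (d θ₂).quad u
  d_le_b : ∀ θ ∈ Θ, ∀ u, (d θ).quad (ι u) ≤ (b θ).quad u

namespace Setting

variable {n : ℕ} {H 𝓗 : Type*} [NormedAddCommGroup H] [InnerProductSpace ℂ H]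
  [NormedAddCommGroup 𝓗] [InnerProductSpace ℂ 𝓗] (S : Setting n H 𝓗)

/-- The norm `‖u‖_θ = (a_θ[u] + b_θ[u])^{1/2}`. -/
def nrm (θ : Param n) (u : H) : ℝ := (S.a θ + S.b θ).nrm u

/-- `V_θ = {v | a_θ[v] = 0}`. -/
def V (θ : Param n) : Submodule ℂ H := (S.a θ).nullSpace

/-- `W_θ`, the orthogonal complement of `V_θ` with respect to `(·,·)_θ`. -/
def W (θ : Param n) : Submodule ℂ H where
  carrier := {w | ∀ v ∈ S.V θ, (S.a θ + S.b θ).toForm w v = 0}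
  add_mem' := by
    intro u w hu hw v hv
    simp [hu v hv, hw v hv]
  zero_mem' := by intro v _; simp
  smul_mem' := by
    intro c w hw v hv
    simp [hw v hv]

/-- The operator `𝓛_{ε,θ}` generated in `(𝓗, d_θ)` by the form `ε⁻² a_θ + b_θ` with form
domain `H`. -/
def op (ε : ℝ) (θ : Param n) : 𝓗 →ₗ.[ℂ] 𝓗 :=
  formOperator (((ε : ℂ) ^ 2)⁻¹ • (S.a θ).toForm + (S.b θ).toForm) S.ι.toLinearMap (S.d θ).toForm

/-- The gap condition (H1). -/
def GapCondition : Prop :=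
  ∀ θ ∈ S.Θ, ∃ ν > 0, ∀ w ∈ S.W θ, ν * S.nrm θ w ^ 2 ≤ (S.a θ).quad w

open Classical in
/-- `V^⋆_θ`, which is `V_θ` for `θ ≠ 0` and `V_⋆` for `θ = 0`. -/
def Vst (Vstar : Submodule ℂ H) (θ : Param n) : Submodule ℂ H :=
  if θ = 0 then Vstar else S.V θ

/-- The removable singularity condition (H2). -/
def RemovableSingularity (Vstar : Submodule ℂ H) : Prop :=
  IsClosed (Vstar : Set H) ∧
  ∃ L ≥ 0, ∀ θ₁ ∈ S.Θ, ∀ θ₂ ∈ S.Θ, ∀ v₁ ∈ S.Vst Vstar θ₁,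
    (⨅ v₂ : S.Vst Vstar θ₂, S.nrm θ₂ (v₁ - v₂)) ≤ L * ‖θ₁ - θ₂‖ * S.nrm θ₁ v₁

/-- `V_⋆ ∔ Z`, for `Z` a subspace of `V_0`. -/
def sumSpace (Vstar : Submodule ℂ H) (Z : Submodule ℂ (S.V 0)) : Submodule ℂ H :=
  Vstar ⊔ Z.map (S.V 0).subtype

/-- `Z` is a closed subspace of `V_0` with `V_0 = V_⋆ ∔ Z`, the direct sum being transversal. -/
def IsDefectSpace (Vstar : Submodule ℂ H) (Z : Submodule ℂ (S.V 0)) : Prop :=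
  IsClosed (Z : Set (S.V 0)) ∧
  S.V 0 = S.sumSpace Vstar Z ∧ Disjoint Vstar (Z.map (S.V 0).subtype) ∧
  ∃ K, 0 ≤ K ∧ K < 1 ∧ ∀ v ∈ Vstar, ∀ z ∈ Z,
    ‖(S.a 0 + S.b 0).toForm v z‖ ≤ K * S.nrm 0 v * S.nrm 0 z

/-- The quadratic bound (H3) for the degeneration of the gap. -/
def QuadraticGap : Prop :=
  ∃ γ > 0, ∀ θ ∈ S.Θ, ∀ w ∈ S.W θ, γ * ‖θ‖ ^ 2 * S.nrm θ w ^ 2 ≤ (S.a θ).quad w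

/-- The regularity (H4) of `a_θ` at the interior point `θ = 0` of `Θ`, with the sesquilinear maps
`a₁ = a'₀` and `a₂ = a''₀`. -/
def RegularAtZero (a₁ : S.V 0 →ₗ[ℂ] H →ₗ⋆[ℂ] (Fin n → ℂ))
    (a₂ : S.V 0 →ₗ[ℂ] S.V 0 →ₗ⋆[ℂ] Matrix (Fin n) (Fin n) ℂ) : Prop :=
  (0 : Param n) ∈ interior S.Θ ∧
  (∃ K ≥ 0, ∀ v : S.V 0, ∀ u : H, ∀ θ ∈ S.Θ,
    ‖(S.a θ).toForm v u - a₁ v u ⬝ᵥ cvec θ‖ ≤ K * ‖θ‖ ^ 2 * S.nrm 0 v * S.nrm 0 u) ∧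
  (∃ K ≥ 0, ∀ v v' : S.V 0, ∀ θ ∈ S.Θ,
    ‖(S.a θ).toForm v v' - (a₂ v v' *ᵥ cvec θ) ⬝ᵥ cvec θ‖ ≤
      K * ‖θ‖ ^ 3 * S.nrm 0 v * S.nrm 0 v')

/-- The Lipschitz continuity (H5) of `b_θ` at `θ = 0`, with `Θ` connected. -/
def LipschitzB : Prop :=
  IsConnected S.Θ ∧
  ∃ L ≥ 0, ∀ v ∈ S.V 0, ∀ v' ∈ S.V 0, ∀ θ ∈ S.Θ,
    ‖(S.b θ).toForm v v' - (S.b 0).toForm v v'‖ ≤ L * ‖θ‖ * S.nrm 0 v * S.nrm θ v'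

/-- `𝓔_θ` restricts to bijections `V_⋆ → V^⋆_θ` which carry `b_0` to `b_θ` and satisfy
`|b_θ(𝓔_θ v, z) - b_0(v, z)| ≤ K_b |θ| ‖v‖_0 ‖z‖_0`. -/
def IsTransfer (Vstar : Submodule ℂ H) (Z : Submodule ℂ (S.V 0))
    (E : Param n → 𝓗 ≃ₗ[ℂ] 𝓗) : Prop :=
  ∃ K ≥ 0, ∀ θ ∈ S.Θ, ∃ T : Vstar ≃ₗ[ℂ] S.Vst Vstar θ,
    (∀ v : Vstar, S.ι (T v : H) = E θ (S.ι v)) ∧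
    (∀ v v' : Vstar, (S.b θ).toForm (T v) (T v') = (S.b 0).toForm v v') ∧
    (∀ v : Vstar, ∀ z ∈ Z, ‖(S.b θ).toForm (T v) z - (S.b 0).toForm v z‖ ≤
      K * ‖θ‖ * S.nrm 0 v * S.nrm 0 z)

/-- The unitarity and Lipschitz condition (H6) for bijections `𝓔_θ` of `𝓗` that extend transfer
operators `V_⋆ → V^⋆_θ`. -/
def UnitaryTransfer (Vstar : Submodule ℂ H) (Z : Submodule ℂ (S.V 0))
    (E : Param n → 𝓗 ≃ₗ[ℂ] 𝓗) : Prop :=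
  S.IsTransfer Vstar Z E ∧
  (∀ θ ∈ S.Θ, ∀ u u' : 𝓗, (S.d θ).toForm (E θ u) (E θ u') = (S.d 0).toForm u u') ∧
  (∀ u : 𝓗, E 0 u = u) ∧
  ∃ K ≥ 0, ∀ θ₁ ∈ S.Θ, ∀ θ₂ ∈ S.Θ, ∀ u : 𝓗,
    (S.d θ₁).nrm (E θ₁ u - E θ₂ u) ≤ K * ‖θ₁ - θ₂‖ * (S.d 0).nrm u

/-- `N` is the solution operator `N_ξ : V_0 → W_0` of the linearised cell problem
`a_0(N_ξ v, w) = - a'_0(v, w) · ξ` for all `w ∈ W_0`. -/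
def IsCorrector (a₁ : S.V 0 →ₗ[ℂ] H →ₗ⋆[ℂ] (Fin n → ℂ)) (ξ : Param n)
    (N : S.V 0 →ₗ[ℂ] S.W 0) : Prop :=
  ∀ (v : S.V 0) (w : S.W 0), (S.a 0).toForm (N v) w = -(a₁ v w ⬝ᵥ cvec ξ)

/-- The operator `N_ξ`; it exists and is unique under (H1) and (H4). -/
def corrector (a₁ : S.V 0 →ₗ[ℂ] H →ₗ⋆[ℂ] (Fin n → ℂ)) (ξ : Param n) :
    S.V 0 →ₗ[ℂ] S.W 0 :=
  Classical.epsilon (S.IsCorrector a₁ ξ)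

/-- The homogenised form `a^h_ξ(v, v') = a''_0(v, v') ξ · ξ - a_0(N_ξ v, N_ξ v')` on `V_0`. -/
def homForm (a₁ : S.V 0 →ₗ[ℂ] H →ₗ⋆[ℂ] (Fin n → ℂ))
    (a₂ : S.V 0 →ₗ[ℂ] S.V 0 →ₗ⋆[ℂ] Matrix (Fin n) (Fin n) ℂ) (ξ : Param n) :
    SesqForm (S.V 0) :=
  LinearMap.mk₂'ₛₗ (RingHom.id ℂ) (starRingEnd ℂ)
      (fun v v' => (a₂ v v' *ᵥ cvec ξ) ⬝ᵥ cvec ξ)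
      (by intros; simp [Matrix.add_mulVec, add_dotProduct])
      (by intros; simp [Matrix.smul_mulVec, smul_dotProduct])
      (by intros; simp [Matrix.add_mulVec, add_dotProduct])
      (by intros; simp [Matrix.smul_mulVec, smul_dotProduct])
    - (S.a 0).toForm.pullback ((S.W 0).subtype ∘ₗ S.corrector a₁ ξ)

/-- The map `(v, z) ↦ v + z` from `V_⋆ × Z` to `H`. -/
def sumMap (Vstar : Submodule ℂ H) (Z : Submodule ℂ (S.V 0)) : Vstar × Z →ₗ[ℂ] H :=
  Vstar.subtype.coprod ((S.V 0).subtype ∘ₗ Z.subtype)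

/-- The form `𝕊_ξ(v + z, v' + z') = a^h_ξ(z, z') + b_0(v + z, v' + z')` on `V_⋆ ∔ Z`, whose
elements `v + z` are represented by the pairs `(v, z)`. -/
def limitForm (Vstar : Submodule ℂ H) (Z : Submodule ℂ (S.V 0))
    (a₁ : S.V 0 →ₗ[ℂ] H →ₗ⋆[ℂ] (Fin n → ℂ))
    (a₂ : S.V 0 →ₗ[ℂ] S.V 0 →ₗ⋆[ℂ] Matrix (Fin n) (Fin n) ℂ) (ξ : Param n) :
    SesqForm (Vstar × Z) :=
  (S.homForm a₁ a₂ ξ).pullback (Z.subtype ∘ₗ LinearMap.snd ℂ Vstar Z)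
    + (S.b 0).toForm.pullback (S.sumMap Vstar Z)

/-- `𝓗_0`, the closure of `V_⋆ ∔ Z` in `𝓗`. -/
def limitSpace (Vstar : Submodule ℂ H) (Z : Submodule ℂ (S.V 0)) : Submodule ℂ 𝓗 :=
  ((S.sumSpace Vstar Z).map S.ι.toLinearMap).topologicalClosure

/-- The embedding of `V_⋆ ∔ Z` in `𝓗_0`. -/
def limitEmbedding (Vstar : Submodule ℂ H) (Z : Submodule ℂ (S.V 0)) :
    Vstar × Z →ₗ[ℂ] S.limitSpace Vstar Z :=
  (S.ι.toLinearMap ∘ₗ S.sumMap Vstar Z).codRestrict _ fun p =>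
    Submodule.le_topologicalClosure _ (Submodule.mem_map_of_mem
      (Submodule.add_mem_sup p.1.2 (Submodule.mem_map_of_mem p.2.2)))

/-- The operator `𝕃_ξ` generated in `(𝓗_0, d_0)` by the form `𝕊_ξ` with form domain
`V_⋆ ∔ Z`. -/
def limitOp (Vstar : Submodule ℂ H) (Z : Submodule ℂ (S.V 0))
    (a₁ : S.V 0 →ₗ[ℂ] H →ₗ⋆[ℂ] (Fin n → ℂ))
    (a₂ : S.V 0 →ₗ[ℂ] S.V 0 →ₗ⋆[ℂ] Matrix (Fin n) (Fin n) ℂ) (ξ : Param n) :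
    S.limitSpace Vstar Z →ₗ.[ℂ] S.limitSpace Vstar Z :=
  formOperator (S.limitForm Vstar Z a₁ a₂ ξ) (S.limitEmbedding Vstar Z)
    ((S.d 0).toForm.pullback (S.limitSpace Vstar Z).subtype)

end Setting

end

end AbstractHom

/-! The key is a splitting of test vectors (`exists_hasDecomposition`): φ = v + z + r with v in
V^⋆_θ and z in Z, where |θ|‖z‖ and ‖r‖ are controlled by a_θ[φ]^{1/2}. Since a_θ[φ] is at most ε²
times the energy (ε⁻²a_θ + b_θ)[φ], both quantities are O(ε) in the energy norm. Near θ = 0 the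
W_θ-part of φ is split once more along V_0 = V_⋆ ∔ Z and W_0, and its V_⋆-part is moved into V_θ by
(H2).

The second ingredient is an expansion at θ = 0. On V_0 the form a_θ is of order |θ|², so its
first-order term vanishes there. With the corrector added, a_θ(z + N_θ z, ·) is of order |θ|² on all
of H and agrees with a^h_θ(z, ·) on V_0 up to |θ|³. The quadratic gap and the transversality of V_⋆
and Z then make a^h_ξ coercive on Z with constant c|ξ|² (`exists_homForm_coercive`), so the limit
solution (v, z) for ξ = θ/ε satisfies |θ/ε|²‖z‖ ≤ D‖g‖.

The trial solution is 𝓔_θ v + z + N_θ z. Its residual is tested separately on the three parts v',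
z', r of a test vector. The terms singular in ε are ε⁻²|θ|³‖z‖‖z'‖ = (|θ/ε|²‖z‖)(|θ|‖z'‖) and
ε⁻²|θ|²‖z‖‖r‖, and both are O(ε) by the two bounds above (`exists_residual_bound`). Testing with the
error itself gives the operator estimate, because N_θ z and 𝓔_θ z - z are O(ε) as well.

The eigenvalue estimates follow by Weyl's dimension count (`mem_eigenvalueSet_of_form_le`). The
inverses are compact and symmetric, their positive eigenvalues are the reciprocals of those sought,
and the two spaces are compared through P𝓔_θ⁻¹ and 𝓔_θ restricted to 𝓗_0, neither of which increases
the d-norm. -/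

namespace AbstractHom

noncomputable section

/-! ### Algebra of non-negative forms: symmetry, Cauchy–Schwarz, seminorms -/

namespace NonnegForm

variable {X : Type*} [AddCommGroup X] [Module ℂ X] (s : NonnegForm X)

theorem apply_self (u : X) : s.toForm u u = (s.quad u : ℂ) :=
  Complex.ext (by simp [quad]) (by simp [s.im_eq_zero u])

/-- Polarisation: since s[u + v] and s[u + iv] are real, the imaginary and real parts of s(u, v) and
s(v, u) are tied together. -/
theorem conj_symm (u v : X) : (starRingEnd ℂ) (s.toForm v u) = s.toForm u v := by
  have h1 := s.im_eq_zero (u + v)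
  have h2 := s.im_eq_zero (u + Complex.I • v)
  have hu := s.im_eq_zero u
  have hv := s.im_eq_zero v
  simp only [map_add, LinearMap.add_apply, Complex.add_im, hu, hv, map_smulₛₗ, LinearMap.smul_apply,
    smul_eq_mul, RingHom.id_apply, Complex.conj_I, Complex.mul_im, Complex.mul_re, Complex.I_re,
    Complex.I_im, Complex.neg_re, Complex.neg_im, Complex.add_re] at h1 h2
  apply Complex.ext
  · simp only [Complex.conj_re]; linarith
  · simp only [Complex.conj_im]; linarith

/-- The pre-inner product given by a non-negative form. -/
@[reducible]
def preCore : PreInnerProductSpace.Core ℂ X where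
  -- The slots are swapped: the forms are linear in the first argument, `inner` in the second.
  inner x y := s.toForm y x
  conj_inner_symm x y := s.conj_symm y x
  re_inner_nonneg := s.re_nonneg
  add_left x y z := by simp
  smul_left x y r := by simp

theorem nrm_nonneg (u : X) : 0 ≤ s.nrm u := Real.sqrt_nonneg _

theorem quad_nonneg (u : X) : 0 ≤ s.quad u := s.re_nonneg u

theorem nrm_sq (u : X) : s.nrm u ^ 2 = s.quad u := Real.sq_sqrt (s.re_nonneg u)

theorem norm_apply_le (u v : X) : ‖s.toForm u v‖ ≤ s.nrm u * s.nrm v := by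
  have := @InnerProductSpace.Core.norm_inner_le_norm ℂ X _ _ _ s.preCore v u
  rw [mul_comm]
  exact this

theorem nrm_add_le (u v : X) : s.nrm (u + v) ≤ s.nrm u + s.nrm v :=
  @norm_add_le X (@InnerProductSpace.Core.toSeminormedAddCommGroup ℂ X _ _ _ s.preCore).toSeminormedAddGroup u v

theorem nrm_neg (u : X) : s.nrm (-u) = s.nrm u := by
  simp [nrm, quad]

theorem nrm_sub_le (u v : X) : s.nrm (u - v) ≤ s.nrm u + s.nrm v := by
  rw [sub_eq_add_neg, ← s.nrm_neg v]; exact s.nrm_add_le _ _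

theorem add_toForm (s t : NonnegForm X) : (s + t).toForm = s.toForm + t.toForm := rfl

theorem add_quad (s t : NonnegForm X) (u : X) : (s + t).quad u = s.quad u + t.quad u := by
  simp [quad, add_toForm]

/-- The non-negative form `c s`, for `0 ≤ c`. -/
def smul (c : ℝ) (hc : 0 ≤ c) : NonnegForm X where
  toForm := (c : ℂ) • s.toForm
  re_nonneg u := by simpa using mul_nonneg hc (s.re_nonneg u)
  im_eq_zero u := by simp [s.im_eq_zero]

/-- The pullback of a non-negative form. -/
def comap {Y : Type*} [AddCommGroup Y] [Module ℂ Y] (f : Y →ₗ[ℂ] X) : NonnegForm Y where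
  toForm := s.toForm.pullback f
  re_nonneg u := s.re_nonneg (f u)
  im_eq_zero u := s.im_eq_zero (f u)

@[simp] theorem comap_apply {Y : Type*} [AddCommGroup Y] [Module ℂ Y] (f : Y →ₗ[ℂ] X) (y y' : Y) :
    (s.comap f).toForm y y' = s.toForm (f y) (f y') := rfl

@[simp] theorem comap_quad {Y : Type*} [AddCommGroup Y] [Module ℂ Y] (f : Y →ₗ[ℂ] X) (y : Y) :
    (s.comap f).quad y = s.quad (f y) := rfl

@[simp] theorem comap_nrm {Y : Type*} [AddCommGroup Y] [Module ℂ Y] (f : Y →ₗ[ℂ] X) (y : Y) :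
    (s.comap f).nrm y = s.nrm (f y) := rfl

end NonnegForm

/-! ### Equivalent inner products and the Riesz representation -/

namespace NonnegForm

variable {X : Type*} [NormedAddCommGroup X] [NormedSpace ℂ X] (s : NonnegForm X)

variable {s} in
theorem IsEquivNorm.eq_zero (hs : s.IsEquivNorm) {u : X} (hu : s.toForm u u = 0) : u = 0 := by
  obtain ⟨c, hc, C, hC, h⟩ := hs
  have h1 := (h u).1
  have : s.nrm u = 0 := by simp [nrm, quad, hu]
  rw [this] at h1
  have := norm_nonneg u
  exact norm_le_zero_iff.1 (by nlinarith)

theorem isEquivNorm_of_bounds {c C : ℝ} (hc : 0 < c) (h : ∀ u, c * ‖u‖ ^ 2 ≤ s.quad u)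
    (h' : ∀ u, s.quad u ≤ C * ‖u‖ ^ 2) : s.IsEquivNorm := by
  refine ⟨√c, Real.sqrt_pos.2 hc, √(max C 1), Real.sqrt_pos.2 (by positivity), fun u => ⟨?_, ?_⟩⟩
  · rw [nrm]
    refine Real.le_sqrt_of_sq_le ?_
    rw [mul_pow, Real.sq_sqrt hc.le]
    exact h u
  · rw [nrm]
    refine Real.sqrt_le_iff.2 ⟨by positivity, ?_⟩
    rw [mul_pow, Real.sq_sqrt (by positivity)]
    exact (h' u).trans (by gcongr; exact le_max_left _ _)

/-- The space `X` with the inner product `s`. -/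
def FormSpace (s : NonnegForm X) (_ : s.IsEquivNorm) : Type _ := X

variable {s} (hs : s.IsEquivNorm)

instance : AddCommGroup (FormSpace s hs) := inferInstanceAs (AddCommGroup X)
instance : Module ℂ (FormSpace s hs) := inferInstanceAs (Module ℂ X)

/-- The inner product of `FormSpace s hs`. -/
@[reducible]
def formCore : InnerProductSpace.Core ℂ (FormSpace s hs) where
  inner x y := s.toForm y x
  conj_inner_symm x y := s.conj_symm y x
  re_inner_nonneg := s.re_nonneg
  add_left x y z := by
    exact LinearMap.map_add (s.toForm z) x y
  smul_left x y r := by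
    exact LinearMap.map_smulₛₗ (s.toForm y) r x
  definite x hx := hs.eq_zero hx

instance : NormedAddCommGroup (FormSpace s hs) := (formCore hs).toNormedAddCommGroup
instance : InnerProductSpace ℂ (FormSpace s hs) := InnerProductSpace.ofCore (formCore hs).toCore

/-- The identity, as a linear map from `X` to `FormSpace s hs`. -/
def toFormSpaceₗ : X ≃ₗ[ℂ] FormSpace s hs where
  toFun x := x
  invFun x := x
  map_add' _ _ := rfl
  map_smul' _ _ := rfl
  left_inv _ := rfl
  right_inv _ := rfl

/-- The identity, as a continuous linear equivalence from `X` to `FormSpace s hs`. -/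
def toFormSpace : X ≃L[ℂ] FormSpace s hs :=
  (toFormSpaceₗ hs).toContinuousLinearEquivOfBounds hs.choose_spec.2.choose (hs.choose)⁻¹
    (fun x => (hs.choose_spec.2.choose_spec.2 x).2)
    (fun x => by
      rw [inv_mul_eq_div, le_div_iff₀ hs.choose_spec.1, mul_comm]
      exact (hs.choose_spec.2.choose_spec.2 x).1)

theorem norm_toFormSpace (x : X) : ‖toFormSpace hs x‖ = s.nrm x := rfl

theorem inner_toFormSpace (x y : X) :
    inner ℂ (toFormSpace hs x) (toFormSpace hs y) = s.toForm y x := rfl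

instance [CompleteSpace X] : CompleteSpace (FormSpace s hs) :=
  (completeSpace_congr (e := (toFormSpace hs).toEquiv) (toFormSpace hs).isUniformEmbedding).1 inferInstance

/-- This is the Riesz theorem in `FormSpace`, applied to the complex conjugate of `ℓ` because
`toDual` represents linear functionals. -/
theorem exists_riesz (hs : s.IsEquivNorm) [CompleteSpace X] (ℓ : X →ₗ⋆[ℂ] ℂ) (C : ℝ) (hℓ : ∀ x, ‖ℓ x‖ ≤ C * ‖x‖) :
    ∃ x, ∀ y, s.toForm x y = ℓ y := by
  let m : X →ₗ[ℂ] ℂ :=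
    { toFun := fun x => (starRingEnd ℂ) (ℓ x)
      map_add' := by intros; simp
      map_smul' := by intros; simp }
  let M : X →L[ℂ] ℂ := m.mkContinuous C (fun x => by simpa [m] using hℓ x)
  let z := (InnerProductSpace.toDual ℂ (FormSpace s hs)).symm
    (M.comp ((toFormSpace hs).symm : FormSpace s hs →L[ℂ] X))
  refine ⟨(toFormSpace hs).symm z, fun y => ?_⟩
  have h1 : inner ℂ z (toFormSpace hs y) = M y := by
    simp only [z, InnerProductSpace.toDual_symm_apply]
    simp
  have h2 : inner ℂ z (toFormSpace hs y) = s.toForm y ((toFormSpace hs).symm z) := by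
    rw [← inner_toFormSpace hs]; simp
  rw [← s.conj_symm, ← h2, h1]
  simp [M, m]

/-- Solvability of `s(N m, x) = B(m, x)` for all `x`, with a linear solution operator `N`. -/
theorem exists_solution (hs : s.IsEquivNorm) [CompleteSpace X] {M : Type*} [AddCommGroup M] [Module ℂ M]
    (B : M →ₗ[ℂ] X →ₗ⋆[ℂ] ℂ) (hB : ∀ m, ∃ C : ℝ, ∀ x, ‖B m x‖ ≤ C * ‖x‖) :
    ∃ N : M →ₗ[ℂ] X, ∀ m x, s.toForm (N m) x = B m x := by
  have h : ∀ m, ∃ x, ∀ y, s.toForm x y = B m y := fun m => by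
    obtain ⟨C, hC⟩ := hB m
    exact exists_riesz hs (B m) C hC
  choose N hN using h
  have key : ∀ x y, (∀ z, s.toForm x z = s.toForm y z) → x = y := fun x y hxy => by
    refine sub_eq_zero.1 (hs.eq_zero ?_)
    rw [map_sub s.toForm, LinearMap.sub_apply, hxy, sub_self]
  refine ⟨⟨⟨N, fun m m' => key _ _ fun z => ?_⟩, fun c m => key _ _ fun z => ?_⟩, hN⟩
  · simp [hN]
  · simp [hN]

end NonnegForm

/-! ### Inverses of form operators and spectral bounds for compact symmetric operators -/

section Spectral

/-- `toLinearPMap` has the prescribed graph only when that graph is single-valued, and this is what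
`hj` and `hd` ensure. Nondegeneracy of `s` then identifies every weak solution with `N g`. -/
theorem isInverse_formOperator {X Y : Type*} [AddCommGroup X] [Module ℂ X] [AddCommGroup Y]
    [Module ℂ Y] {s : SesqForm X} {j : X →ₗ[ℂ] Y} {d : SesqForm Y} (hj : Function.Injective j)
    (hd : ∀ g, (∀ x, d g (j x) = 0) → g = 0) (hs : ∀ x, (∀ x', s x x' = 0) → x = 0)
    {N : Y →ₗ[ℂ] X} (hN : ∀ g x, s (N g) x = d g (j x)) :
    IsInverse (formOperator s j d) (j ∘ₗ N) := by
  have hg : ∀ x ∈ formGraph s j d, x.1 = 0 → x.2 = 0 := by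
    rintro ⟨u, g⟩ ⟨x, hx, hx'⟩ (rfl : u = 0)
    have : x = 0 := hj (by simpa using hx)
    subst this
    exact hd _ fun x' => by rw [← hx']; simp
  have hgraph : (formOperator s j d).graph = formGraph s j d :=
    Submodule.toLinearPMap_graph_eq _ hg
  intro g u
  have h1 : (∃ h : u ∈ (formOperator s j d).domain, formOperator s j d ⟨u, h⟩ = g) ↔
      (u, g) ∈ formGraph s j d := by
    rw [← hgraph, LinearPMap.mem_graph_iff]
    constructor
    · rintro ⟨h, h'⟩
      exact ⟨⟨u, h⟩, rfl, h'⟩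
    · rintro ⟨⟨y, hy⟩, rfl, h'⟩
      exact ⟨hy, h'⟩
  rw [h1]
  constructor
  · rintro rfl
    exact ⟨N g, rfl, hN g⟩
  · rintro ⟨x, hx, hx'⟩
    have : N g - x = 0 := hs _ fun x' => by
      rw [map_sub, LinearMap.sub_apply, hN, hx', sub_self]
    rw [← show j x = u from hx, ← sub_eq_zero.1 this]
    rfl

variable {Y : Type*} [AddCommGroup Y] [Module ℂ Y]

theorem mem_eigenspace_iff {T : Y →ₗ.[ℂ] Y} {R : Y →ₗ[ℂ] Y} (hTR : IsInverse T R) {μ : ℂ} {u : Y} :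
    u ∈ eigenspace T μ ↔ R (μ • u) = u := by
  rw [hTR]
  simp only [AbstractHom.eigenspace, Submodule.mem_map, LinearMap.mem_ker, LinearMap.sub_apply,
    LinearMap.smul_apply, sub_eq_zero]
  constructor
  · rintro ⟨y, hy, rfl⟩
    exact ⟨y.2, hy⟩
  · rintro ⟨h, h'⟩
    exact ⟨⟨u, h⟩, h', rfl⟩

/-- Operators `R` which are symmetric with respect to `d` and satisfy `d[R g] ≤ d(R g, g)`. -/
structure IsContractiveSymm (d : NonnegForm Y) (R : Y →ₗ[ℂ] Y) : Prop where
  symm : ∀ x y, d.toForm (R x) y = d.toForm x (R y)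
  quad_le : ∀ x, d.quad (R x) ≤ (d.toForm (R x) x).re

/-- Symmetry makes eigenvectors for distinct real eigenvalues orthogonal, so the two quadratic forms
are diagonal along a finite decomposition of `u`. -/
theorem exists_sum_eigenvectors {d : NonnegForm Y} {R : Y →ₗ[ℂ] Y}
    (hR : ∀ x y, d.toForm (R x) y = d.toForm x (R y)) {I : Set ℝ} {u : Y}
    (hu : u ∈ ⨆ σ : I, Module.End.eigenspace R ((σ : ℝ) : ℂ)) :
    ∃ f : I →₀ Y, (d.toForm (R u) u).re = ∑ σ ∈ f.support, (σ : ℝ) * d.quad (f σ) ∧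
      d.quad u = ∑ σ ∈ f.support, d.quad (f σ) := by
  obtain ⟨f, hf, rfl⟩ := (Submodule.mem_iSup_iff_exists_finsupp _ _).1 hu
  have hf' : ∀ σ, R (f σ) = ((σ : ℝ) : ℂ) • f σ := fun σ => Module.End.mem_eigenspace_iff.1 (hf σ)
  have orth : ∀ σ τ, σ ≠ τ → d.toForm (f σ) (f τ) = 0 := by
    intro σ τ hst
    have h := hR (f σ) (f τ)
    rw [hf', hf', map_smul, LinearMap.smul_apply, map_smulₛₗ, Complex.conj_ofReal, smul_eq_mul,
      smul_eq_mul, ← sub_eq_zero, ← sub_mul] at h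
    rcases mul_eq_zero.1 h with h | h
    · exact absurd (Subtype.ext (Complex.ofReal_injective (sub_eq_zero.1 h))) hst
    · exact h
  refine ⟨f, ?_, ?_⟩
  · simp only [Finsupp.sum, map_sum, LinearMap.sum_apply, Complex.re_sum]
    refine Finset.sum_congr rfl fun σ hσ => ?_
    rw [Finset.sum_eq_single σ]
    · rw [hf']; simp [NonnegForm.quad]
    · intro τ _ hτ
      rw [hf', map_smul, LinearMap.smul_apply, orth _ _ hτ]; simp
    · intro h; exact absurd hσ h
  · simp only [Finsupp.sum, NonnegForm.quad, map_sum, LinearMap.sum_apply, Complex.re_sum]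
    refine Finset.sum_congr rfl fun σ hσ => ?_
    rw [Finset.sum_eq_single σ]
    · intro τ _ hτ
      rw [orth _ _ hτ]; simp
    · intro h; exact absurd hσ h

theorem le_form_of_mem_iSup {d : NonnegForm Y} {R : Y →ₗ[ℂ] Y}
    (hR : ∀ x y, d.toForm (R x) y = d.toForm x (R y)) {I : Set ℝ} {s : ℝ} (hI : ∀ σ ∈ I, s ≤ σ)
    {u : Y} (hu : u ∈ ⨆ σ : I, Module.End.eigenspace R ((σ : ℝ) : ℂ)) :
    s * d.quad u ≤ (d.toForm (R u) u).re := by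
  obtain ⟨f, h1, h2⟩ := exists_sum_eigenvectors hR hu
  rw [h1, h2, Finset.mul_sum]
  exact Finset.sum_le_sum fun σ _ => mul_le_mul_of_nonneg_right (hI σ σ.2) (d.quad_nonneg _)

theorem form_le_of_mem_iSup {d : NonnegForm Y} {R : Y →ₗ[ℂ] Y}
    (hR : ∀ x y, d.toForm (R x) y = d.toForm x (R y)) {I : Set ℝ} {s : ℝ} (hI : ∀ σ ∈ I, σ ≤ s)
    {u : Y} (hu : u ∈ ⨆ σ : I, Module.End.eigenspace R ((σ : ℝ) : ℂ)) :
    (d.toForm (R u) u).re ≤ s * d.quad u := by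
  obtain ⟨f, h1, h2⟩ := exists_sum_eigenvectors hR hu
  rw [h1, h2, Finset.mul_sum]
  exact Finset.sum_le_sum fun σ _ => mul_le_mul_of_nonneg_right (hI σ σ.2) (d.quad_nonneg _)

/-- By the spectral theorem the eigenspaces span a dense subspace. Those below `s` (spanning `K`)
are orthogonal to those from `s` on (spanning `K'`), so a vector orthogonal to `K'` lies in the
closure of `K`. There the bound holds by continuity. -/
theorem inner_le_of_orthogonal_eigenspaces {F : Type*} [NormedAddCommGroup F]
    [InnerProductSpace ℂ F] [CompleteSpace F] {R : F →L[ℂ] F} (hc : IsCompactOperator R)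
    (hR : (R : F →ₗ[ℂ] F).IsSymmetric) (d : NonnegForm F)
    (hd : ∀ x y, d.toForm x y = inner ℂ y x) {s : ℝ} {u : F}
    (hu : ∀ e ∈ ⨆ σ : Set.Ici s, Module.End.eigenspace (R : F →ₗ[ℂ] F) ((σ : ℝ) : ℂ),
      inner ℂ e u = 0) :
    (inner ℂ u (R u)).re ≤ s * ‖u‖ ^ 2 := by
  have hdR : ∀ x y, d.toForm (R x) y = d.toForm x (R y) := fun x y => by
    rw [hd, hd]; exact (hR y x).symm
  set K : Submodule ℂ F := ⨆ σ : Set.Iio s, Module.End.eigenspace (R : F →ₗ[ℂ] F) ((σ : ℝ) : ℂ)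
    with hK
  set K' : Submodule ℂ F := ⨆ σ : Set.Ici s, Module.End.eigenspace (R : F →ₗ[ℂ] F) ((σ : ℝ) : ℂ)
    with hK'
  have hle : ⨆ μ : ℂ, Module.End.eigenspace (R : F →ₗ[ℂ] F) μ ≤ K ⊔ K' := by
    refine iSup_le fun μ => ?_
    by_cases hμ : Module.End.HasEigenvalue (R : F →ₗ[ℂ] F) μ
    · have hreal : ((μ.re : ℝ) : ℂ) = μ := Complex.conj_eq_iff_re.1 (hR.conj_eigenvalue_eq_self hμ)
      rcases lt_or_ge μ.re s with h | h
      · refine le_trans ?_ le_sup_left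
        rw [hK]
        refine le_trans ?_ (le_iSup _ (⟨μ.re, h⟩ : Set.Iio s))
        simp only [hreal, le_refl]
      · refine le_trans ?_ le_sup_right
        rw [hK']
        refine le_trans ?_ (le_iSup _ (⟨μ.re, h⟩ : Set.Ici s))
        simp only [hreal, le_refl]
    · rw [Module.End.HasEigenvalue, Module.End.HasUnifEigenvalue, not_not] at hμ
      exact hμ.le.trans bot_le
  have hbot : (K ⊔ K')ᗮ = ⊥ := by
    rw [eq_bot_iff, ← R.orthogonalComplement_iSup_eigenspaces_eq_bot hc hR]
    exact Submodule.orthogonal_le hle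
  have horth : K ≤ K'ᗮ := by
    rw [hK, hK']
    refine iSup_le fun σ x hx => ?_
    rw [← Submodule.iInf_orthogonal]
    refine Submodule.mem_iInf _ |>.2 fun τ => ?_
    rw [Submodule.mem_orthogonal]
    intro y hy
    have hne : ((τ : ℝ) : ℂ) ≠ ((σ : ℝ) : ℂ) := by
      have h1 : (σ : ℝ) < s := σ.2
      have h2 : s ≤ (τ : ℝ) := τ.2
      intro h
      have := Complex.ofReal_injective h
      linarith
    exact hR.orthogonalFamily_eigenspaces hne ⟨y, hy⟩ ⟨x, hx⟩
  have huK : u ∈ K.topologicalClosure := by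
    have hu' : u ∈ K'ᗮ := (Submodule.mem_orthogonal _ _).2 hu
    rw [← Submodule.orthogonal_orthogonal_eq_closure]
    have hclosed : IsClosed (K.topologicalClosure : Set F) := K.isClosed_topologicalClosure
    have : CompleteSpace K.topologicalClosure := hclosed.completeSpace_coe
    obtain ⟨p, hp, q, hq, rfl⟩ := K.topologicalClosure.exists_add_mem_mem_orthogonal u
    have hpK' : p ∈ K'ᗮ := (Submodule.topologicalClosure_minimal _ horth
      (Submodule.isClosed_orthogonal _)) hp
    have hqK : q ∈ Kᗮ := Submodule.orthogonal_le K.le_topologicalClosure hq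
    have hqK' : q ∈ K'ᗮ := by simpa using Submodule.sub_mem _ hu' hpK'
    have : q ∈ (K ⊔ K')ᗮ := by
      rw [← Submodule.inf_orthogonal]; exact ⟨hqK, hqK'⟩
    rw [hbot, Submodule.mem_bot] at this
    rw [this, add_zero, Submodule.orthogonal_orthogonal_eq_closure]
    exact hp
  have hclosed : IsClosed {x : F | (inner ℂ x (R x)).re ≤ s * ‖x‖ ^ 2} :=
    isClosed_le (by fun_prop) (by fun_prop)
  refine closure_minimal (s := (K : Set F)) ?_ hclosed huK
  intro x hx
  have h1 := form_le_of_mem_iSup (R := (R : F →ₗ[ℂ] F)) hdR (I := Set.Iio s) (s := s)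
    (fun σ hσ => (show σ < s from hσ).le) hx
  have h2 : d.quad x = ‖x‖ ^ 2 := by
    rw [NonnegForm.quad, hd, inner_self_eq_norm_sq_to_K]; norm_cast
  rw [h2, hd] at h1
  exact h1

end Spectral

/-! ### Comparison of eigenvalues by dimension counting -/

section Weyl

variable {Y : Type*} [NormedAddCommGroup Y] [NormedSpace ℂ Y]

theorem form_le_of_orthogonal_eigenspaces [CompleteSpace Y] {d : NonnegForm Y}
    (hd : d.IsEquivNorm) {R : Y →ₗ[ℂ] Y} (hc : IsCompactOperator R)
    (hR : ∀ x y, d.toForm (R x) y = d.toForm x (R y)) {s : ℝ} {u : Y}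
    (hu : ∀ e ∈ ⨆ σ : Set.Ici s, Module.End.eigenspace R ((σ : ℝ) : ℂ), d.toForm u e = 0) :
    (d.toForm (R u) u).re ≤ s * d.quad u := by
  let e := d.toFormSpace hd
  let R₁ : Y →L[ℂ] Y := ⟨R, hc.continuous⟩
  let R' : d.FormSpace hd →L[ℂ] d.FormSpace hd :=
    (e : Y →L[ℂ] d.FormSpace hd) ∘L R₁ ∘L (e.symm : d.FormSpace hd →L[ℂ] Y)
  have hR' : ∀ x, R' (e x) = e (R x) := fun x => by simp [R', R₁]
  have hc' : IsCompactOperator R' := by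
    have h1 : IsCompactOperator (R₁ ∘ (e.symm : d.FormSpace hd →L[ℂ] Y)) :=
      IsCompactOperator.comp_clm (f := R₁) hc _
    exact h1.clm_comp (e : Y →L[ℂ] d.FormSpace hd)
  have hsym : (R' : d.FormSpace hd →ₗ[ℂ] d.FormSpace hd).IsSymmetric := by
    intro x y
    obtain ⟨x, rfl⟩ := e.surjective x
    obtain ⟨y, rfl⟩ := e.surjective y
    change inner ℂ (R' (e x)) (e y) = inner ℂ (e x) (R' (e y))
    rw [hR', hR', NonnegForm.inner_toFormSpace, NonnegForm.inner_toFormSpace, hR]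
  let d' : NonnegForm (d.FormSpace hd) := d.comap (e.symm : d.FormSpace hd →ₗ[ℂ] Y)
  have key := inner_le_of_orthogonal_eigenspaces hc' hsym d'
    (fun x y => by
      obtain ⟨x, rfl⟩ := e.surjective x
      obtain ⟨y, rfl⟩ := e.surjective y
      rw [NonnegForm.inner_toFormSpace]
      simp [d'])
    (s := s) (u := e u) (by
      intro x hx
      have hmap : (⨆ σ : Set.Ici s, Module.End.eigenspace
          (R' : d.FormSpace hd →ₗ[ℂ] d.FormSpace hd) ((σ : ℝ) : ℂ)) ≤
          (⨆ σ : Set.Ici s, Module.End.eigenspace R ((σ : ℝ) : ℂ)).map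
            (e : Y →ₗ[ℂ] d.FormSpace hd) := by
        refine iSup_le fun σ y hy => ?_
        obtain ⟨y, rfl⟩ := e.surjective y
        refine Submodule.mem_map_of_mem (f := (e : Y →ₗ[ℂ] d.FormSpace hd)) ?_
        refine Submodule.mem_iSup_of_mem σ ?_
        rw [Module.End.mem_eigenspace_iff] at hy ⊢
        apply e.injective
        rw [← hR', map_smul]
        exact hy
      obtain ⟨y, hy, rfl⟩ := hmap hx
      change inner ℂ (e y) (e u) = 0
      rw [NonnegForm.inner_toFormSpace]
      exact hu y hy)
  rw [hR', NonnegForm.inner_toFormSpace, NonnegForm.norm_toFormSpace, NonnegForm.nrm_sq] at key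
  exact key

/-- With g = μu and Rg = u, contractivity reads d[u] ≤ μ d[u], which forces u = 0 when μ < 1. -/
theorem IsContractiveSymm.eigenspace_eq_bot {d : NonnegForm Y} (hd : d.IsEquivNorm)
    {R : Y →ₗ[ℂ] Y} (hR : IsContractiveSymm d R) {T : Y →ₗ.[ℂ] Y} (hT : IsInverse T R) {μ : ℝ}
    (hμ : μ < 1) : eigenspace T (μ : ℂ) = ⊥ := by
  rw [eq_bot_iff]
  intro u hu
  rw [mem_eigenspace_iff hT] at hu
  have h := hR.quad_le ((μ : ℂ) • u)
  rw [hu, map_smulₛₗ, Complex.conj_ofReal, d.apply_self, smul_eq_mul, ← Complex.ofReal_mul,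
    Complex.ofReal_re] at h
  have h2 : d.quad u = 0 := by nlinarith [d.quad_nonneg u]
  exact hd.eq_zero (by rw [d.apply_self, h2, Complex.ofReal_zero])

/-- The inversion μ ↦ 1/μ matches (0, t] with [1/t, ∞). The remaining non-positive μ carry no
eigenvectors, by contractivity. -/
theorem iSup_eigenspace_eq {d : NonnegForm Y} (hd : d.IsEquivNorm)
    {R : Y →ₗ[ℂ] Y} (hR : IsContractiveSymm d R) {T : Y →ₗ.[ℂ] Y} (hT : IsInverse T R) {t : ℝ}
    (ht : 0 < t) : (⨆ μ : Set.Iic t, eigenspace T (((μ : ℝ) : ℂ))) =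
      ⨆ σ : Set.Ici t⁻¹, Module.End.eigenspace R ((σ : ℝ) : ℂ) := by
  have key : ∀ μ : ℝ, 0 < μ → eigenspace T (μ : ℂ) = Module.End.eigenspace R ((μ⁻¹ : ℝ) : ℂ) := by
    intro μ hμ
    have hμ' : (μ : ℂ) ≠ 0 := Complex.ofReal_ne_zero.2 hμ.ne'
    ext u
    rw [mem_eigenspace_iff hT, Module.End.mem_eigenspace_iff, map_smul, Complex.ofReal_inv,
      eq_inv_smul_iff₀ hμ']
  apply le_antisymm
  · refine iSup_le fun μ => ?_
    rcases lt_or_ge (μ : ℝ) 1 with h | h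
    · rw [hR.eigenspace_eq_bot hd hT h]; exact bot_le
    · have h0 : 0 < (μ : ℝ) := by linarith
      rw [key _ h0]
      exact le_iSup (fun σ : Set.Ici t⁻¹ => Module.End.eigenspace R ((σ : ℝ) : ℂ))
        ⟨(μ : ℝ)⁻¹, inv_anti₀ h0 μ.2⟩
  · refine iSup_le fun σ => ?_
    have h0 : 0 < (σ : ℝ) := lt_of_lt_of_le (inv_pos.2 ht) σ.2
    have := key (σ : ℝ)⁻¹ (inv_pos.2 h0)
    rw [inv_inv] at this
    rw [← this]
    exact le_iSup (fun μ : Set.Iic t => eigenspace T (((μ : ℝ) : ℂ)))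
      ⟨(σ : ℝ)⁻¹, inv_le_of_inv_le₀ ht σ.2⟩

/-- The set whose infimum is the `k`-th eigenvalue. -/
def eigenvalueSet (T : Y →ₗ.[ℂ] Y) (k : ℕ) : Set ℝ :=
  {t : ℝ | (k : Cardinal) ≤ Module.rank ℂ ↥(⨆ μ : Set.Iic t, eigenspace T (((μ : ℝ) : ℂ)))}

theorem one_le_of_mem_eigenvalueSet {d : NonnegForm Y} (hd : d.IsEquivNorm)
    {R : Y →ₗ[ℂ] Y} (hR : IsContractiveSymm d R) {T : Y →ₗ.[ℂ] Y} (hT : IsInverse T R) {k : ℕ}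
    (hk : 1 ≤ k) {t : ℝ} (ht : t ∈ eigenvalueSet T k) : 1 ≤ t := by
  by_contra! h
  have h1 : (⨆ μ : Set.Iic t, eigenspace T (((μ : ℝ) : ℂ))) = ⊥ := by
    rw [eq_bot_iff]
    refine iSup_le fun μ => ?_
    rw [hR.eigenspace_eq_bot hd hT (lt_of_le_of_lt μ.2 h)]
  rw [eigenvalueSet, Set.mem_ofPred_eq, h1, rank_bot] at ht
  have : k ≤ 0 := by exact_mod_cast ht
  omega

variable {Y' : Type*} [NormedAddCommGroup Y'] [NormedSpace ℂ Y']

/-- Weyl's argument: if the spectral space `U'` of `R'` for eigenvalues ≥ σ had dimension below k,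
some nonzero u in the spectral space `U` of `R` for eigenvalues ≥ 1/t would have Φu orthogonal to
`U'`. Then (1/t - δ) d[u] ≤ d'(R'Φu, Φu) ≤ σ d'[Φu] ≤ σ d[u], against σ < 1/t - δ. -/
theorem mem_eigenvalueSet_of_form_le [CompleteSpace Y'] {d : NonnegForm Y} (hd : d.IsEquivNorm)
    {R : Y →ₗ[ℂ] Y} (hR : IsContractiveSymm d R) {T : Y →ₗ.[ℂ] Y} (hT : IsInverse T R)
    {d' : NonnegForm Y'} (hd' : d'.IsEquivNorm) {R' : Y' →ₗ[ℂ] Y'} (hR' : IsContractiveSymm d' R')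
    (hc' : IsCompactOperator R') {T' : Y' →ₗ.[ℂ] Y'} (hT' : IsInverse T' R')
    (Φ : Y →ₗ[ℂ] Y') (hΦ : ∀ y, d'.quad (Φ y) ≤ d.quad y) {δ : ℝ}
    (hRR : ∀ y, (d.toForm (R y) y).re - δ * d.quad y ≤ (d'.toForm (R' (Φ y)) (Φ y)).re)
    {k : ℕ} {t σ : ℝ} (ht : 0 < t) (hkt : t ∈ eigenvalueSet T k) (hσ : 0 < σ) (hσt : σ < t⁻¹ - δ) :
    σ⁻¹ ∈ eigenvalueSet T' k := by
  rw [eigenvalueSet, Set.mem_ofPred_eq] at hkt ⊢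
  rw [iSup_eigenspace_eq hd' hR' hT' (inv_pos.2 hσ), inv_inv]
  rw [iSup_eigenspace_eq hd hR hT ht] at hkt
  set U := ⨆ τ : Set.Ici t⁻¹, Module.End.eigenspace R ((τ : ℝ) : ℂ)
  set U' := ⨆ τ : Set.Ici σ, Module.End.eigenspace R' ((τ : ℝ) : ℂ) with hU'
  by_contra! hlt
  have : FiniteDimensional ℂ U' :=
    Module.rank_lt_aleph0_iff.1 (hlt.trans (Cardinal.natCast_lt_aleph0))
  let B := Module.finBasis ℂ U'
  -- The components of `f` are the pairings of Φu with a basis of `U'`; injectivity of `f` bounds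
  -- dim `U` by dim `U'`.
  let f : U →ₗ[ℂ] (Fin (Module.finrank ℂ U') → ℂ) :=
    LinearMap.pi fun i => ((d'.toForm.flip (B i : Y')) ∘ₗ Φ) ∘ₗ U.subtype
  have hf : Function.Injective f := by
    rw [injective_iff_map_eq_zero]
    intro u hu
    have h1 : ∀ e ∈ U', d'.toForm (Φ u) e = 0 := by
      intro e he
      have h2 : ∀ i, d'.toForm (Φ u) (B i) = 0 := fun i => congrFun hu i
      have h3 := B.sum_repr ⟨e, he⟩
      have h4 : e = ∑ i, B.repr ⟨e, he⟩ i • (B i : Y') := by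
        have h5 := congrArg U'.subtype h3
        simp only [map_sum, map_smul, Submodule.subtype_apply] at h5
        exact h5.symm
      rw [h4, map_sum]
      refine Finset.sum_eq_zero fun i _ => ?_
      rw [map_smulₛₗ, h2, smul_zero]
    have h2 := form_le_of_orthogonal_eigenspaces hd' hc' hR'.symm h1
    have h3 := hRR u
    have h4 := le_form_of_mem_iSup (s := t⁻¹) hR.symm (fun τ hτ => hτ) u.2
    have h5 := hΦ u
    have h6 := d.quad_nonneg (u : Y)
    have h7 : d.quad (u : Y) = 0 := by
      have h8 : σ * d'.quad (Φ u) ≤ σ * d.quad (u : Y) := by gcongr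
      nlinarith
    exact Subtype.ext (hd.eq_zero (by rw [d.apply_self, h7, Complex.ofReal_zero]))
  have h1 := LinearMap.lift_rank_le_of_injective f hf
  have h2 : Module.rank ℂ U ≤ Module.finrank ℂ U' := by
    simpa using h1
  have h3 : (k : Cardinal) ≤ Module.finrank ℂ U' := hkt.trans h2
  rw [← Module.finrank_eq_rank ℂ U'] at hlt
  have h4 : k ≤ Module.finrank ℂ U' := by exact_mod_cast h3
  have h5 : Module.finrank ℂ U' < k := by exact_mod_cast hlt
  omega

theorem inv_eigenvalue_sub_le [CompleteSpace Y'] {d : NonnegForm Y} (hd : d.IsEquivNorm)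
    {R : Y →ₗ[ℂ] Y} (hR : IsContractiveSymm d R) {T : Y →ₗ.[ℂ] Y} (hT : IsInverse T R)
    {d' : NonnegForm Y'} (hd' : d'.IsEquivNorm) {R' : Y' →ₗ[ℂ] Y'} (hR' : IsContractiveSymm d' R')
    (hc' : IsCompactOperator R') {T' : Y' →ₗ.[ℂ] Y'} (hT' : IsInverse T' R')
    (Φ : Y →ₗ[ℂ] Y') (hΦ : ∀ y, d'.quad (Φ y) ≤ d.quad y) {δ : ℝ} (hδ : 0 ≤ δ)
    (hRR : ∀ y, (d.toForm (R y) y).re - δ * d.quad y ≤ (d'.toForm (R' (Φ y)) (Φ y)).re)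
    {k : ℕ} (hk : 1 ≤ k) :
    1 / eigenvalue T k - 1 / eigenvalue T' k ≤ δ := by
  have hT1 : ∀ t ∈ eigenvalueSet T k, 1 ≤ t := fun t =>
    one_le_of_mem_eigenvalueSet hd hR hT hk
  have hT1' : ∀ t ∈ eigenvalueSet T' k, 1 ≤ t := fun t =>
    one_le_of_mem_eigenvalueSet hd' hR' hT' hk
  have h0' : 0 ≤ eigenvalue T' k := Real.sInf_nonneg fun t ht => zero_le_one.trans (hT1' t ht)
  -- If `T` has no k-th eigenvalue, then sInf ∅ = 0 and 1/0 = 0, and the inequality is trivial.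
  rcases (eigenvalueSet T k).eq_empty_or_nonempty with h | hne
  · have : eigenvalue T k = 0 := by
      change sInf (eigenvalueSet T k) = 0
      rw [h, Real.sInf_empty]
    rw [this]
    have := one_div_nonneg.2 h0'
    simp only [div_zero]
    linarith
  have h1 : 1 ≤ eigenvalue T k := le_csInf hne hT1
  by_contra! hlt
  -- Such a σ is positive and gives σ⁻¹ in the k-th set of `T'`, hence σ ≤ 1/λ'. This also covers
  -- the case where that set was not known to be nonempty.
  obtain ⟨σ, hσ1, hσ2⟩ := exists_between (show 1 / eigenvalue T' k < 1 / eigenvalue T k - δ by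
    linarith)
  have hσ : 0 < σ := lt_of_le_of_lt (one_div_nonneg.2 h0') hσ1
  have h2 : eigenvalue T k < (σ + δ)⁻¹ := by
    rw [lt_inv_comm₀ (by linarith) (by linarith), ← one_div]
    linarith
  obtain ⟨t, ht, htlt⟩ := exists_lt_of_csInf_lt hne h2
  have ht0 : 0 < t := lt_of_lt_of_le one_pos (hT1 t ht)
  have h3 : σ < t⁻¹ - δ := by
    have := (lt_inv_comm₀ ht0 (by linarith : 0 < σ + δ)).1 htlt
    linarith
  have h4 := mem_eigenvalueSet_of_form_le hd hR hT hd' hR' hc' hT' Φ hΦ hRR ht0 ht hσ h3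
  have h5 : eigenvalue T' k ≤ σ⁻¹ := csInf_le ⟨1, fun t ht => hT1' t ht⟩ h4
  have h6 : 1 ≤ eigenvalue T' k := le_csInf ⟨_, h4⟩ hT1'
  have h7 : σ ≤ 1 / eigenvalue T' k := by
    rw [one_div]
    exact (le_inv_comm₀ (by linarith) hσ).1 h5
  linarith

end Weyl

/-! ### Uniform estimates with a single constant -/

namespace Setting

open Filter

variable {n : ℕ} {H 𝓗 : Type*} [NormedAddCommGroup H] [InnerProductSpace ℂ H]
  [NormedAddCommGroup 𝓗] [InnerProductSpace ℂ 𝓗] (S : Setting n H 𝓗)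

theorem nrm_sq_eq (θ : Param n) (u : H) : S.nrm θ u ^ 2 = (S.a θ).quad u + (S.b θ).quad u := by
  rw [nrm, NonnegForm.nrm_sq, NonnegForm.add_quad]

theorem nrm_nonneg (θ : Param n) (u : H) : 0 ≤ S.nrm θ u := NonnegForm.nrm_nonneg _ _

theorem a_nrm_le (θ : Param n) (u : H) : (S.a θ).nrm u ≤ S.nrm θ u :=
  Real.sqrt_le_sqrt (by rw [NonnegForm.add_quad]; linarith [(S.b θ).quad_nonneg u])

theorem b_nrm_le (θ : Param n) (u : H) : (S.b θ).nrm u ≤ S.nrm θ u :=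
  Real.sqrt_le_sqrt (by rw [NonnegForm.add_quad]; linarith [(S.a θ).quad_nonneg u])

theorem mem_V_iff {θ : Param n} {v : H} : v ∈ S.V θ ↔ (S.a θ).toForm v v = 0 := Iff.rfl

theorem a_apply_left {θ : Param n} {v : H} (hv : v ∈ S.V θ) (u : H) : (S.a θ).toForm v u = 0 :=
  ((S.a θ).apply_eq_zero hv u).1

theorem a_apply_right {θ : Param n} {v : H} (hv : v ∈ S.V θ) (u : H) : (S.a θ).toForm u v = 0 :=
  ((S.a θ).apply_eq_zero hv u).2

theorem nrm_sq_of_mem_V {θ : Param n} {v : H} (hv : v ∈ S.V θ) :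
    S.nrm θ v ^ 2 = (S.b θ).quad v := by
  rw [nrm_sq_eq, NonnegForm.quad, (S.mem_V_iff).1 hv]; simp

theorem eventually_norm_le_nrm (h0 : (0 : Param n) ∈ S.Θ) :
    ∀ᶠ C : ℝ in atTop, ∀ θ ∈ S.Θ, ∀ u, ‖u‖ ≤ C * S.nrm θ u := by
  obtain ⟨c, hc, C, hC, h⟩ := S.isEquivNorm_add 0 h0
  obtain ⟨K, hK, hK'⟩ := S.uniform_equiv
  filter_upwards [eventually_ge_atTop (K / c)] with D hD θ hθ u
  have h1 := (h u).1.trans (hK' 0 h0 θ hθ u)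
  calc ‖u‖ ≤ K / c * S.nrm θ u := by
        rw [div_mul_eq_mul_div, le_div_iff₀ hc, mul_comm]; exact h1
    _ ≤ _ := mul_le_mul_of_nonneg_right hD (S.nrm_nonneg _ _)

theorem eventually_nrm_le_norm (h0 : (0 : Param n) ∈ S.Θ) :
    ∀ᶠ C : ℝ in atTop, ∀ θ ∈ S.Θ, ∀ u, S.nrm θ u ≤ C * ‖u‖ := by
  obtain ⟨c, hc, C, hC, h⟩ := S.isEquivNorm_add 0 h0
  obtain ⟨K, hK, hK'⟩ := S.uniform_equiv
  filter_upwards [eventually_ge_atTop (K * C)] with D hD θ hθ u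
  calc S.nrm θ u ≤ K * (S.nrm 0 u) := hK' θ hθ 0 h0 u
    _ ≤ K * (C * ‖u‖) := by gcongr; exact (h u).2
    _ = K * C * ‖u‖ := by ring
    _ ≤ _ := by gcongr

/-- The uniform comparison of the norms `S.nrm θ` with the norm of `H`. -/
structure NormBounds (B : ℝ) : Prop where
  one_le : 1 ≤ B
  zero_mem : (0 : Param n) ∈ S.Θ
  norm_le : ∀ θ ∈ S.Θ, ∀ u, ‖u‖ ≤ B * S.nrm θ u
  nrm_le : ∀ θ ∈ S.Θ, ∀ u, S.nrm θ u ≤ B * ‖u‖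

theorem exists_normBounds (h0 : (0 : Param n) ∈ S.Θ) : ∃ B, S.NormBounds B := by
  obtain ⟨B, h1, h2, h3⟩ := ((eventually_ge_atTop 1).and
    ((S.eventually_norm_le_nrm h0).and (S.eventually_nrm_le_norm h0))).exists
  exact ⟨B, h1, h0, h2, h3⟩

variable {S} {B : ℝ} (hB : S.NormBounds B)
include hB

theorem NormBounds.pos : 0 < B := lt_of_lt_of_le one_pos hB.one_le

/-- Replacing `S.nrm` by the norm of `H` in a bilinear estimate. -/
theorem NormBounds.mul_nrm_le {θ θ' : Param n} (hθ : θ ∈ S.Θ) (hθ' : θ' ∈ S.Θ) {x D : ℝ} (hD : 0 ≤ D)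
    {u v : H} (h : x ≤ D * S.nrm θ u * S.nrm θ' v) : x ≤ D * B ^ 2 * ‖u‖ * ‖v‖ := by
  have hB0 := hB.pos
  calc x ≤ D * S.nrm θ u * S.nrm θ' v := h
    _ ≤ D * (B * ‖u‖) * (B * ‖v‖) := by
        gcongr
        · exact S.nrm_nonneg _ _
        · exact hB.nrm_le θ hθ u
        · exact hB.nrm_le θ' hθ' v
    _ = _ := by ring

theorem NormBounds.eventually_a_le :
    ∀ᶠ C : ℝ in atTop, ∀ θ ∈ S.Θ, ∀ u v, ‖(S.a θ).toForm u v‖ ≤ C * ‖u‖ * ‖v‖ := by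
  filter_upwards [eventually_ge_atTop (1 * B ^ 2)] with C hC θ hθ u v
  have h : ‖(S.a θ).toForm u v‖ ≤ 1 * S.nrm θ u * S.nrm θ v := by
    rw [one_mul]
    exact ((S.a θ).norm_apply_le u v).trans (mul_le_mul (S.a_nrm_le θ u) (S.a_nrm_le θ v)
      (NonnegForm.nrm_nonneg _ _) (S.nrm_nonneg _ _))
  exact (hB.mul_nrm_le hθ hθ zero_le_one h).trans (by gcongr)

theorem NormBounds.eventually_b_le :
    ∀ᶠ C : ℝ in atTop, ∀ θ ∈ S.Θ, ∀ u v, ‖(S.b θ).toForm u v‖ ≤ C * ‖u‖ * ‖v‖ := by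
  filter_upwards [eventually_ge_atTop (1 * B ^ 2)] with C hC θ hθ u v
  have h : ‖(S.b θ).toForm u v‖ ≤ 1 * S.nrm θ u * S.nrm θ v := by
    rw [one_mul]
    exact ((S.b θ).norm_apply_le u v).trans (mul_le_mul (S.b_nrm_le θ u) (S.b_nrm_le θ v)
      (NonnegForm.nrm_nonneg _ _) (S.nrm_nonneg _ _))
  exact (hB.mul_nrm_le hθ hθ zero_le_one h).trans (by gcongr)

theorem NormBounds.eventually_a_sub_le :
    ∀ᶠ C : ℝ in atTop, ∀ θ ∈ S.Θ, ∀ u v,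
      ‖(S.a θ).toForm u v - (S.a 0).toForm u v‖ ≤ C * ‖θ‖ * ‖u‖ * ‖v‖ := by
  obtain ⟨L, hL, h⟩ := S.lipschitz_a
  filter_upwards [eventually_ge_atTop (L * B ^ 2)] with C hC θ hθ u v
  have h1 := h θ hθ 0 hB.zero_mem u v
  rw [sub_zero] at h1
  calc _ ≤ L * ‖θ‖ * B ^ 2 * ‖u‖ * ‖v‖ := hB.mul_nrm_le hθ hθ (by positivity) h1
    _ = L * B ^ 2 * ‖θ‖ * ‖u‖ * ‖v‖ := by ring
    _ ≤ _ := by gcongr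

theorem NormBounds.eventually_gap_zero (h1 : S.GapCondition) :
    ∀ᶠ C : ℝ in atTop, ∀ w ∈ S.W 0, ‖w‖ ^ 2 ≤ C * (S.a 0).quad w := by
  obtain ⟨ν, hν, h⟩ := h1 0 hB.zero_mem
  have hB0 := hB.pos
  filter_upwards [eventually_ge_atTop (B ^ 2 / ν)] with C hC w hw
  calc ‖w‖ ^ 2 ≤ (B * S.nrm 0 w) ^ 2 := by gcongr; exact hB.norm_le 0 hB.zero_mem w
    _ = B ^ 2 / ν * (ν * S.nrm 0 w ^ 2) := by field_simp
    _ ≤ B ^ 2 / ν * (S.a 0).quad w := by gcongr; exact h w hw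
    _ ≤ _ := mul_le_mul_of_nonneg_right hC ((S.a 0).quad_nonneg w)

theorem NormBounds.eventually_gap (h3 : S.QuadraticGap) :
    ∀ᶠ C : ℝ in atTop, ∀ θ ∈ S.Θ, ∀ w ∈ S.W θ, ‖θ‖ ^ 2 * ‖w‖ ^ 2 ≤ C * (S.a θ).quad w := by
  obtain ⟨γ, hγ, h⟩ := h3
  have hB0 := hB.pos
  filter_upwards [eventually_ge_atTop (B ^ 2 / γ)] with C hC θ hθ w hw
  calc ‖θ‖ ^ 2 * ‖w‖ ^ 2 ≤ ‖θ‖ ^ 2 * (B * S.nrm θ w) ^ 2 := by gcongr; exact hB.norm_le θ hθ w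
    _ = B ^ 2 / γ * (γ * ‖θ‖ ^ 2 * S.nrm θ w ^ 2) := by field_simp
    _ ≤ B ^ 2 / γ * (S.a θ).quad w := by gcongr; exact h θ hθ w hw
    _ ≤ _ := mul_le_mul_of_nonneg_right hC ((S.a θ).quad_nonneg w)

theorem NormBounds.eventually_near {Vstar : Submodule ℂ H} (h2 : S.RemovableSingularity Vstar) :
    ∀ᶠ C : ℝ in atTop, ∀ θ₁ ∈ S.Θ, ∀ θ₂ ∈ S.Θ, ∀ v₁ ∈ S.Vst Vstar θ₁, ∃ v₂ ∈ S.Vst Vstar θ₂,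
      ‖v₁ - v₂‖ ≤ C * ‖θ₁ - θ₂‖ * ‖v₁‖ := by
  obtain ⟨_, L, hL, h⟩ := h2
  have hB0 := hB.pos
  -- The infimum in (H2) need not be attained. Enlarging `L` to `L + 1` leaves room for a
  -- near-minimiser, provided the right-hand side is positive; hence the two trivial cases.
  filter_upwards [eventually_ge_atTop (B * ((L + 1) * B))] with C hC θ₁ hθ₁ θ₂ hθ₂ v₁ hv₁
  by_cases hθ : θ₁ = θ₂
  · exact ⟨v₁, hθ ▸ hv₁, by simp [hθ]⟩
  by_cases hv : v₁ = 0
  · exact ⟨0, Submodule.zero_mem _, by simp [hv]⟩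
  have hv' : 0 < ‖v₁‖ := norm_pos_iff.2 hv
  have hθ' : 0 < ‖θ₁ - θ₂‖ := norm_pos_iff.2 (sub_ne_zero.2 hθ)
  have h1 : (⨅ v₂ : S.Vst Vstar θ₂, S.nrm θ₂ (v₁ - v₂)) < (L + 1) * B * ‖θ₁ - θ₂‖ * ‖v₁‖ :=
    calc _ ≤ L * ‖θ₁ - θ₂‖ * S.nrm θ₁ v₁ := h θ₁ hθ₁ θ₂ hθ₂ v₁ hv₁
      _ ≤ L * ‖θ₁ - θ₂‖ * (B * ‖v₁‖) := by gcongr; exact hB.nrm_le θ₁ hθ₁ v₁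
      _ < L * ‖θ₁ - θ₂‖ * (B * ‖v₁‖) + B * ‖θ₁ - θ₂‖ * ‖v₁‖ := by
          have : 0 < B * ‖θ₁ - θ₂‖ * ‖v₁‖ := by positivity
          linarith
      _ = _ := by ring
  obtain ⟨v₂, hv₂⟩ := exists_lt_of_ciInf_lt h1
  refine ⟨v₂, v₂.2, ?_⟩
  calc ‖v₁ - v₂‖ ≤ B * S.nrm θ₂ (v₁ - v₂) := hB.norm_le θ₂ hθ₂ _
    _ ≤ B * ((L + 1) * B * ‖θ₁ - θ₂‖ * ‖v₁‖) := by gcongr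
    _ = B * ((L + 1) * B) * ‖θ₁ - θ₂‖ * ‖v₁‖ := by ring
    _ ≤ _ := by gcongr

/-- The strengthened Cauchy–Schwarz inequality with `K` < 1 gives ‖v + z‖_0² ≥ (1 - K)(‖v‖_0² +
‖z‖_0²), so both projections of V_⋆ ∔ Z are bounded. -/
theorem NormBounds.eventually_direct {Vstar : Submodule ℂ H} {Z : Submodule ℂ (S.V 0)}
    (hZ : S.IsDefectSpace Vstar Z) :
    ∀ᶠ C : ℝ in atTop, ∀ v ∈ Vstar, ∀ z ∈ Z, ‖v‖ ≤ C * ‖v + z‖ ∧ ‖(z : H)‖ ≤ C * ‖v + z‖ := by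
  obtain ⟨_, _, _, K, hK0, hK1, h⟩ := hZ
  have hB0 := hB.pos
  have hK : 0 < 1 - K := by linarith
  filter_upwards [eventually_ge_atTop (B * ((1 - K)⁻¹ * B))] with C hC v hv z hz
  have h0 := hB.zero_mem
  have e : S.nrm 0 (v + z) ^ 2 = S.nrm 0 v ^ 2 + S.nrm 0 (z : H) ^ 2 +
      2 * ((S.a 0 + S.b 0).toForm v z).re := by
    simp only [Setting.nrm, NonnegForm.nrm_sq]
    have := congrArg Complex.re ((S.a 0 + S.b 0).conj_symm v z)
    rw [Complex.conj_re] at this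
    simp only [NonnegForm.quad, map_add, LinearMap.add_apply, Complex.add_re]
    linarith
  have hre := (abs_le.1 ((Complex.abs_re_le_norm _).trans (h v hv z hz))).1
  have hv0 := S.nrm_nonneg 0 v
  have hz0 := S.nrm_nonneg 0 (z : H)
  have key : (1 - K) * (S.nrm 0 v ^ 2 + S.nrm 0 (z : H) ^ 2) ≤ S.nrm 0 (v + z) ^ 2 := by
    nlinarith [sq_nonneg (S.nrm 0 v - S.nrm 0 (z : H))]
  have fin : ∀ x : H, (1 - K) * S.nrm 0 x ^ 2 ≤ S.nrm 0 (v + z) ^ 2 → ‖x‖ ≤ C * ‖v + z‖ := by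
    intro x hx
    have h1 : (1 - K) * S.nrm 0 x ≤ S.nrm 0 (v + z) := by
      refine abs_le_of_sq_le_sq' ?_ (S.nrm_nonneg _ _) |>.2
      have : 0 ≤ S.nrm 0 x ^ 2 := sq_nonneg _
      calc ((1 - K) * S.nrm 0 x) ^ 2 = (1 - K) * ((1 - K) * S.nrm 0 x ^ 2) := by ring
        _ ≤ 1 * ((1 - K) * S.nrm 0 x ^ 2) := by
            gcongr
            linarith
        _ ≤ _ := by rw [one_mul]; exact hx
    calc ‖x‖ ≤ B * S.nrm 0 x := hB.norm_le 0 h0 x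
      _ ≤ B * ((1 - K)⁻¹ * S.nrm 0 (v + z)) := by
          gcongr; rw [← div_eq_inv_mul, le_div_iff₀ hK, mul_comm]; exact h1
      _ ≤ B * ((1 - K)⁻¹ * (B * ‖v + z‖)) := by gcongr; exact hB.nrm_le 0 h0 _
      _ = B * ((1 - K)⁻¹ * B) * ‖v + z‖ := by ring
      _ ≤ _ := by gcongr
  constructor
  · exact fin v (le_trans (by gcongr; linarith [sq_nonneg (S.nrm 0 (z : H))]) key)
  · exact fin z (le_trans (by gcongr; linarith [sq_nonneg (S.nrm 0 v)]) key)

theorem NormBounds.eventually_a₁ {a₁ : S.V 0 →ₗ[ℂ] H →ₗ⋆[ℂ] (Fin n → ℂ)}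
    {a₂ : S.V 0 →ₗ[ℂ] S.V 0 →ₗ⋆[ℂ] Matrix (Fin n) (Fin n) ℂ} (h4 : S.RegularAtZero a₁ a₂) :
    ∀ᶠ C : ℝ in atTop, ∀ v : S.V 0, ∀ u : H, ∀ θ ∈ S.Θ,
      ‖(S.a θ).toForm v u - a₁ v u ⬝ᵥ cvec θ‖ ≤ C * ‖θ‖ ^ 2 * ‖v‖ * ‖u‖ := by
  obtain ⟨_, ⟨K, hK, h⟩, _⟩ := h4
  filter_upwards [eventually_ge_atTop (K * B ^ 2)] with C hC v u θ hθ
  calc _ ≤ K * ‖θ‖ ^ 2 * B ^ 2 * ‖v‖ * ‖u‖ :=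
        hB.mul_nrm_le hB.zero_mem hB.zero_mem (by positivity) (h v u θ hθ)
    _ = K * B ^ 2 * ‖θ‖ ^ 2 * ‖v‖ * ‖u‖ := by ring
    _ ≤ _ := by gcongr

theorem NormBounds.eventually_a₂ {a₁ : S.V 0 →ₗ[ℂ] H →ₗ⋆[ℂ] (Fin n → ℂ)}
    {a₂ : S.V 0 →ₗ[ℂ] S.V 0 →ₗ⋆[ℂ] Matrix (Fin n) (Fin n) ℂ} (h4 : S.RegularAtZero a₁ a₂) :
    ∀ᶠ C : ℝ in atTop, ∀ v v' : S.V 0, ∀ θ ∈ S.Θ,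
      ‖(S.a θ).toForm v v' - (a₂ v v' *ᵥ cvec θ) ⬝ᵥ cvec θ‖ ≤ C * ‖θ‖ ^ 3 * ‖v‖ * ‖v'‖ := by
  obtain ⟨_, _, ⟨K, hK, h⟩⟩ := h4
  filter_upwards [eventually_ge_atTop (K * B ^ 2)] with C hC v u θ hθ
  calc _ ≤ K * ‖θ‖ ^ 3 * B ^ 2 * ‖v‖ * ‖u‖ :=
        hB.mul_nrm_le hB.zero_mem hB.zero_mem (by positivity) (h v u θ hθ)
    _ = K * B ^ 2 * ‖θ‖ ^ 3 * ‖v‖ * ‖u‖ := by ring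
    _ ≤ _ := by gcongr

theorem NormBounds.eventually_b_sub_le (h5 : S.LipschitzB) :
    ∀ᶠ C : ℝ in atTop, ∀ v ∈ S.V 0, ∀ v' ∈ S.V 0, ∀ θ ∈ S.Θ,
      ‖(S.b θ).toForm v v' - (S.b 0).toForm v v'‖ ≤ C * ‖θ‖ * ‖v‖ * ‖v'‖ := by
  obtain ⟨_, L, hL, h⟩ := h5
  filter_upwards [eventually_ge_atTop (L * B ^ 2)] with C hC v hv v' hv' θ hθ
  calc _ ≤ L * ‖θ‖ * B ^ 2 * ‖v‖ * ‖v'‖ :=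
        hB.mul_nrm_le hB.zero_mem hθ (by positivity) (h v hv v' hv' θ hθ)
    _ = L * B ^ 2 * ‖θ‖ * ‖v‖ * ‖v'‖ := by ring
    _ ≤ _ := by gcongr

theorem NormBounds.eventually_transfer {Vstar : Submodule ℂ H} {Z : Submodule ℂ (S.V 0)}
    (hV : Vstar ≤ S.V 0) {E : Param n → 𝓗 ≃ₗ[ℂ] 𝓗} (h6 : S.IsTransfer Vstar Z E) :
    ∀ᶠ C : ℝ in atTop, ∀ θ ∈ S.Θ, ∃ T : Vstar ≃ₗ[ℂ] S.Vst Vstar θ,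
      (∀ v : Vstar, S.ι (T v : H) = E θ (S.ι v)) ∧
      (∀ v v' : Vstar, (S.b θ).toForm (T v) (T v') = (S.b 0).toForm v v') ∧
      (∀ v : Vstar, ∀ z ∈ Z, ‖(S.b θ).toForm (T v) z - (S.b 0).toForm v z‖ ≤
        C * ‖θ‖ * ‖v‖ * ‖z‖) ∧
      (∀ v : Vstar, ‖T v‖ ≤ C * ‖v‖) ∧ (∀ v : Vstar, ‖v‖ ≤ C * ‖T v‖) := by
  obtain ⟨K, hK, h⟩ := h6
  have hB0 := hB.pos
  have h0 := hB.zero_mem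
  filter_upwards [eventually_ge_atTop (K * B ^ 2), eventually_ge_atTop (B * B)] with C hC hC' θ hθ
  obtain ⟨T, hT1, hT2, hT3⟩ := h θ hθ
  have hV' : ∀ v ∈ S.Vst Vstar θ, v ∈ S.V θ := by
    intro v hv
    by_cases h : θ = 0
    · rw [Setting.Vst, if_pos h] at hv; rw [h]; exact hV hv
    · rwa [Setting.Vst, if_neg h] at hv
  -- On V_0 and V_θ the norms reduce to b_0 and b_θ, which `T` intertwines; so `T` is isometric.
  have hn : ∀ v : Vstar, S.nrm θ (T v) = S.nrm 0 v := by
    intro v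
    rw [← sq_eq_sq₀ (S.nrm_nonneg _ _) (S.nrm_nonneg _ _), S.nrm_sq_of_mem_V (hV' _ (T v).2),
      S.nrm_sq_of_mem_V (hV v.2), NonnegForm.quad, NonnegForm.quad, hT2]
  refine ⟨T, hT1, hT2, fun v z hz => ?_, fun v => ?_, fun v => ?_⟩
  · calc _ ≤ K * ‖θ‖ * B ^ 2 * ‖v‖ * ‖z‖ :=
        hB.mul_nrm_le h0 h0 (by positivity) (hT3 v z hz)
    _ = K * B ^ 2 * ‖θ‖ * ‖v‖ * ‖z‖ := by ring
    _ ≤ _ := by gcongr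
  · calc ‖(T v : H)‖ ≤ B * S.nrm θ (T v) := hB.norm_le θ hθ _
      _ = B * S.nrm 0 v := by rw [hn]
      _ ≤ B * (B * ‖(v : H)‖) := by gcongr; exact hB.nrm_le 0 h0 _
      _ = B * B * ‖(v : H)‖ := by ring
      _ ≤ _ := mul_le_mul_of_nonneg_right hC' (norm_nonneg _)
  · calc ‖(v : H)‖ ≤ B * S.nrm 0 v := hB.norm_le 0 h0 _
      _ = B * S.nrm θ (T v) := by rw [hn]
      _ ≤ B * (B * ‖(T v : H)‖) := by gcongr; exact hB.nrm_le θ hθ _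
      _ = B * B * ‖(T v : H)‖ := by ring
      _ ≤ _ := mul_le_mul_of_nonneg_right hC' (norm_nonneg _)

theorem NormBounds.eventually_d_le :
    ∀ᶠ C : ℝ in atTop, ∀ θ ∈ S.Θ, ∀ u, (S.d θ).nrm (S.ι u) ≤ C * ‖u‖ := by
  filter_upwards [eventually_ge_atTop B] with C hC θ hθ u
  calc (S.d θ).nrm (S.ι u) ≤ (S.b θ).nrm u := Real.sqrt_le_sqrt (S.d_le_b θ hθ u)
    _ ≤ S.nrm θ u := S.b_nrm_le θ u
    _ ≤ B * ‖u‖ := hB.nrm_le θ hθ u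
    _ ≤ _ := by gcongr

theorem NormBounds.eventually_E_sub_le {Vstar : Submodule ℂ H} {Z : Submodule ℂ (S.V 0)}
    {E : Param n → 𝓗 ≃ₗ[ℂ] 𝓗} (h6 : S.UnitaryTransfer Vstar Z E) :
    ∀ᶠ C : ℝ in atTop, ∀ θ ∈ S.Θ, ∀ u : 𝓗,
      (S.d θ).nrm (E θ u - u) ≤ C * ‖θ‖ * (S.d 0).nrm u := by
  obtain ⟨_, _, hE0, K, hK, h⟩ := h6
  filter_upwards [eventually_ge_atTop K] with C hC θ hθ u
  have h1 := h θ hθ 0 hB.zero_mem u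
  rw [hE0, sub_zero] at h1
  refine h1.trans ?_
  have := (S.d 0).nrm_nonneg u
  gcongr

omit hB

/-- The hypotheses on `S`, with the norm of `H` and a common constant `C`. -/
structure Bounds (S : Setting n H 𝓗) (Vstar : Submodule ℂ H) (Z : Submodule ℂ (S.V 0))
    (a₁ : S.V 0 →ₗ[ℂ] H →ₗ⋆[ℂ] (Fin n → ℂ))
    (a₂ : S.V 0 →ₗ[ℂ] S.V 0 →ₗ⋆[ℂ] Matrix (Fin n) (Fin n) ℂ)
    (E : Param n → 𝓗 ≃ₗ[ℂ] 𝓗) (C : ℝ) : Prop extends S.NormBounds C where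
  zero_mem_interior : (0 : Param n) ∈ interior S.Θ
  norm_param_le : ∀ θ ∈ S.Θ, ‖θ‖ ≤ C
  a_le : ∀ θ ∈ S.Θ, ∀ u v, ‖(S.a θ).toForm u v‖ ≤ C * ‖u‖ * ‖v‖
  b_le : ∀ θ ∈ S.Θ, ∀ u v, ‖(S.b θ).toForm u v‖ ≤ C * ‖u‖ * ‖v‖
  a_sub_le : ∀ θ ∈ S.Θ, ∀ u v,
    ‖(S.a θ).toForm u v - (S.a 0).toForm u v‖ ≤ C * ‖θ‖ * ‖u‖ * ‖v‖
  gap_zero : ∀ w ∈ S.W 0, ‖w‖ ^ 2 ≤ C * (S.a 0).quad w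
  gap : ∀ θ ∈ S.Θ, ∀ w ∈ S.W θ, ‖θ‖ ^ 2 * ‖w‖ ^ 2 ≤ C * (S.a θ).quad w
  isClosed_Vstar : IsClosed (Vstar : Set H)
  near : ∀ θ₁ ∈ S.Θ, ∀ θ₂ ∈ S.Θ, ∀ v₁ ∈ S.Vst Vstar θ₁, ∃ v₂ ∈ S.Vst Vstar θ₂,
    ‖v₁ - v₂‖ ≤ C * ‖θ₁ - θ₂‖ * ‖v₁‖
  isClosed_Z : IsClosed (Z : Set (S.V 0))
  V_zero_eq : S.V 0 = S.sumSpace Vstar Z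
  disjoint : Disjoint Vstar (Z.map (S.V 0).subtype)
  direct : ∀ v ∈ Vstar, ∀ z ∈ Z, ‖v‖ ≤ C * ‖v + z‖ ∧ ‖(z : H)‖ ≤ C * ‖v + z‖
  a₁_le : ∀ v : S.V 0, ∀ u : H, ∀ θ ∈ S.Θ,
    ‖(S.a θ).toForm v u - a₁ v u ⬝ᵥ cvec θ‖ ≤ C * ‖θ‖ ^ 2 * ‖v‖ * ‖u‖
  a₂_le : ∀ v v' : S.V 0, ∀ θ ∈ S.Θ,
    ‖(S.a θ).toForm v v' - (a₂ v v' *ᵥ cvec θ) ⬝ᵥ cvec θ‖ ≤ C * ‖θ‖ ^ 3 * ‖v‖ * ‖v'‖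
  b_sub_le : ∀ v ∈ S.V 0, ∀ v' ∈ S.V 0, ∀ θ ∈ S.Θ,
    ‖(S.b θ).toForm v v' - (S.b 0).toForm v v'‖ ≤ C * ‖θ‖ * ‖v‖ * ‖v'‖
  transfer : ∀ θ ∈ S.Θ, ∃ T : Vstar ≃ₗ[ℂ] S.Vst Vstar θ,
    (∀ v : Vstar, S.ι (T v : H) = E θ (S.ι v)) ∧
    (∀ v v' : Vstar, (S.b θ).toForm (T v) (T v') = (S.b 0).toForm v v') ∧
    (∀ v : Vstar, ∀ z ∈ Z, ‖(S.b θ).toForm (T v) z - (S.b 0).toForm v z‖ ≤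
      C * ‖θ‖ * ‖v‖ * ‖z‖) ∧
    (∀ v : Vstar, ‖T v‖ ≤ C * ‖v‖) ∧ (∀ v : Vstar, ‖v‖ ≤ C * ‖T v‖)
  d_le : ∀ θ ∈ S.Θ, ∀ u, (S.d θ).nrm (S.ι u) ≤ C * ‖u‖
  d_E : ∀ θ ∈ S.Θ, ∀ u u' : 𝓗, (S.d θ).toForm (E θ u) (E θ u') = (S.d 0).toForm u u'
  E_sub_le : ∀ θ ∈ S.Θ, ∀ u : 𝓗, (S.d θ).nrm (E θ u - u) ≤ C * ‖θ‖ * (S.d 0).nrm u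

theorem exists_bounds {Vstar : Submodule ℂ H} {Z : Submodule ℂ (S.V 0)}
    {a₁ : S.V 0 →ₗ[ℂ] H →ₗ⋆[ℂ] (Fin n → ℂ)}
    {a₂ : S.V 0 →ₗ[ℂ] S.V 0 →ₗ⋆[ℂ] Matrix (Fin n) (Fin n) ℂ}
    {E : Param n → 𝓗 ≃ₗ[ℂ] 𝓗}
    (h1 : S.GapCondition) (h2 : S.RemovableSingularity Vstar) (hZ : S.IsDefectSpace Vstar Z)
    (h3 : S.QuadraticGap) (h4 : S.RegularAtZero a₁ a₂) (h5 : S.LipschitzB)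
    (h6 : S.UnitaryTransfer Vstar Z E) : ∃ C, S.Bounds Vstar Z a₁ a₂ E C := by
  have h0 : (0 : Param n) ∈ S.Θ := interior_subset h4.1
  obtain ⟨B, hB⟩ := S.exists_normBounds h0
  have hV : Vstar ≤ S.V 0 := by rw [hZ.2.1]; exact le_sup_left
  obtain ⟨ρ, hρ⟩ := S.isCompact_Θ.isBounded.exists_norm_le
  -- Each estimate persists when its constant grows, so finitely many of them share one constant.
  have key : ∀ᶠ C in atTop, S.Bounds Vstar Z a₁ a₂ E C := by
    filter_upwards [eventually_ge_atTop 1, S.eventually_norm_le_nrm h0,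
      S.eventually_nrm_le_norm h0, eventually_ge_atTop ρ, hB.eventually_a_le, hB.eventually_b_le,
      hB.eventually_a_sub_le, hB.eventually_gap_zero h1, hB.eventually_gap h3,
      hB.eventually_near h2, hB.eventually_direct hZ, hB.eventually_a₁ h4, hB.eventually_a₂ h4,
      hB.eventually_b_sub_le h5, hB.eventually_transfer hV h6.1, hB.eventually_d_le,
      hB.eventually_E_sub_le h6] with C k1 k2 k3 k4 k5 k6 k7 k8 k9 k10 k11 k12 k13 k14 k15 k16 k17
    exact ⟨⟨k1, h0, k2, k3⟩, h4.1, fun θ hθ => (hρ θ hθ).trans k4, k5, k6, k7, k8, k9, h2.1, k10,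
      hZ.1, hZ.2.1, hZ.2.2.1, k11, k12, k13, k14, k15, k16, h6.2.1, k17⟩
  exact key.exists

end Setting

/-! ### The cell problem and the homogenised form -/

theorem cvec_smul {n : ℕ} (t : ℝ) (θ : Param n) : cvec (t • θ) = (t : ℂ) • cvec θ := by
  ext i; simp [cvec]

/-- Used to compare orders in t: a coefficient bounded by a higher-order remainder vanishes. -/
theorem le_zero_of_forall_le_mul {x D t₀ : ℝ} (ht₀ : 0 < t₀)
    (h : ∀ t, 0 < t → t ≤ t₀ → x ≤ D * t) : x ≤ 0 := by
  by_contra! hx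
  have hD : 0 < |D| + 1 := by positivity
  have h1 := h (min t₀ (x / (2 * (|D| + 1)))) (by positivity) (min_le_left _ _)
  have h2 : D * min t₀ (x / (2 * (|D| + 1))) ≤ (|D| + 1) * (x / (2 * (|D| + 1))) := by
    calc D * min t₀ (x / (2 * (|D| + 1))) ≤ (|D| + 1) * min t₀ (x / (2 * (|D| + 1))) := by
          have : 0 ≤ min t₀ (x / (2 * (|D| + 1))) := by positivity
          gcongr; linarith [le_abs_self D]
      _ ≤ _ := by gcongr; exact min_le_right _ _
  have h3 : (|D| + 1) * (x / (2 * (|D| + 1))) = x / 2 := by field_simp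
  linarith

theorem NonnegForm.continuous_apply_left {X : Type*} [NormedAddCommGroup X] [NormedSpace ℂ X]
    {s : NonnegForm X} {C : ℝ} (hs : ∀ u v, ‖s.toForm u v‖ ≤ C * ‖u‖ * ‖v‖) (v : X) :
    Continuous fun u => s.toForm u v :=
  ((s.toForm.flip v).mkContinuous (C * ‖v‖) fun u => by
    rw [LinearMap.flip_apply]; exact (hs u v).trans_eq (by ring)).continuous

namespace Setting

variable {n : ℕ} {H 𝓗 : Type*} [NormedAddCommGroup H] [InnerProductSpace ℂ H]
  [NormedAddCommGroup 𝓗] [InnerProductSpace ℂ 𝓗] {S : Setting n H 𝓗}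
  {Vstar : Submodule ℂ H} {Z : Submodule ℂ (S.V 0)}
  {a₁ : S.V 0 →ₗ[ℂ] H →ₗ⋆[ℂ] (Fin n → ℂ)}
  {a₂ : S.V 0 →ₗ[ℂ] S.V 0 →ₗ⋆[ℂ] Matrix (Fin n) (Fin n) ℂ}
  {E : Param n → 𝓗 ≃ₗ[ℂ] 𝓗} {C : ℝ}

namespace Bounds

variable (hC : S.Bounds Vstar Z a₁ a₂ E C)
include hC

theorem pos : 0 < C := hC.toNormBounds.pos

theorem nonneg : 0 ≤ C := hC.pos.le

theorem Vstar_le : Vstar ≤ S.V 0 := by rw [hC.V_zero_eq]; exact le_sup_left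

theorem Vst_le (θ : Param n) : S.Vst Vstar θ ≤ S.V θ := by
  intro v hv
  by_cases h : θ = 0
  · rw [Setting.Vst, if_pos h] at hv; rw [h]; exact hC.Vstar_le hv
  · rwa [Setting.Vst, if_neg h] at hv

theorem exists_add_eq {v : H} (hv : v ∈ S.V 0) : ∃ v₀ ∈ Vstar, ∃ z ∈ Z, v = v₀ + (z : H) := by
  rw [hC.V_zero_eq, sumSpace, Submodule.mem_sup] at hv
  obtain ⟨v₀, hv₀, z, hz, rfl⟩ := hv
  obtain ⟨z, hz, rfl⟩ := hz
  exact ⟨v₀, hv₀, z, hz, rfl⟩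

theorem isClosed_V {θ : Param n} (hθ : θ ∈ S.Θ) : IsClosed (S.V θ : Set H) := by
  have : (S.V θ : Set H) = ⋂ u, {v | (S.a θ).toForm v u = 0} := by
    ext v
    simp only [SetLike.mem_coe, Set.mem_iInter, Set.mem_ofPred_eq]
    exact ⟨fun h u => S.a_apply_left h u, fun h => h v⟩
  rw [this]
  exact isClosed_iInter fun u => isClosed_eq
    (NonnegForm.continuous_apply_left (hC.a_le θ hθ) u) continuous_const

theorem ab_le {θ : Param n} (hθ : θ ∈ S.Θ) (u v : H) :
    ‖(S.a θ + S.b θ).toForm u v‖ ≤ (2 * C) * ‖u‖ * ‖v‖ := by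
  rw [NonnegForm.add_toForm]
  have h1 := hC.a_le θ hθ u v
  have h2 := hC.b_le θ hθ u v
  calc _ ≤ ‖(S.a θ).toForm u v‖ + ‖(S.b θ).toForm u v‖ := norm_add_le _ _
    _ ≤ _ := by linarith

theorem isClosed_W {θ : Param n} (hθ : θ ∈ S.Θ) : IsClosed (S.W θ : Set H) := by
  have : (S.W θ : Set H) = ⋂ v : S.V θ, {w | (S.a θ + S.b θ).toForm w v = 0} := by
    ext v
    simp only [SetLike.mem_coe, Set.mem_iInter, Set.mem_ofPred_eq]
    exact ⟨fun h u => h u u.2, fun h u hu => h ⟨u, hu⟩⟩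
  rw [this]
  exact isClosed_iInter fun u => isClosed_eq
    (NonnegForm.continuous_apply_left (hC.ab_le hθ) _) continuous_const

theorem isEquivNorm_comap {θ : Param n} (hθ : θ ∈ S.Θ) (U : Submodule ℂ H) :
    ((S.a θ + S.b θ).comap U.subtype).IsEquivNorm :=
  ⟨C⁻¹, inv_pos.2 hC.pos, C, hC.pos, fun u => ⟨by
    rw [inv_mul_le_iff₀ hC.pos]; exact hC.norm_le θ hθ u, hC.nrm_le θ hθ u⟩⟩

/-- `v` is the (·,·)_θ-orthogonal projection of φ, obtained from Riesz on the closed subspace V_θ.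
The last clause holds because a_θ does not see V_θ. -/
theorem exists_V_add_W [CompleteSpace H] {θ : Param n} (hθ : θ ∈ S.Θ) (φ : H) :
    ∃ v ∈ S.V θ, ∃ w ∈ S.W θ, φ = v + w ∧ ‖v‖ ≤ 2 * C ^ 2 * ‖φ‖ ∧ ‖w‖ ≤ 2 * C ^ 2 * ‖φ‖ ∧
      (S.a θ).quad w = (S.a θ).quad φ := by
  have hCp := hC.pos
  have : CompleteSpace (S.V θ) := (hC.isClosed_V hθ).completeSpace_coe
  obtain ⟨v, hv⟩ := NonnegForm.exists_riesz (hC.isEquivNorm_comap hθ (S.V θ))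
    (((S.a θ + S.b θ).toForm φ).comp (S.V θ).subtype) (2 * C * ‖φ‖) (fun x => hC.ab_le hθ φ x)
  have hv' : ∀ x ∈ S.V θ, (S.a θ + S.b θ).toForm v x = (S.a θ + S.b θ).toForm φ x :=
    fun x hx => hv ⟨x, hx⟩
  have hvn : S.nrm θ v ≤ S.nrm θ φ := by
    have h1 : S.nrm θ v ^ 2 ≤ S.nrm θ φ * S.nrm θ v := by
      rw [Setting.nrm, NonnegForm.nrm_sq]
      calc (S.a θ + S.b θ).quad v = ((S.a θ + S.b θ).toForm φ v).re := by
            rw [← hv' v v.2, NonnegForm.quad]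
        _ ≤ ‖(S.a θ + S.b θ).toForm φ v‖ := Complex.re_le_norm _
        _ ≤ _ := NonnegForm.norm_apply_le _ _ _
    rcases (S.nrm_nonneg θ (v : H)).eq_or_lt with h | h
    · rw [← h]; exact S.nrm_nonneg _ _
    · exact le_of_mul_le_mul_right (by rw [← sq]; exact h1) h
  have hwn : S.nrm θ (φ - v) ≤ 2 * S.nrm θ φ := by
    have := (S.a θ + S.b θ).nrm_sub_le φ v
    change S.nrm θ (φ - v) ≤ S.nrm θ φ + S.nrm θ v at this
    linarith
  refine ⟨v, v.2, φ - v, fun x hx => ?_, by abel, ?_, ?_, ?_⟩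
  · rw [map_sub, LinearMap.sub_apply, hv' x hx, sub_self]
  · calc ‖(v : H)‖ ≤ C * S.nrm θ v := hC.norm_le θ hθ _
      _ ≤ C * (2 * (C * ‖φ‖)) := by
          gcongr
          linarith [hC.nrm_le θ hθ φ, S.nrm_nonneg θ φ]
      _ = _ := by ring
  · calc ‖φ - (v : H)‖ ≤ C * S.nrm θ (φ - v) := hC.norm_le θ hθ _
      _ ≤ C * (2 * (C * ‖φ‖)) := by
          gcongr
          linarith [hC.nrm_le θ hθ φ]
      _ = _ := by ring
  · rw [NonnegForm.quad, NonnegForm.quad, map_sub (S.a θ).toForm, LinearMap.sub_apply, map_sub,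
      map_sub,
      S.a_apply_left v.2, S.a_apply_left v.2, S.a_apply_right v.2]
    simp

theorem exists_radius : ∃ r > 0, ∀ θ : Param n, ‖θ‖ ≤ r → θ ∈ S.Θ := by
  obtain ⟨r, hr, h⟩ := Metric.nhds_basis_closedBall.mem_iff.1
    (mem_interior_iff_mem_nhds.1 hC.zero_mem_interior)
  exact ⟨r, hr, fun θ hθ => h (by simpa using hθ)⟩

theorem norm_a_le_of_mem_V {θ : Param n} (hθ : θ ∈ S.Θ) {v : H} (hv : v ∈ S.V 0) (u : H) :
    ‖(S.a θ).toForm v u‖ ≤ C * ‖θ‖ * ‖v‖ * ‖u‖ := by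
  simpa [S.a_apply_left hv] using hC.a_sub_le θ hθ v u

/-- No continuity of a'_0 is assumed. On a sphere of radius r inside Θ it is within the (H4) error
of a_θ, which is bounded, and linearity in ξ does the rest. -/
theorem exists_a₁_bound : ∃ D ≥ 0, ∀ (ξ : Param n) (v : S.V 0) (u : H),
    ‖a₁ v u ⬝ᵥ cvec ξ‖ ≤ D * ‖ξ‖ * ‖v‖ * ‖u‖ := by
  obtain ⟨r, hr, hr'⟩ := hC.exists_radius
  have hCp := hC.pos
  refine ⟨C * (1 + r), by positivity, fun ξ v u => ?_⟩
  rcases eq_or_ne ξ 0 with rfl | hξ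
  · have : cvec (0 : Param n) = 0 := by ext; simp [cvec]
    simp [this]
  have hξ' : 0 < ‖ξ‖ := norm_pos_iff.2 hξ
  set t := r / ‖ξ‖ with ht
  have ht0 : 0 < t := by positivity
  have hn : ‖t • ξ‖ = r := by
    rw [norm_smul, Real.norm_of_nonneg ht0.le, ht, div_mul_cancel₀ _ hξ'.ne']
  have hmem : t • ξ ∈ S.Θ := hr' _ hn.le
  have h1 := hC.a₁_le v u _ hmem
  have h2 := hC.norm_a_le_of_mem_V hmem v.2 u
  rw [hn] at h1 h2
  have h3 : ‖a₁ v u ⬝ᵥ cvec (t • ξ)‖ ≤ C * (1 + r) * r * ‖(v : H)‖ * ‖u‖ := by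
    calc _ ≤ ‖(S.a (t • ξ)).toForm v u‖ + ‖(S.a (t • ξ)).toForm v u - a₁ v u ⬝ᵥ cvec (t • ξ)‖ := by
          rw [← norm_neg (_ - _)]
          refine le_trans (le_of_eq ?_) (norm_add_le _ _)
          congr 1; ring
      _ ≤ C * r * ‖(v : H)‖ * ‖u‖ + C * r ^ 2 * ‖(v : H)‖ * ‖u‖ := add_le_add h2 h1
      _ = _ := by ring
  rw [cvec_smul, dotProduct_smul, norm_smul, Complex.norm_real, Real.norm_of_nonneg ht0.le] at h3
  have h4 : t * (C * (1 + r) * ‖ξ‖ * ‖(v : H)‖ * ‖u‖) = C * (1 + r) * r * ‖(v : H)‖ * ‖u‖ := by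
    rw [ht]; field_simp
  rw [← h4] at h3
  exact le_of_mul_le_mul_left h3 ht0

theorem exists_a₂_bound : ∃ D ≥ 0, ∀ (ξ : Param n) (v v' : S.V 0),
    ‖(a₂ v v' *ᵥ cvec ξ) ⬝ᵥ cvec ξ‖ ≤ D * ‖ξ‖ ^ 2 * ‖v‖ * ‖v'‖ := by
  obtain ⟨r, hr, hr'⟩ := hC.exists_radius
  have hCp := hC.pos
  refine ⟨C * (1 / r + r), by positivity, fun ξ v u => ?_⟩
  rcases eq_or_ne ξ 0 with rfl | hξ
  · have : cvec (0 : Param n) = 0 := by ext; simp [cvec]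
    simp [this]
  have hξ' : 0 < ‖ξ‖ := norm_pos_iff.2 hξ
  set t := r / ‖ξ‖ with ht
  have ht0 : 0 < t := by positivity
  have hn : ‖t • ξ‖ = r := by
    rw [norm_smul, Real.norm_of_nonneg ht0.le, ht, div_mul_cancel₀ _ hξ'.ne']
  have hmem : t • ξ ∈ S.Θ := hr' _ hn.le
  have h1 := hC.a₂_le v u _ hmem
  have h2 := hC.norm_a_le_of_mem_V hmem v.2 u
  rw [hn] at h1 h2
  have h3 : ‖(a₂ v u *ᵥ cvec (t • ξ)) ⬝ᵥ cvec (t • ξ)‖ ≤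
      C * (r + r ^ 3) * ‖v‖ * ‖u‖ := by
    calc _ ≤ ‖(S.a (t • ξ)).toForm v u‖ +
            ‖(S.a (t • ξ)).toForm v u - (a₂ v u *ᵥ cvec (t • ξ)) ⬝ᵥ cvec (t • ξ)‖ := by
          rw [← norm_neg (_ - _)]
          refine le_trans (le_of_eq ?_) (norm_add_le _ _)
          congr 1; ring
      _ ≤ C * r * ‖v‖ * ‖u‖ + C * r ^ 3 * ‖v‖ * ‖u‖ := add_le_add h2 h1
      _ = _ := by ring
  rw [cvec_smul, Matrix.mulVec_smul, dotProduct_smul, smul_dotProduct, norm_smul, norm_smul,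
    Complex.norm_real, Real.norm_of_nonneg ht0.le] at h3
  have h4 : t * (t * (C * (1 / r + r) * ‖ξ‖ ^ 2 * ‖v‖ * ‖u‖)) =
      C * (r + r ^ 3) * ‖v‖ * ‖u‖ := by
    rw [ht]; field_simp
  rw [← h4] at h3
  exact le_of_mul_le_mul_left (le_of_mul_le_mul_left h3 ht0) ht0

theorem exists_a_bound_on_V : ∃ D ≥ 0, ∀ θ ∈ S.Θ, ∀ v v' : S.V 0,
    ‖(S.a θ).toForm v v'‖ ≤ D * ‖θ‖ ^ 2 * ‖v‖ * ‖v'‖ := by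
  obtain ⟨D, hD, h⟩ := hC.exists_a₂_bound
  have hCp := hC.pos
  refine ⟨D + C * C, by positivity, fun θ hθ v v' => ?_⟩
  have h1 := hC.a₂_le v v' θ hθ
  have h2 := h θ v v'
  have h3 := hC.norm_param_le θ hθ
  calc _ ≤ ‖(a₂ v v' *ᵥ cvec θ) ⬝ᵥ cvec θ‖ +
          ‖(S.a θ).toForm v v' - (a₂ v v' *ᵥ cvec θ) ⬝ᵥ cvec θ‖ := by
        refine le_trans (le_of_eq ?_) (norm_add_le _ _)
        congr 1; ring
    _ ≤ D * ‖θ‖ ^ 2 * ‖v‖ * ‖v'‖ + C * (C * ‖θ‖ ^ 2) * ‖v‖ * ‖v'‖ := by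
        refine add_le_add h2 (h1.trans ?_)
        gcongr
        rw [pow_succ']
        gcongr
    _ = _ := by ring

/-- On V_0 both a_θ and its distance to a'_0 · θ are O(|θ|²). A term linear in θ of that size is
zero. -/
theorem a₁_eq_zero (ξ : Param n) (v v' : S.V 0) : a₁ v v' ⬝ᵥ cvec ξ = 0 := by
  obtain ⟨r, hr, hr'⟩ := hC.exists_radius
  obtain ⟨D, hD, h⟩ := hC.exists_a_bound_on_V
  have hCp := hC.pos
  rw [← norm_le_zero_iff]
  refine le_zero_of_forall_le_mul (D := (D + C) * ‖ξ‖ ^ 2 * ‖v‖ * ‖v'‖)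
    (t₀ := r / (‖ξ‖ + 1)) (by positivity) fun t ht ht' => ?_
  have hn : ‖t • ξ‖ = t * ‖ξ‖ := by rw [norm_smul, Real.norm_of_nonneg ht.le]
  have hmem : t • ξ ∈ S.Θ := hr' _ (by
    rw [hn]
    calc t * ‖ξ‖ ≤ r / (‖ξ‖ + 1) * (‖ξ‖ + 1) := by gcongr; linarith
      _ = r := by field_simp)
  have h1 := hC.a₁_le v v' _ hmem
  have h2 := h _ hmem v v'
  have h3 : ‖a₁ v v' ⬝ᵥ cvec (t • ξ)‖ ≤ D * (t * ‖ξ‖) ^ 2 * ‖v‖ * ‖v'‖ +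
      C * (t * ‖ξ‖) ^ 2 * ‖v‖ * ‖v'‖ := by
    rw [← hn]
    refine le_trans ?_ (add_le_add h2 h1)
    rw [← norm_neg (_ - _)]
    refine le_trans (le_of_eq ?_) (norm_add_le _ _)
    congr 1; ring
  rw [cvec_smul, dotProduct_smul, norm_smul, Complex.norm_real, Real.norm_of_nonneg ht.le] at h3
  refine le_of_mul_le_mul_left (h3.trans_eq ?_) ht
  ring

theorem isEquivNorm_a_W : ((S.a 0).comap (S.W 0).subtype).IsEquivNorm := by
  have hCp := hC.pos
  refine NonnegForm.isEquivNorm_of_bounds _ (c := C⁻¹) (C := C) (inv_pos.2 hCp) (fun u => ?_)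
    (fun u => ?_)
  · rw [inv_mul_le_iff₀ hCp]; exact hC.gap_zero u u.2
  · calc (S.a 0).quad u ≤ ‖(S.a 0).toForm u u‖ := Complex.re_le_norm _
      _ ≤ C * ‖(u : H)‖ * ‖(u : H)‖ := hC.a_le 0 hC.zero_mem u u
      _ = _ := by rw [sq, mul_assoc]; rfl

/-- `corrector` is chosen by `epsilon`, so existence is what must be shown: by (H1) the form a_0 is
an equivalent inner product on W_0, and Riesz applies. -/
theorem isCorrector [CompleteSpace H] (ξ : Param n) :
    S.IsCorrector a₁ ξ (S.corrector a₁ ξ) := by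
  refine Classical.epsilon_spec (p := S.IsCorrector a₁ ξ) ?_
  have : CompleteSpace (S.W 0) := (hC.isClosed_W hC.zero_mem).completeSpace_coe
  obtain ⟨D, hD, h⟩ := hC.exists_a₁_bound
  obtain ⟨N, hN⟩ := NonnegForm.exists_solution hC.isEquivNorm_a_W
    (LinearMap.mk₂'ₛₗ (RingHom.id ℂ) (starRingEnd ℂ)
      (fun (v : S.V 0) (w : S.W 0) => -(a₁ v w ⬝ᵥ cvec ξ))
      (by intros; simp [add_dotProduct]; ring) (by intros; simp [smul_dotProduct])
      (by intros; simp [add_dotProduct]; ring) (by intros; simp [smul_dotProduct]))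
    (fun v => ⟨D * ‖ξ‖ * ‖v‖, fun x => by
      simpa using h ξ v x⟩)
  exact ⟨N, fun v w => hN v w⟩

theorem exists_corrector_bound [CompleteSpace H] : ∃ D ≥ 0, ∀ (ξ : Param n) (v : S.V 0),
    ‖(S.corrector a₁ ξ v : H)‖ ≤ D * ‖ξ‖ * ‖v‖ := by
  obtain ⟨D, hD, h⟩ := hC.exists_a₁_bound
  have hCp := hC.pos
  refine ⟨C * D, by positivity, fun ξ v => ?_⟩
  set w := S.corrector a₁ ξ v
  have h1 := hC.gap_zero w w.2
  have h2 : (S.a 0).quad w ≤ D * ‖ξ‖ * ‖v‖ * ‖(w : H)‖ := by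
    calc (S.a 0).quad w ≤ ‖(S.a 0).toForm w w‖ := Complex.re_le_norm _
      _ = ‖a₁ v w ⬝ᵥ cvec ξ‖ := by rw [hC.isCorrector ξ v w, norm_neg]
      _ ≤ _ := h ξ v w
  rcases (norm_nonneg (w : H)).eq_or_lt with h0 | h0
  · rw [← h0]; positivity
  · refine le_of_mul_le_mul_right ?_ h0
    calc ‖(w : H)‖ * ‖(w : H)‖ = ‖(w : H)‖ ^ 2 := by ring
      _ ≤ C * (D * ‖ξ‖ * ‖v‖ * ‖(w : H)‖) := h1.trans (by gcongr)
      _ = _ := by ring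

theorem corrector_smul [CompleteSpace H] (t : ℝ) (ξ : Param n) (v : S.V 0) :
    (S.corrector a₁ (t • ξ) v : H) = (t : ℂ) • (S.corrector a₁ ξ v : H) := by
  rw [← Submodule.coe_smul, SetLike.coe_eq_coe, ← sub_eq_zero]
  refine hC.isEquivNorm_a_W.eq_zero ?_
  have key : ∀ w : S.W 0, (S.a 0).toForm
      ((S.corrector a₁ (t • ξ) v - (t : ℂ) • S.corrector a₁ ξ v : S.W 0) : H) w = 0 := by
    intro w
    rw [Submodule.coe_sub, Submodule.coe_smul, map_sub, map_smul, LinearMap.sub_apply,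
      LinearMap.smul_apply, hC.isCorrector, hC.isCorrector, cvec_smul, dotProduct_smul]
    simp
  exact key (S.corrector a₁ (t • ξ) v - (t : ℂ) • S.corrector a₁ ξ v)

omit hC in
theorem homForm_apply (ξ : Param n) (v v' : S.V 0) : S.homForm a₁ a₂ ξ v v' =
    (a₂ v v' *ᵥ cvec ξ) ⬝ᵥ cvec ξ -
      (S.a 0).toForm (S.corrector a₁ ξ v) (S.corrector a₁ ξ v') := rfl

theorem homForm_smul [CompleteSpace H] (t : ℝ) (ξ : Param n) (v v' : S.V 0) :
    S.homForm a₁ a₂ (t • ξ) v v' = ((t ^ 2 : ℝ) : ℂ) * S.homForm a₁ a₂ ξ v v' := by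
  rw [homForm_apply, homForm_apply, hC.corrector_smul, hC.corrector_smul, cvec_smul,
    Matrix.mulVec_smul, dotProduct_smul, smul_dotProduct, map_smul (S.a 0).toForm,
    LinearMap.smul_apply, map_smulₛₗ, Complex.conj_ofReal]
  simp only [smul_eq_mul]
  push_cast
  ring

theorem exists_homForm_bound [CompleteSpace H] : ∃ D ≥ 0, ∀ (ξ : Param n) (v v' : S.V 0),
    ‖S.homForm a₁ a₂ ξ v v'‖ ≤ D * ‖ξ‖ ^ 2 * ‖v‖ * ‖v'‖ := by
  obtain ⟨D, hD, h⟩ := hC.exists_a₂_bound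
  obtain ⟨D', hD', h'⟩ := hC.exists_corrector_bound
  have hCp := hC.pos
  refine ⟨D + C * D' * D', by positivity, fun ξ v v' => ?_⟩
  rw [homForm_apply]
  calc _ ≤ ‖(a₂ v v' *ᵥ cvec ξ) ⬝ᵥ cvec ξ‖ +
        ‖(S.a 0).toForm (S.corrector a₁ ξ v) (S.corrector a₁ ξ v')‖ := norm_sub_le _ _
    _ ≤ D * ‖ξ‖ ^ 2 * ‖v‖ * ‖v'‖ + C * (D' * ‖ξ‖ * ‖v‖) * (D' * ‖ξ‖ * ‖v'‖) := by
        refine add_le_add (h ξ v v') ((hC.a_le 0 hC.zero_mem _ _).trans ?_)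
        gcongr
        · exact h' ξ v
        · exact h' ξ v'
    _ = _ := by ring

/-- a_{tξ}[v] is real and differs from t² a''_0(v, v)ξ·ξ by O(t³); dividing by t² removes the
imaginary part. -/
theorem homForm_self_im [CompleteSpace H] (ξ : Param n) (v : S.V 0) :
    (S.homForm a₁ a₂ ξ v v).im = 0 := by
  rw [homForm_apply, Complex.sub_im, (S.a 0).im_eq_zero, sub_zero]
  obtain ⟨r, hr, hr'⟩ := hC.exists_radius
  have hCp := hC.pos
  rw [← abs_nonpos_iff]
  refine le_zero_of_forall_le_mul (D := C * ‖ξ‖ ^ 3 * ‖v‖ * ‖v‖)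
    (t₀ := r / (‖ξ‖ + 1)) (by positivity) fun t ht ht' => ?_
  have hn : ‖t • ξ‖ = t * ‖ξ‖ := by rw [norm_smul, Real.norm_of_nonneg ht.le]
  have hmem : t • ξ ∈ S.Θ := hr' _ (by
    rw [hn]
    calc t * ‖ξ‖ ≤ r / (‖ξ‖ + 1) * (‖ξ‖ + 1) := by gcongr; linarith
      _ = r := by field_simp)
  have h1 := (Complex.abs_im_le_norm _).trans (hC.a₂_le v v _ hmem)
  rw [Complex.sub_im, (S.a _).im_eq_zero, zero_sub, abs_neg, hn, cvec_smul,
    Matrix.mulVec_smul, dotProduct_smul, smul_dotProduct, smul_eq_mul, smul_eq_mul, ← mul_assoc,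
    ← Complex.ofReal_mul, Complex.im_ofReal_mul, abs_mul, abs_of_pos (mul_pos ht ht)] at h1
  refine le_of_mul_le_mul_left (h1.trans_eq ?_) (mul_pos ht ht)
  ring

/-- Because a'_0 vanishes on V_0 × V_0, the corrector equation extends from test vectors in W_0 to
all of H. It then cancels the first-order term, leaving the (H4) error and the Lipschitz error of
a_θ applied to N_θ z = O(|θ|). -/
theorem exists_a_corrected_bound [CompleteSpace H] : ∃ D ≥ 0, ∀ θ ∈ S.Θ, ∀ (z : S.V 0) (φ : H),
    ‖(S.a θ).toForm (z + S.corrector a₁ θ z) φ‖ ≤ D * ‖θ‖ ^ 2 * ‖z‖ * ‖φ‖ := by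
  obtain ⟨D, hD, h⟩ := hC.exists_corrector_bound
  have hCp := hC.pos
  refine ⟨C + C * D, by positivity, fun θ hθ z φ => ?_⟩
  obtain ⟨v, hv, w, hw, rfl, -⟩ := hC.exists_V_add_W hC.zero_mem φ
  set N := S.corrector a₁ θ z
  have h1 : (S.a 0).toForm N (v + w) = -(a₁ z (v + w) ⬝ᵥ cvec θ) := by
    rw [map_add, S.a_apply_right hv, zero_add, map_add, add_dotProduct,
      hC.a₁_eq_zero θ z ⟨v, hv⟩, zero_add]
    exact hC.isCorrector θ z ⟨w, hw⟩
  have h2 := hC.a₁_le z (v + w) θ hθ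
  have h3 := hC.a_sub_le θ hθ N (v + w)
  calc _ = ‖((S.a θ).toForm z (v + w) - a₁ z (v + w) ⬝ᵥ cvec θ) +
        ((S.a θ).toForm N (v + w) - (S.a 0).toForm N (v + w))‖ := by
        rw [h1, map_add (S.a θ).toForm, LinearMap.add_apply]; congr 1; ring
    _ ≤ C * ‖θ‖ ^ 2 * ‖z‖ * ‖v + w‖ + C * ‖θ‖ * (D * ‖θ‖ * ‖z‖) * ‖v + w‖ := by
        refine (norm_add_le _ _).trans (add_le_add h2 (h3.trans ?_))
        gcongr
        exact h θ z
    _ = _ := by ring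

/-- By the corrector equation for z', the term a_θ(N_θ z, z') + a_0(N_θ z, N_θ z') is the conjugate
of the (H4) error a_θ(z', N_θ z) - a'_0(z', N_θ z) · θ. That error gains a third power of |θ| from
N_θ z. -/
theorem exists_a_sub_homForm_bound [CompleteSpace H] : ∃ D ≥ 0, ∀ θ ∈ S.Θ, ∀ (z z' : S.V 0),
    ‖(S.a θ).toForm (z + S.corrector a₁ θ z) z' - S.homForm a₁ a₂ θ z z'‖ ≤
      D * ‖θ‖ ^ 3 * ‖z‖ * ‖z'‖ := by
  obtain ⟨D, hD, h⟩ := hC.exists_corrector_bound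
  have hCp := hC.pos
  refine ⟨C + C * D, by positivity, fun θ hθ z z' => ?_⟩
  set N := S.corrector a₁ θ z with hN
  have h1 := hC.a₁_le z' N θ hθ
  have h2 : (S.a θ).toForm N z' + (S.a 0).toForm N (S.corrector a₁ θ z') =
      (starRingEnd ℂ) ((S.a θ).toForm z' N - a₁ z' N ⬝ᵥ cvec θ) := by
    have : a₁ z' N ⬝ᵥ cvec θ = -(S.a 0).toForm (S.corrector a₁ θ z') N := by
      rw [hC.isCorrector θ z' N, neg_neg]
    rw [this, map_sub, map_neg, NonnegForm.conj_symm, NonnegForm.conj_symm]; ring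
  calc _ = ‖((S.a θ).toForm z z' - (a₂ z z' *ᵥ cvec θ) ⬝ᵥ cvec θ) +
        ((S.a θ).toForm N z' + (S.a 0).toForm N (S.corrector a₁ θ z'))‖ := by
        rw [homForm_apply, map_add, LinearMap.add_apply]; congr 1; ring
    _ ≤ C * ‖θ‖ ^ 3 * ‖z‖ * ‖z'‖ + C * ‖θ‖ ^ 2 * ‖z'‖ * (D * ‖θ‖ * ‖z‖) := by
        refine (norm_add_le _ _).trans (add_le_add (hC.a₂_le z z' θ hθ) ?_)
        rw [h2, RCLike.norm_conj]
        refine h1.trans ?_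
        gcongr
        exact h θ z
    _ = _ := by ring

/-- For small θ, a^h_θ[z] equals a_θ[z + N_θ z] up to |θ|³, and the latter is a_θ[w] for the
W_θ-part w. By (H3) it suffices that ‖w‖ is comparable to ‖z‖: the V_θ-part is near V_⋆ by (H2), and
Z is transversal to V_⋆. Homogeneity in ξ removes the smallness. -/
theorem exists_homForm_coercive [CompleteSpace H] : ∃ c > 0, ∀ (ξ : Param n), ∀ z ∈ Z,
    c * ‖ξ‖ ^ 2 * ‖z‖ ^ 2 ≤ (S.homForm a₁ a₂ ξ z z).re := by
  obtain ⟨r, hr, hr'⟩ := hC.exists_radius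
  obtain ⟨D, hD, h⟩ := hC.exists_corrector_bound
  obtain ⟨D₁, hD₁, h₁⟩ := hC.exists_a_corrected_bound
  obtain ⟨D₂, hD₂, h₂⟩ := hC.exists_a_sub_homForm_bound
  have hCp := hC.pos
  set G : ℝ := C * D + C * (C * (2 * C ^ 2 * (1 + D * C))) with hG
  have hG0 : 0 ≤ G := by positivity
  set Q : ℝ := D₁ * D + D₂ with hQ
  have hQ0 : 0 ≤ Q := by positivity
  -- This combines the gap constant 1/C with ‖z‖ ≤ 2C‖w‖; half of c₀ is later spent on the cubic
  -- error.
  set c₀ : ℝ := 1 / (4 * C ^ 3) with hc₀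
  have hc₀p : 0 < c₀ := by positivity
  -- the estimate for small `θ`
  have small : ∀ θ ∈ S.Θ, θ ≠ 0 → G * ‖θ‖ ≤ 1 / 2 → Q * ‖θ‖ ≤ c₀ / 2 → ∀ z ∈ Z,
      c₀ / 2 * ‖θ‖ ^ 2 * ‖z‖ ^ 2 ≤ (S.homForm a₁ a₂ θ z z).re := by
    intro θ hθ hne hGθ hQθ z hz
    set N := S.corrector a₁ θ z with hN
    have hNn : ‖(N : H)‖ ≤ D * ‖θ‖ * ‖z‖ := h θ z
    obtain ⟨v, hv, w, hw, huvw, hvn, -, hq⟩ := hC.exists_V_add_W hθ ((z : H) + N)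
    have hv' : v ∈ S.Vst Vstar θ := by rwa [Setting.Vst, if_neg hne]
    obtain ⟨v₂, hv₂, hvv₂⟩ := hC.near θ hθ 0 hC.zero_mem v hv'
    rw [Setting.Vst, if_pos rfl] at hv₂
    rw [sub_zero] at hvv₂
    have hun : ‖(z : H) + N‖ ≤ (1 + D * C) * ‖z‖ := by
      calc _ ≤ ‖(z : H)‖ + ‖(N : H)‖ := norm_add_le _ _
        _ ≤ ‖z‖ + D * C * ‖z‖ := by
          refine add_le_add le_rfl (hNn.trans ?_)
          gcongr
          exact hC.norm_param_le θ hθ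
        _ = _ := by ring
    have h3 : ‖v - v₂‖ ≤ C * ‖θ‖ * (2 * C ^ 2 * ((1 + D * C) * ‖z‖)) := by
      refine hvv₂.trans ?_
      gcongr
      refine hvn.trans ?_
      gcongr
    have h4 : ‖z‖ ≤ C * ‖w‖ + G * ‖θ‖ * ‖z‖ := by
      have e : -v₂ + (z : H) = w - N + (v - v₂) := by
        have : w = (z : H) + N - v := by rw [huvw]; abel
        rw [this]; abel
      calc ‖z‖ ≤ C * ‖-v₂ + (z : H)‖ :=
            (hC.direct (-v₂) (Submodule.neg_mem _ hv₂) z hz).2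
        _ ≤ C * (‖w‖ + ‖(N : H)‖ + ‖v - v₂‖) := by
            rw [e]
            gcongr
            exact (norm_add_le _ _).trans (add_le_add (norm_sub_le _ _) le_rfl)
        _ ≤ C * (‖w‖ + D * ‖θ‖ * ‖z‖ + C * ‖θ‖ * (2 * C ^ 2 * ((1 + D * C) * ‖z‖))) := by
            gcongr
        _ = _ := by rw [hG]; ring
    have h5 : ‖z‖ ≤ 2 * C * ‖w‖ := by
      have : G * ‖θ‖ * ‖z‖ ≤ 1 / 2 * ‖z‖ := by gcongr
      linarith
    have h6 := hC.gap θ hθ w hw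
    rw [hq] at h6
    have h7 : c₀ * ‖θ‖ ^ 2 * ‖z‖ ^ 2 ≤ (S.a θ).quad ((z : H) + N) := by
      calc c₀ * ‖θ‖ ^ 2 * ‖z‖ ^ 2 ≤ c₀ * ‖θ‖ ^ 2 * (2 * C * ‖w‖) ^ 2 := by gcongr
        _ = C⁻¹ * (‖θ‖ ^ 2 * ‖w‖ ^ 2) := by rw [hc₀]; field_simp; ring
        _ ≤ _ := by rw [inv_mul_le_iff₀ hCp]; exact h6
    have h8 : ‖(S.a θ).toForm ((z : H) + N) ((z : H) + N) - S.homForm a₁ a₂ θ z z‖ ≤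
        Q * ‖θ‖ ^ 3 * ‖z‖ ^ 2 := by
      calc _ = ‖(S.a θ).toForm ((z : H) + N) N +
            ((S.a θ).toForm ((z : H) + N) z - S.homForm a₁ a₂ θ z z)‖ := by
            rw [map_add ((S.a θ).toForm ((z : H) + N))]; congr 1; ring
        _ ≤ D₁ * ‖θ‖ ^ 2 * ‖z‖ * (D * ‖θ‖ * ‖z‖) + D₂ * ‖θ‖ ^ 3 * ‖z‖ * ‖z‖ := by
            refine (norm_add_le _ _).trans (add_le_add ((h₁ θ hθ z N).trans ?_) (h₂ θ hθ z z))
            gcongr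
        _ = _ := by rw [hQ]; ring
    have h9 := (Complex.re_le_norm _).trans h8
    rw [Complex.sub_re] at h9
    change (S.a θ).quad _ - _ ≤ _ at h9
    have h10 : Q * ‖θ‖ ^ 3 * ‖z‖ ^ 2 ≤ c₀ / 2 * ‖θ‖ ^ 2 * ‖z‖ ^ 2 := by
      calc Q * ‖θ‖ ^ 3 * ‖z‖ ^ 2 = (Q * ‖θ‖) * ‖θ‖ ^ 2 * ‖z‖ ^ 2 := by ring
        _ ≤ _ := by gcongr
    linarith
  refine ⟨c₀ / 2, by positivity, fun ξ z hz => ?_⟩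
  rcases eq_or_ne ξ 0 with rfl | hξ
  · have := hC.homForm_smul 0 0 z z
    rw [smul_zero] at this
    rw [this]; simp
  have hξ' : 0 < ‖ξ‖ := norm_pos_iff.2 hξ
  -- Rescaling ξ to length ρ puts it in Θ and meets both smallness conditions; the two sides are
  -- quadratic in ξ.
  set ρ : ℝ := min r (min (1 / (2 * (G + 1))) (c₀ / (2 * (Q + 1)))) with hρ
  have hρ0 : 0 < ρ := by positivity
  set t := ρ / ‖ξ‖ with ht
  have ht0 : 0 < t := by positivity
  have hn : ‖t • ξ‖ = ρ := by
    rw [norm_smul, Real.norm_of_nonneg ht0.le, ht, div_mul_cancel₀ _ hξ'.ne']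
  have h1 := small (t • ξ) (hr' _ (by rw [hn]; exact min_le_left _ _))
    (smul_ne_zero ht0.ne' hξ)
    (by
      rw [hn]
      calc G * ρ ≤ (G + 1) * (1 / (2 * (G + 1))) := by
            gcongr
            · linarith
            · exact (min_le_right _ _).trans (min_le_left _ _)
        _ = 1 / 2 := by field_simp)
    (by
      rw [hn]
      calc Q * ρ ≤ (Q + 1) * (c₀ / (2 * (Q + 1))) := by
            gcongr
            · linarith
            · exact (min_le_right _ _).trans (min_le_right _ _)
        _ = c₀ / 2 := by field_simp) z hz
  rw [hC.homForm_smul, Complex.re_ofReal_mul, norm_smul, Real.norm_of_nonneg ht0.le] at h1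
  refine le_of_mul_le_mul_left (le_trans (le_of_eq ?_) h1) (pow_pos ht0 2)
  ring

end Bounds
end Setting

/-! ### Decomposition of test vectors along V^⋆_θ and Z -/

theorem le_mul_of_sq_le_mul_sq {x y K : ℝ} (hK : 0 ≤ K) (hy : 0 ≤ y) (h : x ^ 2 ≤ K * y ^ 2) :
    x ≤ (K + 1) * y := by
  refine (abs_le_of_sq_le_sq' (h.trans ?_) (by positivity)).2
  rw [mul_pow]
  gcongr
  nlinarith

namespace Setting

variable {n : ℕ} {H 𝓗 : Type*} [NormedAddCommGroup H] [InnerProductSpace ℂ H]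
  [NormedAddCommGroup 𝓗] [InnerProductSpace ℂ 𝓗]

/-- A decomposition of `φ` along `V^⋆_θ` and `Z`, up to a remainder controlled by `a_θ[φ]`. -/
def HasDecomposition (S : Setting n H 𝓗) (Vstar : Submodule ℂ H) (Z : Submodule ℂ (S.V 0))
    (D : ℝ) (θ : Param n) (φ : H) : Prop :=
  ∃ v ∈ S.Vst Vstar θ, ∃ z ∈ Z, ∃ r : H, φ = v + z + r ∧ ‖v‖ ≤ D * ‖φ‖ ∧ ‖z‖ ≤ D * ‖φ‖ ∧
    ‖θ‖ * ‖z‖ ≤ D * (S.a θ).nrm φ ∧ ‖r‖ ≤ D * (S.a θ).nrm φ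

variable {S : Setting n H 𝓗}
  {Vstar : Submodule ℂ H} {Z : Submodule ℂ (S.V 0)}
  {a₁ : S.V 0 →ₗ[ℂ] H →ₗ⋆[ℂ] (Fin n → ℂ)}
  {a₂ : S.V 0 →ₗ[ℂ] S.V 0 →ₗ⋆[ℂ] Matrix (Fin n) (Fin n) ℂ}
  {E : Param n → 𝓗 ≃ₗ[ℂ] 𝓗} {C : ℝ}

theorem HasDecomposition.mono {D D' : ℝ} {θ : Param n} {φ : H} (hD : D ≤ D')
    (h : S.HasDecomposition Vstar Z D θ φ) : S.HasDecomposition Vstar Z D' θ φ := by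
  obtain ⟨v, hv, z, hz, r, h0, h1, h2, h3, h4⟩ := h
  have := (S.a θ).nrm_nonneg φ
  exact ⟨v, hv, z, hz, r, h0, h1.trans (by gcongr), h2.trans (by gcongr), h3.trans (by gcongr),
    h4.trans (by gcongr)⟩

namespace Bounds

variable (hC : S.Bounds Vstar Z a₁ a₂ E C)
include hC

theorem hasDecomposition_zero [CompleteSpace H] (φ : H) :
    S.HasDecomposition Vstar Z (2 * C ^ 3 + C + 1) 0 φ := by
  have hCp := hC.pos
  obtain ⟨φ₀, hφ₀, w, hw, rfl, hn, -, hq⟩ := hC.exists_V_add_W hC.zero_mem φ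
  obtain ⟨v, hv, z, hz, rfl⟩ := hC.exists_add_eq hφ₀
  obtain ⟨h1, h2⟩ := hC.direct v hv z hz
  have hq0 := (S.a 0).nrm_nonneg (v + z + w)
  refine ⟨v, by rwa [Setting.Vst, if_pos rfl], z, hz, w, rfl, ?_, ?_, ?_, ?_⟩
  · calc ‖v‖ ≤ C * (2 * C ^ 2 * ‖v + z + w‖) := h1.trans (by gcongr)
      _ = 2 * C ^ 3 * ‖v + z + w‖ := by ring
      _ ≤ _ := by gcongr; linarith
  · calc ‖(z : H)‖ ≤ C * (2 * C ^ 2 * ‖v + z + w‖) := h2.trans (by gcongr)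
      _ = 2 * C ^ 3 * ‖v + z + w‖ := by ring
      _ ≤ _ := by gcongr; linarith
  · rw [norm_zero, zero_mul]; positivity
  · have h3 := hC.gap_zero w hw
    rw [hq, ← NonnegForm.nrm_sq] at h3
    refine (le_mul_of_sq_le_mul_sq hC.nonneg hq0 h3).trans ?_
    gcongr
    linarith [pow_pos hCp 3]

theorem hasDecomposition_of_le_norm [CompleteSpace H] {ρ : ℝ} (hρ : 0 < ρ) {θ : Param n}
    (hθ : θ ∈ S.Θ) (hρθ : ρ ≤ ‖θ‖) (φ : H) :
    S.HasDecomposition Vstar Z (2 * C ^ 2 + C / ρ ^ 2 + 1) θ φ := by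
  have hCp := hC.pos
  have hne : θ ≠ 0 := by
    rintro rfl
    rw [norm_zero] at hρθ
    linarith
  obtain ⟨v, hv, w, hw, rfl, hn, -, hq⟩ := hC.exists_V_add_W hθ φ
  have hq0 := (S.a θ).nrm_nonneg (v + w)
  -- Away from θ = 0 the gap in (H3) is uniform, so no Z-component is needed.
  refine ⟨v, by rwa [Setting.Vst, if_neg hne], 0, Z.zero_mem, w, by simp, ?_, ?_, ?_, ?_⟩
  · refine hn.trans ?_
    gcongr
    have : 0 < C / ρ ^ 2 := by positivity
    linarith
  · rw [norm_zero]; positivity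
  · rw [norm_zero, mul_zero]; positivity
  · have h3 := hC.gap θ hθ w hw
    rw [hq, ← NonnegForm.nrm_sq] at h3
    have h4 : ‖w‖ ^ 2 ≤ C / ρ ^ 2 * (S.a θ).nrm (v + w) ^ 2 := by
      rw [div_mul_eq_mul_div, le_div_iff₀ (by positivity), mul_comm]
      exact le_trans (by gcongr) h3
    refine (le_mul_of_sq_le_mul_sq (by positivity) hq0 h4).trans ?_
    gcongr
    linarith [pow_pos hCp 2]

/-- φ = v₁ + w₁ along V_θ and W_θ, then w₁ = v₀ + z + w along V_⋆, Z and W_0. (H3) controls |θ|‖w₁‖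
by a_θ[φ]^{1/2}, hence also |θ|‖v₀‖ and |θ|‖z‖. Replacing v₀ by a nearby v₂ in V_θ costs O(|θ|‖v₀‖),
which goes into the remainder. -/
theorem exists_hasDecomposition_of_small [CompleteSpace H] : ∃ D ≥ 0, ∀ θ ∈ S.Θ, θ ≠ 0 →
    ‖θ‖ ≤ 1 / (2 * C ^ 2) → ∀ φ, S.HasDecomposition Vstar Z D θ φ := by
  obtain ⟨D₁, hD₁, hV⟩ := hC.exists_a_bound_on_V
  have hCp := hC.pos
  set k₀ : ℝ := 2 * C ^ 2 * (C + 1) with hk₀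
  set k₁ : ℝ := 2 * C ^ 2 + C * (2 * C ^ 2 * (2 * C ^ 2)) * (1 + C * C) with hk₁
  set k₂ : ℝ := (2 * C + 1) * (1 + (D₁ + 1) * k₀) + C * (C * k₀) with hk₂
  have e0 : 0 ≤ k₀ := by positivity
  have e1 : 0 ≤ k₁ := by positivity
  have e2 : 0 ≤ k₂ := by positivity
  have e3 : 0 ≤ C * k₀ := by positivity
  have e4 : 0 ≤ C * (2 * C ^ 2 * (2 * C ^ 2)) := by positivity
  refine ⟨k₁ + k₂ + C * k₀ + C * (2 * C ^ 2 * (2 * C ^ 2)), by positivity,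
    fun θ hθ hne hθs φ => ?_⟩
  obtain ⟨v₁, hv₁, w₁, hw₁, hφ, hv₁n, hw₁n, hq⟩ := hC.exists_V_add_W hθ φ
  obtain ⟨ψ, hψ, w, hw, hψw, hψn, -, hq'⟩ := hC.exists_V_add_W hC.zero_mem w₁
  obtain ⟨v₀, hv₀, z, hz, hψz⟩ := hC.exists_add_eq hψ
  obtain ⟨h1, h2⟩ := hC.direct v₀ hv₀ z hz
  rw [← hψz] at h1 h2
  obtain ⟨v₂, hv₂, hv₀₂⟩ := hC.near 0 hC.zero_mem θ hθ v₀ (by rwa [Setting.Vst, if_pos rfl])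
  rw [zero_sub, norm_neg] at hv₀₂
  set q := (S.a θ).nrm φ with hqdef
  have hq0 : 0 ≤ q := (S.a θ).nrm_nonneg φ
  have hqw : (S.a θ).nrm w₁ = q := by rw [hqdef, NonnegForm.nrm, NonnegForm.nrm, hq]
  have hθw₁ : ‖θ‖ * ‖w₁‖ ≤ (C + 1) * q := by
    have h3 := hC.gap θ hθ w₁ hw₁
    rw [hq, ← NonnegForm.nrm_sq, ← mul_pow] at h3
    exact le_mul_of_sq_le_mul_sq hC.nonneg hq0 h3
  have hθψ : ‖θ‖ * ‖ψ‖ ≤ k₀ * q := by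
    calc ‖θ‖ * ‖ψ‖ ≤ ‖θ‖ * (2 * C ^ 2 * ‖w₁‖) := by gcongr
      _ = 2 * C ^ 2 * (‖θ‖ * ‖w₁‖) := by ring
      _ ≤ 2 * C ^ 2 * ((C + 1) * q) := by gcongr
      _ = _ := by ring
  have haψ : (S.a θ).nrm ψ ≤ (D₁ + 1) * (k₀ * q) := by
    refine (le_mul_of_sq_le_mul_sq hD₁ (by positivity) (y := ‖θ‖ * ‖ψ‖) ?_).trans (by gcongr)
    rw [NonnegForm.nrm_sq]
    calc (S.a θ).quad ψ ≤ ‖(S.a θ).toForm ψ ψ‖ := Complex.re_le_norm _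
      _ ≤ D₁ * ‖θ‖ ^ 2 * ‖ψ‖ * ‖ψ‖ := hV θ hθ ⟨ψ, hψ⟩ ⟨ψ, hψ⟩
      _ = _ := by ring
  have haw : (S.a θ).nrm w ≤ (1 + (D₁ + 1) * k₀) * q := by
    have : w = w₁ - ψ := by rw [hψw]; abel
    rw [this]
    refine ((S.a θ).nrm_sub_le _ _).trans ?_
    rw [hqw]
    linarith
  -- On W_0 the form a_0 is coercive; for |θ| ≤ 1/(2C²) the Lipschitz error is absorbed, so a_θ is
  -- coercive there too.
  have hwn : ‖w‖ ≤ (2 * C + 1) * ((1 + (D₁ + 1) * k₀) * q) := by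
    have h3 := hC.gap_zero w hw
    have h4 := hC.a_sub_le θ hθ w w
    have h5 := (abs_le.1 ((Complex.abs_re_le_norm _).trans h4)).1
    rw [Complex.sub_re] at h5
    change _ ≤ (S.a θ).quad w - (S.a 0).quad w at h5
    have h6 : C * (C * ‖θ‖ * ‖w‖ * ‖w‖) ≤ 1 / 2 * ‖w‖ ^ 2 := by
      calc C * (C * ‖θ‖ * ‖w‖ * ‖w‖) ≤ C * (C * (1 / (2 * C ^ 2)) * ‖w‖ * ‖w‖) := by gcongr
        _ = _ := by field_simp
    have h7 : C * (S.a 0).quad w ≤ C * ((S.a θ).quad w + C * ‖θ‖ * ‖w‖ * ‖w‖) := by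
      gcongr; linarith
    have h8 : ‖w‖ ^ 2 ≤ 2 * C * (S.a θ).nrm w ^ 2 := by
      rw [NonnegForm.nrm_sq]; linarith
    refine (le_mul_of_sq_le_mul_sq (by positivity) ((S.a θ).nrm_nonneg w) h8).trans ?_
    gcongr
  have hψφ : ‖ψ‖ ≤ 2 * C ^ 2 * (2 * C ^ 2) * ‖φ‖ := by
    calc ‖ψ‖ ≤ 2 * C ^ 2 * (2 * C ^ 2 * ‖φ‖) := hψn.trans (by gcongr)
      _ = _ := by ring
  refine ⟨v₁ + v₂, Submodule.add_mem _ (by rwa [Setting.Vst, if_neg hne]) hv₂, z, hz,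
    w + (v₀ - v₂), ?_, ?_, ?_, ?_, ?_⟩
  · rw [hφ, hψw, hψz]; abel
  · have h3 : ‖v₂‖ ≤ (1 + C * C) * ‖v₀‖ := by
      have : v₂ = v₀ - (v₀ - v₂) := by abel
      rw [this]
      refine (norm_sub_le _ _).trans ?_
      have := hC.norm_param_le θ hθ
      calc ‖v₀‖ + ‖v₀ - v₂‖ ≤ ‖v₀‖ + C * C * ‖v₀‖ := by
            gcongr
            exact hv₀₂.trans (by gcongr)
        _ = _ := by ring
    calc ‖v₁ + v₂‖ ≤ ‖v₁‖ + ‖v₂‖ := norm_add_le _ _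
      _ ≤ 2 * C ^ 2 * ‖φ‖ + (1 + C * C) * (C * (2 * C ^ 2 * (2 * C ^ 2) * ‖φ‖)) := by
          refine add_le_add hv₁n (h3.trans ?_)
          gcongr
          exact h1.trans (by gcongr)
      _ = k₁ * ‖φ‖ := by rw [hk₁]; ring
      _ ≤ _ := by gcongr; linarith
  · calc ‖(z : H)‖ ≤ C * (2 * C ^ 2 * (2 * C ^ 2) * ‖φ‖) := h2.trans (by gcongr)
      _ = C * (2 * C ^ 2 * (2 * C ^ 2)) * ‖φ‖ := by ring
      _ ≤ _ := by gcongr; linarith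
  · calc ‖θ‖ * ‖(z : H)‖ ≤ ‖θ‖ * (C * ‖ψ‖) := by gcongr
      _ = C * (‖θ‖ * ‖ψ‖) := by ring
      _ ≤ C * (k₀ * q) := by gcongr
      _ = C * k₀ * q := by ring
      _ ≤ _ := by gcongr; linarith
  · calc ‖w + (v₀ - v₂)‖ ≤ ‖w‖ + ‖v₀ - v₂‖ := norm_add_le _ _
      _ ≤ (2 * C + 1) * ((1 + (D₁ + 1) * k₀) * q) + C * (C * (k₀ * q)) := by
          refine add_le_add hwn (hv₀₂.trans ?_)
          calc C * ‖θ‖ * ‖v₀‖ ≤ C * ‖θ‖ * (C * ‖ψ‖) := by gcongr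
            _ = C * (C * (‖θ‖ * ‖ψ‖)) := by ring
            _ ≤ _ := by gcongr
      _ = k₂ * q := by rw [hk₂]; ring
      _ ≤ _ := by gcongr; linarith

theorem exists_hasDecomposition [CompleteSpace H] : ∃ D ≥ 0, ∀ θ ∈ S.Θ, ∀ φ,
    S.HasDecomposition Vstar Z D θ φ := by
  obtain ⟨D, hD, h⟩ := hC.exists_hasDecomposition_of_small
  have hCp := hC.pos
  set D₁ := 2 * C ^ 3 + C + 1 with hD₁
  set ρ := 1 / (2 * C ^ 2) with hρ
  have hρ0 : 0 < ρ := by positivity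
  set D₂ := 2 * C ^ 2 + C / ρ ^ 2 + 1 with hD₂
  have h1 : 0 ≤ D₁ := by positivity
  have h2 : 0 ≤ D₂ := by positivity
  refine ⟨D + D₁ + D₂, by positivity, fun θ hθ φ => ?_⟩
  rcases eq_or_ne θ 0 with rfl | hne
  · exact (hC.hasDecomposition_zero φ).mono (by linarith)
  rcases le_total ‖θ‖ ρ with hle | hle
  · exact (h θ hθ hne hle φ).mono (by linarith)
  · exact (hC.hasDecomposition_of_le_norm hρ0 hθ hle φ).mono (by linarith)

end Bounds
end Setting

/-! ### The trial solution, its residual and the operator estimate -/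

namespace Setting

variable {n : ℕ} {H 𝓗 : Type*} [NormedAddCommGroup H] [InnerProductSpace ℂ H]
  [NormedAddCommGroup 𝓗] [InnerProductSpace ℂ 𝓗]

/-- The non-negative form `ε⁻² a_θ + b_θ`. -/
def opForm (S : Setting n H 𝓗) (ε : ℝ) (θ : Param n) : NonnegForm H :=
  (S.a θ).smul (ε ^ 2)⁻¹ (by positivity) + S.b θ

theorem opForm_toForm (S : Setting n H 𝓗) (ε : ℝ) (θ : Param n) :
    (S.opForm ε θ).toForm = ((ε : ℂ) ^ 2)⁻¹ • (S.a θ).toForm + (S.b θ).toForm := by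
  rw [opForm, NonnegForm.add_toForm, NonnegForm.smul]
  push_cast
  rfl

theorem opForm_apply (S : Setting n H 𝓗) (ε : ℝ) (θ : Param n) (u v : H) :
    (S.opForm ε θ).toForm u v = ((ε : ℂ) ^ 2)⁻¹ * (S.a θ).toForm u v + (S.b θ).toForm u v := by
  rw [opForm_toForm]; rfl

theorem opForm_quad (S : Setting n H 𝓗) (ε : ℝ) (θ : Param n) (u : H) :
    (S.opForm ε θ).quad u = (ε ^ 2)⁻¹ * (S.a θ).quad u + (S.b θ).quad u := by
  rw [NonnegForm.quad, opForm_apply, NonnegForm.quad, NonnegForm.quad, Complex.add_re,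
    ← Complex.ofReal_pow, ← Complex.ofReal_inv, Complex.re_ofReal_mul]

variable {S : Setting n H 𝓗}

theorem a_nrm_le_opForm {ε : ℝ} (hε : 0 < ε) (θ : Param n) (u : H) :
    (S.a θ).nrm u ≤ ε * (S.opForm ε θ).nrm u := by
  have : (S.a θ).quad u ≤ ε ^ 2 * (S.opForm ε θ).quad u := by
    rw [opForm_quad, mul_add, ← mul_assoc, mul_inv_cancel₀ (by positivity), one_mul]
    have := (S.b θ).quad_nonneg u
    have : 0 ≤ ε ^ 2 * (S.b θ).quad u := by positivity
    linarith
  rw [← NonnegForm.nrm_sq, ← NonnegForm.nrm_sq, ← mul_pow] at this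
  exact (abs_le_of_sq_le_sq' this (mul_nonneg hε.le (NonnegForm.nrm_nonneg _ _))).2

theorem nrm_le_opForm {ε : ℝ} (hε : 0 < ε) (hε1 : ε < 1) (θ : Param n) (u : H) :
    S.nrm θ u ≤ (S.opForm ε θ).nrm u := by
  refine Real.sqrt_le_sqrt ?_
  rw [opForm_quad, NonnegForm.add_quad]
  have h1 : 1 ≤ (ε ^ 2)⁻¹ := (one_le_inv₀ (by positivity)).2 (by nlinarith)
  have := (S.a θ).quad_nonneg u
  nlinarith

variable
  {Vstar : Submodule ℂ H} {Z : Submodule ℂ (S.V 0)}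
  {a₁ : S.V 0 →ₗ[ℂ] H →ₗ⋆[ℂ] (Fin n → ℂ)}
  {a₂ : S.V 0 →ₗ[ℂ] S.V 0 →ₗ⋆[ℂ] Matrix (Fin n) (Fin n) ℂ}
  {E : Param n → 𝓗 ≃ₗ[ℂ] 𝓗} {C : ℝ}

theorem limitForm_apply (ξ : Param n) (p q : Vstar × Z) :
    S.limitForm Vstar Z a₁ a₂ ξ p q = S.homForm a₁ a₂ ξ p.2 q.2 +
      (S.b 0).toForm ((p.1 : H) + (p.2 : S.V 0)) ((q.1 : H) + (q.2 : S.V 0)) := rfl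

theorem sumMap_apply (p : Vstar × Z) : S.sumMap Vstar Z p = (p.1 : H) + (p.2 : S.V 0) := rfl

namespace Bounds

variable (hC : S.Bounds Vstar Z a₁ a₂ E C)
include hC

theorem nrm_d_E {θ : Param n} (hθ : θ ∈ S.Θ) (u : 𝓗) : (S.d θ).nrm (E θ u) = (S.d 0).nrm u := by
  rw [NonnegForm.nrm, NonnegForm.nrm, NonnegForm.quad, NonnegForm.quad, hC.d_E θ hθ]

theorem nrm_d_E_symm {θ : Param n} (hθ : θ ∈ S.Θ) (g : 𝓗) :
    (S.d 0).nrm ((E θ).symm g) = (S.d θ).nrm g := by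
  rw [← hC.nrm_d_E hθ, LinearEquiv.apply_symm_apply]

theorem d_E_symm {θ : Param n} (hθ : θ ∈ S.Θ) (g u : 𝓗) :
    (S.d 0).toForm ((E θ).symm g) u = (S.d θ).toForm g (E θ u) := by
  rw [← hC.d_E θ hθ, LinearEquiv.apply_symm_apply]

theorem norm_le_opForm {ε : ℝ} (hε : 0 < ε) (hε1 : ε < 1) {θ : Param n} (hθ : θ ∈ S.Θ) (u : H) :
    ‖u‖ ≤ C * (S.opForm ε θ).nrm u :=
  (hC.norm_le θ hθ u).trans (mul_le_mul_of_nonneg_left (nrm_le_opForm hε hε1 θ u) hC.nonneg)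

/-- A priori bounds for the solution of the limit problem. -/
theorem exists_limit_bounds [CompleteSpace H] : ∃ D ≥ 0, ∀ (ξ : Param n) (g : 𝓗) (p : Vstar × Z),
    (∀ q : Vstar × Z, S.limitForm Vstar Z a₁ a₂ ξ p q =
      (S.d 0).toForm g (S.ι (S.sumMap Vstar Z q))) →
    ‖p.1‖ ≤ D * (S.d 0).nrm g ∧ ‖p.2‖ ≤ D * (S.d 0).nrm g ∧
      ‖ξ‖ ^ 2 * ‖p.2‖ ≤ D * (S.d 0).nrm g := by
  obtain ⟨c, hc, hcoer⟩ := hC.exists_homForm_coercive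
  have hCp := hC.pos
  refine ⟨C ^ 2 + c⁻¹ * (C + C ^ 2), by positivity, fun ξ g p hp => ?_⟩
  obtain ⟨v, z⟩ := p
  set γ := (S.d 0).nrm g
  have hγ : 0 ≤ γ := NonnegForm.nrm_nonneg _ _
  set s : H := (v : H) + (z : S.V 0) with hs
  have hsV : s ∈ S.V 0 := Submodule.add_mem _ (hC.Vstar_le v.2) (z : S.V 0).2
  have hd : ∀ x : H, ‖(S.d 0).toForm g (S.ι x)‖ ≤ γ * (S.b 0).nrm x := fun x =>
    ((S.d 0).norm_apply_le _ _).trans (mul_le_mul_of_nonneg_left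
      (Real.sqrt_le_sqrt (S.d_le_b 0 hC.zero_mem x)) hγ)
  -- Test with the solution itself, dropping a^h_ξ[z] ≥ 0 and using d_0 ≤ b_0.
  have hsb : (S.b 0).nrm s ≤ γ := by
    have h1 : (S.b 0).nrm s ^ 2 ≤ γ * (S.b 0).nrm s := by
      have h2 := hp (v, z)
      rw [limitForm_apply, sumMap_apply] at h2
      have h3 := congrArg Complex.re h2
      rw [Complex.add_re] at h3
      have h4 := hcoer ξ z z.2
      have h5 : 0 ≤ c * ‖ξ‖ ^ 2 * ‖(z : S.V 0)‖ ^ 2 := by positivity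
      have h6 := (Complex.re_le_norm _).trans (hd s)
      rw [NonnegForm.nrm_sq, NonnegForm.quad]
      change _ + ((S.b 0).toForm s s).re = ((S.d 0).toForm g (S.ι s)).re at h3
      linarith
    rcases ((S.b 0).nrm_nonneg s).eq_or_lt with h | h
    · rw [← h]; exact hγ
    · exact le_of_mul_le_mul_right (by rw [← sq]; exact h1) h
  have hsn : ‖s‖ ≤ C * γ := by
    refine (hC.norm_le 0 hC.zero_mem s).trans ?_
    gcongr
    have : S.nrm 0 s = (S.b 0).nrm s := by
      rw [← sq_eq_sq₀ (S.nrm_nonneg _ _) (NonnegForm.nrm_nonneg _ _), S.nrm_sq_of_mem_V hsV,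
        NonnegForm.nrm_sq]
    rwa [this]
  obtain ⟨hv, hz⟩ := hC.direct v v.2 z z.2
  have hcC : 0 ≤ c⁻¹ * (C + C ^ 2) := by positivity
  have hfin : ∀ x : ℝ, x ≤ C * ‖s‖ → x ≤ (C ^ 2 + c⁻¹ * (C + C ^ 2)) * γ := by
    intro x hx
    calc x ≤ C * (C * γ) := hx.trans (by gcongr)
      _ = C ^ 2 * γ := by ring
      _ ≤ _ := by gcongr; linarith
  refine ⟨hfin _ hv, hfin _ hz, ?_⟩
  -- Testing with the Z-component alone isolates a^h_ξ[z], whose coercivity yields the factor |ξ|².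
  have h1 := hp (0, z)
  rw [limitForm_apply, sumMap_apply] at h1
  simp only [ZeroMemClass.coe_zero, zero_add] at h1
  have h2 : c * ‖ξ‖ ^ 2 * ‖(z : S.V 0)‖ ^ 2 ≤ (C + C ^ 2) * γ * ‖(z : S.V 0)‖ := by
    have h3 : ‖S.homForm a₁ a₂ ξ z z‖ ≤ γ * (C * ‖(z : S.V 0)‖) + C * ‖s‖ * ‖(z : S.V 0)‖ := by
      rw [eq_sub_of_add_eq h1]
      refine (norm_sub_le _ _).trans (add_le_add ?_ (hC.b_le 0 hC.zero_mem _ _))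
      exact ((S.d 0).norm_apply_le _ _).trans (mul_le_mul_of_nonneg_left
        (hC.d_le 0 hC.zero_mem _) hγ)
    calc c * ‖ξ‖ ^ 2 * ‖(z : S.V 0)‖ ^ 2 ≤ ‖S.homForm a₁ a₂ ξ z z‖ :=
          (hcoer ξ z z.2).trans (Complex.re_le_norm _)
      _ ≤ γ * (C * ‖(z : S.V 0)‖) + C * (C * γ) * ‖(z : S.V 0)‖ := h3.trans (by gcongr)
      _ = _ := by ring
  rcases (norm_nonneg (z : S.V 0)).eq_or_lt with h | h
  · change ‖ξ‖ ^ 2 * ‖(z : S.V 0)‖ ≤ _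
    rw [← h, mul_zero]; positivity
  · have h3 : ‖ξ‖ ^ 2 * ‖(z : S.V 0)‖ ≤ c⁻¹ * ((C + C ^ 2) * γ) := by
      rw [← div_eq_inv_mul, le_div_iff₀ hc]
      refine le_of_mul_le_mul_right (le_trans (le_of_eq ?_) h2) h
      ring
    calc ‖ξ‖ ^ 2 * ‖z‖ ≤ c⁻¹ * ((C + C ^ 2) * γ) := h3
      _ = c⁻¹ * (C + C ^ 2) * γ := by ring
      _ ≤ _ := by gcongr; linarith [pow_pos hCp 2]

/-- The residual of the trial field `T_θ v + z + N_θ z` is `O(ε)`. -/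
theorem exists_residual_bound [CompleteSpace H] : ∃ D ≥ 0, ∀ (ε : ℝ), 0 < ε → ε < 1 →
    ∀ θ ∈ S.Θ, ∀ (T : Vstar ≃ₗ[ℂ] S.Vst Vstar θ),
    (∀ v : Vstar, S.ι (T v : H) = E θ (S.ι v)) →
    (∀ v v' : Vstar, (S.b θ).toForm (T v) (T v') = (S.b 0).toForm v v') →
    (∀ v : Vstar, ∀ z ∈ Z, ‖(S.b θ).toForm (T v) z - (S.b 0).toForm v z‖ ≤
        C * ‖θ‖ * ‖v‖ * ‖z‖) →
    (∀ v : Vstar, ‖T v‖ ≤ C * ‖v‖) → (∀ v : Vstar, ‖v‖ ≤ C * ‖T v‖) →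
    ∀ (g : 𝓗) (p : Vstar × Z) (P : ℝ), 0 ≤ P →
    (∀ q : Vstar × Z, S.limitForm Vstar Z a₁ a₂ (ε⁻¹ • θ) p q =
      (S.d 0).toForm ((E θ).symm g) (S.ι (S.sumMap Vstar Z q))) →
    (S.d θ).nrm g ≤ P → ‖p.1‖ ≤ P → ‖p.2‖ ≤ P → ‖ε⁻¹ • θ‖ ^ 2 * ‖p.2‖ ≤ P →
    ‖θ‖ * ‖p.2‖ ≤ ε * P →
    ∀ φ : H, ‖(S.opForm ε θ).toForm
        ((T p.1 : H) + ((p.2 : S.V 0) + S.corrector a₁ θ (p.2 : S.V 0))) φ -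
          (S.d θ).toForm g (S.ι φ)‖ ≤ D * ε * P * (S.opForm ε θ).nrm φ := by
  obtain ⟨D, hD, hdec⟩ := hC.exists_hasDecomposition
  obtain ⟨DN, hDN, hN⟩ := hC.exists_corrector_bound
  obtain ⟨D₁, hD₁, h₁⟩ := hC.exists_a_corrected_bound
  obtain ⟨D₂, hD₂, h₂⟩ := hC.exists_a_sub_homForm_bound
  have hCp := hC.pos
  set k₁ : ℝ := C * (C * (D * C)) + C * DN * (D * C) with hk₁
  set k₂ : ℝ := D₂ * D + C * D + C * (D * C) + C * DN * (D * C) + C * C * D with hk₂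
  set k₃ : ℝ := D₁ * D + C * (C + (1 + DN * C)) * D + C * D with hk₃
  refine ⟨k₁ + k₂ + k₃, by positivity, ?_⟩
  intro ε hε hε1 θ hθ T hT1 hT2 hT3 hT4 hT5 g p P hP hp hg hv hz hξz hθz φ
  obtain ⟨v, z⟩ := p
  simp only at hv hz hξz hθz ⊢
  obtain ⟨z, hzZ⟩ := z
  simp only [Submodule.coe_norm] at hz hξz hθz
  set A := S.opForm ε θ with hA
  set q := A.nrm φ with hq
  have hq0 : 0 ≤ q := A.nrm_nonneg φ
  set N : H := ((S.corrector a₁ θ z : S.W 0) : H) with hNdef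
  have hz' : ‖(z : H)‖ ≤ P := hz
  have hNz : ‖N‖ ≤ DN * (‖θ‖ * ‖(z : H)‖) := (hN θ z).trans_eq (by rw [Submodule.coe_norm]; ring)
  have hNε : ‖N‖ ≤ DN * (ε * P) := hNz.trans (by gcongr)
  have hNP : ‖N‖ ≤ DN * C * P := by
    calc ‖N‖ ≤ DN * (‖θ‖ * ‖(z : H)‖) := hNz
      _ ≤ DN * (C * P) := by gcongr; exact hC.norm_param_le θ hθ
      _ = _ := by ring
  have hφq : ‖φ‖ ≤ C * q := hC.norm_le_opForm hε hε1 hθ φ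
  obtain ⟨v', hv', z', hz'Z, r, hφ, hv'n, hz'n, hθz', hr⟩ := hdec θ hθ φ
  have haφ : (S.a θ).nrm φ ≤ ε * q := a_nrm_le_opForm hε θ φ
  have hv'n : ‖v'‖ ≤ D * C * q := by
    calc ‖v'‖ ≤ D * (C * q) := hv'n.trans (by gcongr)
      _ = _ := by ring
  have hz'n : ‖(z' : H)‖ ≤ D * C * q := by
    calc ‖(z' : H)‖ ≤ D * (C * q) := hz'n.trans (by gcongr)
      _ = _ := by ring
  have hθz' : ‖θ‖ * ‖(z' : H)‖ ≤ D * (ε * q) := hθz'.trans (by gcongr)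
  have hr : ‖r‖ ≤ D * (ε * q) := hr.trans (by gcongr)
  have hTv : (T v : H) ∈ S.V θ := hC.Vst_le θ (T v).2
  -- The limit equation is tested with the preimage v₀ of v', so that b_θ(T v, v') and b_0(v, v₀)
  -- cancel exactly.
  obtain ⟨v₀, hv₀⟩ := T.surjective ⟨v', hv'⟩
  have hv₀' : (T v₀ : H) = v' := by rw [hv₀]
  have hv₀n : ‖(v₀ : H)‖ ≤ C * (D * C * q) := by
    have := hT5 v₀
    rw [hv₀] at this
    exact this.trans (mul_le_mul_of_nonneg_left hv'n hCp.le)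
  have hpv := hp (v₀, 0)
  have hpz := hp (0, ⟨z', hz'Z⟩)
  rw [limitForm_apply, sumMap_apply, hC.d_E_symm hθ] at hpv hpz
  simp only [ZeroMemClass.coe_zero, zero_add, add_zero, map_zero] at hpv hpz
  rw [← hT1, hv₀'] at hpv
  -- the three contributions
  have I₁ : ‖A.toForm ((T v : H) + (z + N)) v' - (S.d θ).toForm g (S.ι v')‖ ≤ k₁ * ε * P * q := by
    -- v' lies in V_θ, so the singular term ε⁻²a_θ drops out; what remains carries |θ|‖z‖ or ‖N‖.
    have e : A.toForm ((T v : H) + (z + N)) v' - (S.d θ).toForm g (S.ι v') =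
        (starRingEnd ℂ) ((S.b θ).toForm (T v₀) z - (S.b 0).toForm v₀ z) +
          (S.b θ).toForm N v' := by
      rw [← hpv, opForm_apply, S.a_apply_right (hC.Vst_le θ hv'), map_sub, NonnegForm.conj_symm,
        NonnegForm.conj_symm, hv₀', map_add (S.b θ).toForm, map_add (S.b θ).toForm,
        map_add (S.b 0).toForm, LinearMap.add_apply, LinearMap.add_apply, LinearMap.add_apply,
        ← hT2 v v₀, hv₀']
      ring
    rw [e]
    calc _ ≤ C * ‖θ‖ * ‖(v₀ : H)‖ * ‖(z : H)‖ + C * ‖N‖ * ‖v'‖ := by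
          refine (norm_add_le _ _).trans (add_le_add ?_ (hC.b_le θ hθ _ _))
          rw [RCLike.norm_conj]
          exact hT3 v₀ z hzZ
      _ = C * (‖θ‖ * ‖(z : H)‖) * ‖(v₀ : H)‖ + C * ‖N‖ * ‖v'‖ := by ring
      _ ≤ C * (ε * P) * (C * (D * C * q)) + C * (DN * (ε * P)) * (D * C * q) := by gcongr
      _ = _ := by rw [hk₁]; ring
  have I₂ : ‖A.toForm ((T v : H) + (z + N)) z' - (S.d θ).toForm g (S.ι z')‖ ≤ k₂ * ε * P * q := by
    have hhom : S.homForm a₁ a₂ (ε⁻¹ • θ) z z' = ((ε : ℂ) ^ 2)⁻¹ * S.homForm a₁ a₂ θ z z' := by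
      rw [hC.homForm_smul]
      push_cast
      rw [inv_pow]
    have e : A.toForm ((T v : H) + (z + N)) z' - (S.d θ).toForm g (S.ι z') =
        ((ε : ℂ) ^ 2)⁻¹ * ((S.a θ).toForm (z + N) z' - S.homForm a₁ a₂ θ z z') +
        ((S.b θ).toForm (T v) z' - (S.b 0).toForm v z') +
        ((S.b θ).toForm z z' - (S.b 0).toForm z z') + (S.b θ).toForm N z' +
        (S.d θ).toForm g (E θ (S.ι z') - S.ι z') := by
      rw [map_sub ((S.d θ).toForm g), ← hpz, hhom, opForm_apply, map_add (S.a θ).toForm (T v : H),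
        LinearMap.add_apply, S.a_apply_left hTv, map_add (S.b θ).toForm, map_add (S.b θ).toForm,
        map_add (S.b 0).toForm, LinearMap.add_apply, LinearMap.add_apply, LinearMap.add_apply]
      ring
    -- The three powers of |θ| are distributed as (|θ/ε|²‖z‖)(|θ|‖z'‖): the first factor is at most
    -- P, the second is O(ε).
    have n₁ : ‖((ε : ℂ) ^ 2)⁻¹ * ((S.a θ).toForm (z + N) z' - S.homForm a₁ a₂ θ z z')‖ ≤
        D₂ * P * (D * (ε * q)) := by
      rw [norm_mul, norm_inv, norm_pow, Complex.norm_real, Real.norm_of_nonneg hε.le]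
      calc _ ≤ (ε ^ 2)⁻¹ * (D₂ * ‖θ‖ ^ 3 * ‖(z : H)‖ * ‖(z' : H)‖) := by
            gcongr; exact h₂ θ hθ z z'
        _ = D₂ * (‖ε⁻¹ • θ‖ ^ 2 * ‖(z : H)‖) * (‖θ‖ * ‖(z' : H)‖) := by
            rw [norm_smul, norm_inv, Real.norm_of_nonneg hε.le]; field_simp
        _ ≤ _ := by gcongr
    have n₅ : ‖(S.d θ).toForm g (E θ (S.ι z') - S.ι z')‖ ≤ P * (C * C * (D * (ε * q))) := by
      refine ((S.d θ).norm_apply_le _ _).trans ?_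
      refine mul_le_mul hg ?_ (NonnegForm.nrm_nonneg _ _) hP
      calc _ ≤ C * ‖θ‖ * (S.d 0).nrm (S.ι z') := hC.E_sub_le θ hθ _
        _ ≤ C * ‖θ‖ * (C * ‖(z' : H)‖) := by gcongr; exact hC.d_le 0 hC.zero_mem _
        _ = C * C * (‖θ‖ * ‖(z' : H)‖) := by ring
        _ ≤ _ := by gcongr
    rw [e]
    calc _ ≤ D₂ * P * (D * (ε * q)) + C * ‖θ‖ * ‖(v : H)‖ * ‖(z' : H)‖ +
            C * ‖θ‖ * ‖(z : H)‖ * ‖(z' : H)‖ + C * ‖N‖ * ‖(z' : H)‖ +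
            P * (C * C * (D * (ε * q))) := by
          refine (norm_add_le _ _).trans (add_le_add ?_ n₅)
          refine (norm_add_le _ _).trans (add_le_add ?_ (hC.b_le θ hθ _ _))
          refine (norm_add_le _ _).trans (add_le_add ?_ (hC.b_sub_le _ z.2 _ z'.2 θ hθ))
          exact (norm_add_le _ _).trans (add_le_add n₁ (hT3 v z' hz'Z))
      _ = D₂ * P * (D * (ε * q)) + C * ‖(v : H)‖ * (‖θ‖ * ‖(z' : H)‖) +
            C * (‖θ‖ * ‖(z : H)‖) * ‖(z' : H)‖ + C * ‖N‖ * ‖(z' : H)‖ +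
            P * (C * C * (D * (ε * q))) := by ring
      _ ≤ D₂ * P * (D * (ε * q)) + C * P * (D * (ε * q)) +
            C * (ε * P) * (D * C * q) + C * (DN * (ε * P)) * (D * C * q) +
            P * (C * C * (D * (ε * q))) := by gcongr; exact hv
      _ = _ := by rw [hk₂]; ring
  have I₃ : ‖A.toForm ((T v : H) + (z + N)) r - (S.d θ).toForm g (S.ι r)‖ ≤ k₃ * ε * P * q := by
    have e : A.toForm ((T v : H) + (z + N)) r = ((ε : ℂ) ^ 2)⁻¹ * (S.a θ).toForm (z + N) r +
        (S.b θ).toForm ((T v : H) + (z + N)) r := by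
      rw [opForm_apply, map_add (S.a θ).toForm (T v : H), LinearMap.add_apply,
        S.a_apply_left hTv, zero_add]
    -- Only |θ|² is available against r, but ‖r‖ itself is O(ε) in the energy norm.
    have n₁ : ‖((ε : ℂ) ^ 2)⁻¹ * (S.a θ).toForm (z + N) r‖ ≤ D₁ * P * (D * (ε * q)) := by
      rw [norm_mul, norm_inv, norm_pow, Complex.norm_real, Real.norm_of_nonneg hε.le]
      calc _ ≤ (ε ^ 2)⁻¹ * (D₁ * ‖θ‖ ^ 2 * ‖(z : H)‖ * ‖r‖) := by
            gcongr; exact h₁ θ hθ z r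
        _ = D₁ * (‖ε⁻¹ • θ‖ ^ 2 * ‖(z : H)‖) * ‖r‖ := by
            rw [norm_smul, norm_inv, Real.norm_of_nonneg hε.le]; field_simp
        _ ≤ _ := by gcongr
    have nJ : ‖(T v : H) + (z + N)‖ ≤ (C + (1 + DN * C)) * P := by
      calc _ ≤ ‖(T v : H)‖ + (‖(z : H)‖ + ‖N‖) :=
            (norm_add_le _ _).trans (add_le_add le_rfl (norm_add_le _ _))
        _ ≤ C * P + (P + DN * C * P) := by
            gcongr
            exact (hT4 v).trans (by gcongr)
        _ = _ := by ring
    have n₃ : ‖(S.d θ).toForm g (S.ι r)‖ ≤ P * (C * (D * (ε * q))) := by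
      refine ((S.d θ).norm_apply_le _ _).trans ?_
      refine mul_le_mul hg ((hC.d_le θ hθ r).trans (by gcongr)) (NonnegForm.nrm_nonneg _ _) hP
    rw [e]
    calc _ ≤ D₁ * P * (D * (ε * q)) + C * ‖(T v : H) + (z + N)‖ * ‖r‖ +
          P * (C * (D * (ε * q))) := by
          refine (norm_sub_le _ _).trans (add_le_add ?_ n₃)
          exact (norm_add_le _ _).trans (add_le_add n₁ (hC.b_le θ hθ _ _))
      _ ≤ D₁ * P * (D * (ε * q)) + C * ((C + (1 + DN * C)) * P) * (D * (ε * q)) +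
          P * (C * (D * (ε * q))) := by gcongr
      _ = _ := by rw [hk₃]; ring
  calc _ = ‖(A.toForm ((T v : H) + (z + N)) v' - (S.d θ).toForm g (S.ι v')) +
        (A.toForm ((T v : H) + (z + N)) z' - (S.d θ).toForm g (S.ι z')) +
        (A.toForm ((T v : H) + (z + N)) r - (S.d θ).toForm g (S.ι r))‖ := by
        rw [hφ]
        simp only [map_add (A.toForm ((T v : H) + (z + N))), map_add S.ι,
          map_add ((S.d θ).toForm g)]
        congr 1; ring
    _ ≤ k₁ * ε * P * q + k₂ * ε * P * q + k₃ * ε * P * q :=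
        (norm_add_le _ _).trans (add_le_add ((norm_add_le _ _).trans (add_le_add I₁ I₂)) I₃)
    _ = _ := by ring

/-- The operator estimate, for the solutions of the two problems. -/
theorem exists_solution_estimate [CompleteSpace H] : ∃ D ≥ 0, ∀ (ε : ℝ), 0 < ε → ε < 1 →
    ∀ θ ∈ S.Θ, ∀ (g : 𝓗) (u : H) (p : Vstar × Z),
    (∀ φ, (S.opForm ε θ).toForm u φ = (S.d θ).toForm g (S.ι φ)) →
    (∀ q : Vstar × Z, S.limitForm Vstar Z a₁ a₂ (ε⁻¹ • θ) p q =
      (S.d 0).toForm ((E θ).symm g) (S.ι (S.sumMap Vstar Z q))) →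
    (S.d θ).nrm (S.ι u - E θ (S.ι (S.sumMap Vstar Z p))) ≤ D * ε * (S.d θ).nrm g := by
  obtain ⟨D, hD, hlim⟩ := hC.exists_limit_bounds
  obtain ⟨D', hD', hres⟩ := hC.exists_residual_bound
  obtain ⟨DN, hDN, hN⟩ := hC.exists_corrector_bound
  have hCp := hC.pos
  refine ⟨(D' + C * C + C * DN) * (2 * D + 1), by positivity, ?_⟩
  intro ε hε hε1 θ hθ g u p hu hp
  obtain ⟨T, hT1, hT2, hT3, hT4, hT5⟩ := hC.transfer θ hθ
  obtain ⟨hv, hz, hξz⟩ := hlim _ _ p hp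
  rw [hC.nrm_d_E_symm hθ] at hv hz hξz
  set γ := (S.d θ).nrm g
  have hγ : 0 ≤ γ := NonnegForm.nrm_nonneg _ _
  -- The factor covers ‖g‖, the three a priori bounds Dγ, and the sum 2Dγ arising for |θ|‖z‖/ε from
  -- x ≤ x² + 1.
  set P := (2 * D + 1) * γ with hPdef
  have hP : 0 ≤ P := by positivity
  have hDP : D * γ ≤ P := by rw [hPdef]; gcongr; linarith
  have hθz : ‖θ‖ * ‖p.2‖ ≤ ε * P := by
    have h1 : ‖θ‖ = ε * ‖ε⁻¹ • θ‖ := by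
      rw [norm_smul, norm_inv, Real.norm_of_nonneg hε.le, mul_inv_cancel_left₀ hε.ne']
    have h2 : ‖ε⁻¹ • θ‖ ≤ ‖ε⁻¹ • θ‖ ^ 2 + 1 := by nlinarith [sq_nonneg (‖ε⁻¹ • θ‖ - 1)]
    calc ‖θ‖ * ‖p.2‖ = ε * (‖ε⁻¹ • θ‖ * ‖p.2‖) := by rw [h1, mul_assoc]
      _ ≤ ε * ((‖ε⁻¹ • θ‖ ^ 2 + 1) * ‖p.2‖) := by gcongr
      _ = ε * (‖ε⁻¹ • θ‖ ^ 2 * ‖p.2‖ + ‖p.2‖) := by ring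
      _ ≤ ε * (D * γ + D * γ) := by gcongr
      _ ≤ _ := by rw [hPdef]; gcongr; linarith
  have hr := hres ε hε hε1 θ hθ T hT1 hT2 hT3 hT4 hT5 g p P hP hp
    (by rw [hPdef]; nlinarith) (hv.trans hDP) (hz.trans hDP) (hξz.trans hDP) hθz
  set N : H := ((S.corrector a₁ θ (p.2 : S.V 0) : S.W 0) : H) with hNdef
  set A := S.opForm ε θ with hA
  set e : H := (T p.1 : H) + (((p.2 : S.V 0) : H) + N) - u with he
  -- Testing the residual with the error e turns the dual bound into an energy bound.
  have hAe : A.nrm e ≤ D' * ε * P := by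
    have h1 : A.nrm e ^ 2 ≤ D' * ε * P * A.nrm e := by
      have h2 := hr e
      rw [← hu, ← LinearMap.sub_apply, ← map_sub, A.apply_self, Complex.norm_real,
        Real.norm_of_nonneg (A.quad_nonneg e), ← NonnegForm.nrm_sq] at h2
      exact h2
    rcases (A.nrm_nonneg e).eq_or_lt with h | h
    · rw [← h]; positivity
    · exact le_of_mul_le_mul_right (by rw [← sq]; exact h1) h
  have hde : (S.d θ).nrm (S.ι e) ≤ D' * ε * P :=
    (Real.sqrt_le_sqrt (S.d_le_b θ hθ e)).trans
      ((S.b_nrm_le θ e).trans ((nrm_le_opForm hε hε1 θ e).trans hAe))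
  -- Compared with the trial solution, the approximation omits N and replaces z by 𝓔_θ z; both
  -- changes are O(|θ|‖z‖).
  have hsplit : S.ι u - E θ (S.ι (S.sumMap Vstar Z p)) =
      S.ι N - S.ι e - (E θ (S.ι (p.2 : S.V 0)) - S.ι (p.2 : S.V 0)) := by
    rw [sumMap_apply, he, map_add S.ι, map_sub S.ι, map_add S.ι, map_add S.ι, map_add (E θ),
      hT1]
    abel
  have hNε : ‖N‖ ≤ DN * (ε * P) := by
    calc ‖N‖ ≤ DN * ‖θ‖ * ‖p.2‖ := hN θ p.2
      _ = DN * (‖θ‖ * ‖p.2‖) := by ring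
      _ ≤ _ := by gcongr
  rw [hsplit]
  calc _ ≤ (S.d θ).nrm (S.ι N) + (S.d θ).nrm (S.ι e) +
        (S.d θ).nrm (E θ (S.ι (p.2 : S.V 0)) - S.ι (p.2 : S.V 0)) :=
        ((S.d θ).nrm_sub_le _ _).trans (add_le_add ((S.d θ).nrm_sub_le _ _) le_rfl)
    _ ≤ C * (DN * (ε * P)) + D' * ε * P + C * C * (ε * P) := by
        refine add_le_add (add_le_add ((hC.d_le θ hθ N).trans (by gcongr)) hde) ?_
        calc _ ≤ C * ‖θ‖ * (S.d 0).nrm (S.ι (p.2 : S.V 0)) := hC.E_sub_le θ hθ _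
          _ ≤ C * ‖θ‖ * (C * ‖p.2‖) := by gcongr; exact hC.d_le 0 hC.zero_mem _
          _ = C * C * (‖θ‖ * ‖p.2‖) := by ring
          _ ≤ _ := by gcongr
    _ = _ := by rw [hPdef]; ring

end Bounds
end Setting

/-! ### Inverses of operators generated by coercive forms -/

section FormOperator

variable {X Y : Type*} [NormedAddCommGroup X] [NormedSpace ℂ X] [CompleteSpace X]
  [NormedAddCommGroup Y] [NormedSpace ℂ Y]

theorem NonnegForm.IsEquivNorm.exists_bound {d : NonnegForm Y} (hd : d.IsEquivNorm) :
    ∃ C > 0, (∀ u, d.nrm u ≤ C * ‖u‖) ∧ ∀ u v, ‖d.toForm u v‖ ≤ C ^ 2 * ‖u‖ * ‖v‖ := by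
  obtain ⟨c, hc, C, hC, h⟩ := hd
  refine ⟨C, hC, fun u => (h u).2, fun u v => (d.norm_apply_le u v).trans ?_⟩
  calc d.nrm u * d.nrm v ≤ (C * ‖u‖) * (C * ‖v‖) :=
        mul_le_mul (h u).2 (h v).2 (d.nrm_nonneg v) (by positivity)
    _ = _ := by ring

omit [NormedAddCommGroup X] [NormedSpace ℂ X] [CompleteSpace X] in
theorem eq_zero_of_forall_dense {d : NonnegForm Y} (hd : d.IsEquivNorm) {j : X → Y}
    (hj : DenseRange j) {g : Y} (h : ∀ x, d.toForm g (j x) = 0) : g = 0 := by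
  obtain ⟨C, hC, -, hb⟩ := hd.exists_bound
  have hcl : IsClosed {y | d.toForm y g = 0} :=
    isClosed_eq (NonnegForm.continuous_apply_left hb g) continuous_const
  refine hd.eq_zero (hj.induction_on (p := fun y => d.toForm y g = 0) g hcl fun x => ?_)
  rw [← d.conj_symm, h, map_zero]

/-- The inverse of the operator generated by a form, together with its basic properties. -/
theorem exists_inverse_formOperator {s : NonnegForm X} (hs : s.IsEquivNorm) {d : NonnegForm Y}
    (hd : d.IsEquivNorm) {j : X →ₗ[ℂ] Y} (hj : Function.Injective j) (hdense : DenseRange j)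
    (hc : IsCompactOperator j) (hdj : ∀ x, d.quad (j x) ≤ s.quad x) :
    ∃ N : Y →ₗ[ℂ] X, (∀ g x, s.toForm (N g) x = d.toForm g (j x)) ∧
      IsInverse (formOperator s.toForm j d.toForm) (j ∘ₗ N) ∧
      IsContractiveSymm d (j ∘ₗ N) ∧ IsCompactOperator (j ∘ₗ N) := by
  obtain ⟨D, hD, hdD, -⟩ := hd.exists_bound
  have hb : ∀ g x, ‖d.toForm g (j x)‖ ≤ d.nrm g * s.nrm x := fun g x =>
    (d.norm_apply_le g _).trans (mul_le_mul_of_nonneg_left (Real.sqrt_le_sqrt (hdj x))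
      (d.nrm_nonneg g))
  obtain ⟨N, hN⟩ := NonnegForm.exists_solution hs
    (LinearMap.mk₂'ₛₗ (RingHom.id ℂ) (starRingEnd ℂ) (fun g x => d.toForm g (j x))
      (by intros; simp) (by intros; simp) (by intros; simp) (by intros; simp))
    (fun g => by
      obtain ⟨B, hB, hsB, -⟩ := hs.exists_bound
      exact ⟨d.nrm g * B, fun x => (hb g x).trans (by
        rw [mul_assoc]; exact mul_le_mul_of_nonneg_left (hsB x) (d.nrm_nonneg g))⟩)
  have hN' : ∀ g x, s.toForm (N g) x = d.toForm g (j x) := hN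
  have hsymm : ∀ x y, d.toForm (j (N x)) y = d.toForm x (j (N y)) := fun x y => by
    rw [← hN', ← d.conj_symm, ← hN', s.conj_symm]
  refine ⟨N, hN', ?_, ⟨hsymm, fun x => ?_⟩, ?_⟩
  · refine isInverse_formOperator hj (fun g => eq_zero_of_forall_dense hd hdense)
      (fun x hx => hs.eq_zero (hx x)) hN'
  -- The right-hand side equals s[N x], which dominates d[j (N x)] by `hdj`.
  · change d.quad (j (N x)) ≤ (d.toForm (j (N x)) x).re
    rw [hsymm, ← hN']
    exact hdj (N x)
  -- The energy bound makes `N` bounded into the form domain; compactness then comes from the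
  -- embedding `j`.
  · have hNb : ∀ g, s.nrm (N g) ≤ d.nrm g := fun g => by
      have h1 : s.nrm (N g) ^ 2 ≤ d.nrm g * s.nrm (N g) := by
        rw [NonnegForm.nrm_sq, NonnegForm.quad, hN']
        exact (Complex.re_le_norm _).trans (hb g _)
      rcases (s.nrm_nonneg (N g)).eq_or_lt with h | h
      · rw [← h]; exact d.nrm_nonneg g
      · exact le_of_mul_le_mul_right (by rw [← sq]; exact h1) h
    obtain ⟨c, hc0, C, hC, h⟩ := hs
    let N' : Y →L[ℂ] X := N.mkContinuous (c⁻¹ * D) fun g => by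
      rw [mul_assoc, ← div_eq_inv_mul, le_div_iff₀ hc0, mul_comm]
      exact (h _).1.trans ((hNb g).trans (hdD g))
    exact IsCompactOperator.comp_clm (f := j) hc N'

end FormOperator

/-! ### The limit operator and the comparison of eigenvalues -/

namespace Setting

variable {n : ℕ} {H 𝓗 : Type*} [NormedAddCommGroup H] [InnerProductSpace ℂ H]
  [NormedAddCommGroup 𝓗] [InnerProductSpace ℂ 𝓗] {S : Setting n H 𝓗}
  {Vstar : Submodule ℂ H} {Z : Submodule ℂ (S.V 0)}
  {a₁ : S.V 0 →ₗ[ℂ] H →ₗ⋆[ℂ] (Fin n → ℂ)}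
  {a₂ : S.V 0 →ₗ[ℂ] S.V 0 →ₗ⋆[ℂ] Matrix (Fin n) (Fin n) ℂ}
  {E : Param n → 𝓗 ≃ₗ[ℂ] 𝓗} {C : ℝ}

/-- The inner product `d_0` on `𝓗_0`. -/
def limitD (S : Setting n H 𝓗) (Vstar : Submodule ℂ H) (Z : Submodule ℂ (S.V 0)) :
    NonnegForm (S.limitSpace Vstar Z) := (S.d 0).comap (S.limitSpace Vstar Z).subtype

theorem denseRange_limitEmbedding : DenseRange (S.limitEmbedding Vstar Z) := by
  refine Subtype.dense_iff.2 fun x hx => ?_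
  have hx' : x ∈ closure (((S.sumSpace Vstar Z).map S.ι.toLinearMap : Submodule ℂ 𝓗) : Set 𝓗) := hx
  refine closure_mono ?_ hx'
  rintro _ ⟨y, hy, rfl⟩
  obtain ⟨v, hv, z, hz, rfl⟩ := Submodule.mem_sup.1 hy
  obtain ⟨z, hz, rfl⟩ := hz
  exact ⟨S.limitEmbedding Vstar Z (⟨v, hv⟩, ⟨z, hz⟩), ⟨_, rfl⟩, rfl⟩

theorem isEquivNorm_limitD (h0 : (0 : Param n) ∈ S.Θ) : (S.limitD Vstar Z).IsEquivNorm := by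
  obtain ⟨c, hc, C, hC, h⟩ := S.isEquivNorm_d 0 h0
  exact ⟨c, hc, C, hC, fun u => h u⟩

instance [CompleteSpace 𝓗] : CompleteSpace (S.limitSpace Vstar Z) :=
  (Submodule.isClosed_topologicalClosure _).completeSpace_coe

theorem exists_isOrthProj [CompleteSpace 𝓗] (h0 : (0 : Param n) ∈ S.Θ) :
    ∃ P : 𝓗 →ₗ[ℂ] S.limitSpace Vstar Z,
      IsOrthProj (S.d 0).toForm (S.limitSpace Vstar Z) P := by
  obtain ⟨C, hC, -, hb⟩ := (S.isEquivNorm_d 0 h0).exists_bound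
  obtain ⟨P, hP⟩ := NonnegForm.exists_solution (isEquivNorm_limitD (Vstar := Vstar) (Z := Z) h0)
    (LinearMap.mk₂'ₛₗ (RingHom.id ℂ) (starRingEnd ℂ)
      (fun (g : 𝓗) (x : S.limitSpace Vstar Z) => (S.d 0).toForm g x)
      (by intros; simp) (by intros; simp) (by intros; simp) (by intros; simp))
    (fun g => ⟨C ^ 2 * ‖g‖, fun x => hb g x⟩)
  refine ⟨P, fun g q hq => ?_⟩
  have h1 : (S.d 0).toForm (P g) q = (S.d 0).toForm g q := hP g ⟨q, hq⟩
  rw [map_sub, LinearMap.sub_apply, h1, sub_self]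

namespace Bounds

/-- The form `𝕊_ξ`, as a non-negative form. -/
def limitNonnegForm [CompleteSpace H] (hC : S.Bounds Vstar Z a₁ a₂ E C) (ξ : Param n) :
    NonnegForm (Vstar × Z) where
  toForm := S.limitForm Vstar Z a₁ a₂ ξ
  re_nonneg p := by
    obtain ⟨c, hc, h⟩ := hC.exists_homForm_coercive
    rw [limitForm_apply, Complex.add_re]
    exact add_nonneg ((by positivity : 0 ≤ c * ‖ξ‖ ^ 2 * ‖(p.2 : S.V 0)‖ ^ 2).trans
      (h ξ p.2 p.2.2)) ((S.b 0).re_nonneg _)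
  im_eq_zero p := by
    rw [limitForm_apply, Complex.add_im, hC.homForm_self_im, (S.b 0).im_eq_zero, add_zero]

variable (hC : S.Bounds Vstar Z a₁ a₂ E C)
include hC

theorem b_quad_le_limitNonnegForm [CompleteSpace H] (ξ : Param n) (p : Vstar × Z) :
    (S.b 0).quad (S.sumMap Vstar Z p) ≤ (hC.limitNonnegForm ξ).quad p := by
  obtain ⟨c, hc, h⟩ := hC.exists_homForm_coercive
  have h1 := (by positivity : 0 ≤ c * ‖ξ‖ ^ 2 * ‖(p.2 : S.V 0)‖ ^ 2).trans (h ξ p.2 p.2.2)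
  change _ ≤ (S.limitForm Vstar Z a₁ a₂ ξ p p).re
  rw [limitForm_apply, Complex.add_re]
  exact le_add_of_nonneg_left h1

theorem norm_le_norm_sumMap (p : Vstar × Z) : ‖p‖ ≤ C * ‖S.sumMap Vstar Z p‖ := by
  obtain ⟨h1, h2⟩ := hC.direct p.1 p.1.2 p.2 p.2.2
  exact max_le h1 h2

omit hC in
theorem norm_sumMap_le (p : Vstar × Z) : ‖S.sumMap Vstar Z p‖ ≤ 2 * ‖p‖ := by
  have h1 := norm_fst_le p
  have h2 := norm_snd_le p
  calc ‖S.sumMap Vstar Z p‖ ≤ ‖p.1‖ + ‖p.2‖ := norm_add_le _ _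
    _ ≤ _ := by linarith

/-- The lower bound needs only b_0, which is the full norm ‖·‖_0 squared on V_0, together with
transversality. -/
theorem isEquivNorm_limitNonnegForm [CompleteSpace H] (ξ : Param n) :
    (hC.limitNonnegForm ξ).IsEquivNorm := by
  obtain ⟨D, hD, hb⟩ := hC.exists_homForm_bound
  have hCp := hC.pos
  refine NonnegForm.isEquivNorm_of_bounds _ (c := (C ^ 4)⁻¹) (C := D * ‖ξ‖ ^ 2 + C * 2 * 2)
    (by positivity) (fun p => ?_) (fun p => ?_)
  · refine le_trans ?_ (hC.b_quad_le_limitNonnegForm ξ p)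
    have hV : S.sumMap Vstar Z p ∈ S.V 0 :=
      Submodule.add_mem _ (hC.Vstar_le p.1.2) (p.2 : S.V 0).2
    rw [← S.nrm_sq_of_mem_V hV, inv_mul_le_iff₀ (by positivity)]
    calc ‖p‖ ^ 2 ≤ (C * (C * S.nrm 0 (S.sumMap Vstar Z p))) ^ 2 := by
          gcongr
          exact (hC.norm_le_norm_sumMap p).trans (by
            gcongr; exact hC.norm_le 0 hC.zero_mem _)
      _ = _ := by ring
  · calc _ ≤ ‖S.limitForm Vstar Z a₁ a₂ ξ p p‖ := Complex.re_le_norm _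
      _ ≤ D * ‖ξ‖ ^ 2 * ‖p‖ * ‖p‖ + C * (2 * ‖p‖) * (2 * ‖p‖) := by
          rw [limitForm_apply]
          refine (norm_add_le _ _).trans (add_le_add ((hb ξ p.2 p.2).trans ?_)
            ((hC.b_le 0 hC.zero_mem _ _).trans ?_))
          · have := norm_snd_le p
            gcongr <;> exact this
          · gcongr <;> exact norm_sumMap_le p
      _ = _ := by ring

theorem injective_limitEmbedding : Function.Injective (S.limitEmbedding Vstar Z) := by
  rw [injective_iff_map_eq_zero]
  intro p hp
  have h1 : S.ι (S.sumMap Vstar Z p) = 0 := congrArg Subtype.val hp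
  have h2 : S.sumMap Vstar Z p = 0 := S.injective_ι (by rw [h1, map_zero])
  have h3 := hC.norm_le_norm_sumMap p
  rw [h2, norm_zero, mul_zero] at h3
  exact norm_le_zero_iff.1 h3

omit hC in
theorem isCompactOperator_limitEmbedding : IsCompactOperator (S.limitEmbedding Vstar Z) := by
  let m : Vstar × Z →L[ℂ] H := (S.sumMap Vstar Z).mkContinuous 2 norm_sumMap_le
  have h1 : IsCompactOperator (S.ι.toLinearMap ∘ₗ S.sumMap Vstar Z) :=
    S.isCompactOperator_ι.comp_clm m
  exact h1.codRestrict _ (Submodule.isClosed_topologicalClosure _)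

theorem exists_limit_inverse [CompleteSpace H] (ξ : Param n) :
    ∃ N : S.limitSpace Vstar Z →ₗ[ℂ] Vstar × Z,
      (∀ g q, S.limitForm Vstar Z a₁ a₂ ξ (N g) q =
        (S.d 0).toForm g (S.ι (S.sumMap Vstar Z q))) ∧
      IsInverse (S.limitOp Vstar Z a₁ a₂ ξ) (S.limitEmbedding Vstar Z ∘ₗ N) ∧
      IsContractiveSymm (S.limitD Vstar Z) (S.limitEmbedding Vstar Z ∘ₗ N) ∧
      IsCompactOperator (S.limitEmbedding Vstar Z ∘ₗ N) := by
  have : CompleteSpace Vstar := hC.isClosed_Vstar.completeSpace_coe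
  have : CompleteSpace (S.V 0) := (hC.isClosed_V hC.zero_mem).completeSpace_coe
  have : CompleteSpace Z := hC.isClosed_Z.completeSpace_coe
  exact exists_inverse_formOperator (hC.isEquivNorm_limitNonnegForm ξ)
    (isEquivNorm_limitD hC.zero_mem) hC.injective_limitEmbedding denseRange_limitEmbedding
    isCompactOperator_limitEmbedding
    (fun p => (S.d_le_b 0 hC.zero_mem _).trans (hC.b_quad_le_limitNonnegForm ξ p))

theorem isEquivNorm_opForm {ε : ℝ} (hε : 0 < ε) (hε1 : ε < 1) {θ : Param n} (hθ : θ ∈ S.Θ) :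
    (S.opForm ε θ).IsEquivNorm := by
  have hCp := hC.pos
  refine NonnegForm.isEquivNorm_of_bounds _ (c := (C ^ 2)⁻¹) (C := (ε ^ 2)⁻¹ * C + C)
    (by positivity) (fun u => ?_) (fun u => ?_)
  · rw [inv_mul_le_iff₀ (by positivity), ← NonnegForm.nrm_sq, ← mul_pow]
    gcongr
    exact hC.norm_le_opForm hε hε1 hθ u
  · rw [opForm_quad]
    calc _ ≤ (ε ^ 2)⁻¹ * (C * ‖u‖ * ‖u‖) + C * ‖u‖ * ‖u‖ := by
          gcongr
          · exact (Complex.re_le_norm _).trans (hC.a_le θ hθ u u)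
          · exact (Complex.re_le_norm _).trans (hC.b_le θ hθ u u)
      _ = _ := by ring

theorem exists_op_inverse [CompleteSpace H] {ε : ℝ} (hε : 0 < ε) (hε1 : ε < 1) {θ : Param n}
    (hθ : θ ∈ S.Θ) :
    ∃ N : 𝓗 →ₗ[ℂ] H,
      (∀ g φ, (S.opForm ε θ).toForm (N g) φ = (S.d θ).toForm g (S.ι φ)) ∧
      IsInverse (S.op ε θ) (S.ι.toLinearMap ∘ₗ N) ∧
      IsContractiveSymm (S.d θ) (S.ι.toLinearMap ∘ₗ N) ∧
      IsCompactOperator (S.ι.toLinearMap ∘ₗ N) := by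
  have h := exists_inverse_formOperator (hC.isEquivNorm_opForm hε hε1 hθ) (S.isEquivNorm_d θ hθ)
    (j := S.ι.toLinearMap) S.injective_ι S.denseRange_ι S.isCompactOperator_ι (fun x => by
      refine (S.d_le_b θ hθ x).trans ?_
      rw [opForm_quad]
      have := (S.a θ).quad_nonneg x
      exact le_add_of_nonneg_left (by positivity))
  rw [op, ← opForm_toForm]
  exact h

/-- From the operator estimate to the estimate of the eigenvalues. -/
theorem abs_inv_eigenvalue_sub_le [CompleteSpace 𝓗] {θ ξ : Param n} (hθ : θ ∈ S.Θ) {ε : ℝ}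
    {R : 𝓗 →ₗ[ℂ] 𝓗} {R₀ : S.limitSpace Vstar Z →ₗ[ℂ] S.limitSpace Vstar Z}
    {P : 𝓗 →ₗ[ℂ] S.limitSpace Vstar Z}
    (hR : IsInverse (S.op ε θ) R) (hRs : IsContractiveSymm (S.d θ) R) (hRc : IsCompactOperator R)
    (hR₀ : IsInverse (S.limitOp Vstar Z a₁ a₂ ξ) R₀)
    (hR₀s : IsContractiveSymm (S.limitD Vstar Z) R₀) (hR₀c : IsCompactOperator R₀)
    (hP : IsOrthProj (S.d 0).toForm (S.limitSpace Vstar Z) P) {δ : ℝ} (hδ : 0 ≤ δ)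
    (hest : ∀ g, (S.d θ).nrm (R g - E θ (R₀ (P ((E θ).symm g)))) ≤ δ * (S.d θ).nrm g) {k : ℕ}
    (hk : 1 ≤ k) :
    |1 / eigenvalue (S.op ε θ) k - 1 / eigenvalue (S.limitOp Vstar Z a₁ a₂ ξ) k| ≤ δ := by
  have hd := S.isEquivNorm_d θ hθ
  have hd0 := isEquivNorm_limitD (Vstar := Vstar) (Z := Z) hC.zero_mem
  have hP' : ∀ g, ∀ q ∈ S.limitSpace Vstar Z, (S.d 0).toForm (P g) q = (S.d 0).toForm g q := by
    intro g q hq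
    have := hP g q hq
    rw [map_sub, LinearMap.sub_apply, sub_eq_zero] at this
    exact this.symm
  have hPid : ∀ q : S.limitSpace Vstar Z, P q = q := fun q => by
    rw [← sub_eq_zero]
    refine hd0.eq_zero ?_
    change (S.d 0).toForm ((P q : 𝓗) - q) ((P q - q : S.limitSpace Vstar Z) : 𝓗) = 0
    rw [map_sub, LinearMap.sub_apply, hP' _ _ (P q - q).2, sub_self]
  have hPle : ∀ g, (S.d 0).quad (P g) ≤ (S.d 0).quad g := fun g => by
    have h1 : (S.d 0).nrm (P g) ^ 2 ≤ (S.d 0).nrm g * (S.d 0).nrm (P g) := by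
      rw [NonnegForm.nrm_sq, NonnegForm.quad, hP' _ _ (P g).2]
      exact (Complex.re_le_norm _).trans ((S.d 0).norm_apply_le _ _)
    have h2 : (S.d 0).nrm (P g) ≤ (S.d 0).nrm g := by
      rcases ((S.d 0).nrm_nonneg (P g : 𝓗)).eq_or_lt with h | h
      · rw [← h]; exact (S.d 0).nrm_nonneg g
      · exact le_of_mul_le_mul_right (by rw [← sq]; exact h1) h
    rw [← NonnegForm.nrm_sq, ← NonnegForm.nrm_sq]
    exact pow_le_pow_left₀ ((S.d 0).nrm_nonneg _) h2 2
  -- The operator estimate enters only through quadratic forms; unitarity of 𝓔_θ moves the limit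
  -- term from d_θ to d_0.
  have hest' : ∀ g, |((S.d θ).toForm (R g) g).re -
      ((S.d 0).toForm (R₀ (P ((E θ).symm g))) ((E θ).symm g)).re| ≤ δ * (S.d θ).quad g := by
    intro g
    have h1 : (S.d 0).toForm (R₀ (P ((E θ).symm g))) ((E θ).symm g) =
        (S.d θ).toForm (E θ (R₀ (P ((E θ).symm g)))) g := by
      rw [← hC.d_E θ hθ, LinearEquiv.apply_symm_apply]
    rw [h1, ← Complex.sub_re, ← LinearMap.sub_apply, ← map_sub]
    calc _ ≤ _ := (Complex.abs_re_le_norm _).trans ((S.d θ).norm_apply_le _ _)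
      _ ≤ δ * (S.d θ).nrm g * (S.d θ).nrm g :=
          mul_le_mul_of_nonneg_right (hest g) ((S.d θ).nrm_nonneg g)
      _ = _ := by rw [mul_assoc, ← sq, NonnegForm.nrm_sq]
  rw [abs_sub_le_iff]
  constructor
  -- Transfer from 𝓗 to 𝓗_0 by P𝓔_θ⁻¹, a contraction because P is an orthogonal projection.
  · refine inv_eigenvalue_sub_le hd hRs hR hd0 hR₀s hR₀c hR₀ (P ∘ₗ ((E θ).symm : 𝓗 →ₗ[ℂ] 𝓗))
      (fun y => ?_) hδ (fun y => ?_) hk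
    · change (S.d 0).quad (P ((E θ).symm y)) ≤ (S.d θ).quad y
      refine (hPle _).trans (le_of_eq ?_)
      rw [NonnegForm.quad, hC.d_E_symm hθ, LinearEquiv.apply_symm_apply, NonnegForm.quad]
    · change _ ≤ ((S.d 0).toForm (R₀ (P ((E θ).symm y))) (P ((E θ).symm y))).re
      have h1 := (abs_le.1 (hest' y)).2
      have h2 : (S.d 0).toForm (R₀ (P ((E θ).symm y))) (P ((E θ).symm y)) =
          (S.d 0).toForm (R₀ (P ((E θ).symm y))) ((E θ).symm y) := by
        rw [← (S.d 0).conj_symm, hP' _ _ (R₀ _).2, (S.d 0).conj_symm]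
      rw [h2]
      linarith
  -- Transfer back by the isometry 𝓔_θ on 𝓗_0, where P acts as the identity.
  · refine inv_eigenvalue_sub_le hd0 hR₀s hR₀ hd hRs hRc hR
      ((E θ : 𝓗 →ₗ[ℂ] 𝓗) ∘ₗ (S.limitSpace Vstar Z).subtype)
      (fun q => ?_) hδ (fun q => ?_) hk
    · change (S.d θ).quad (E θ q) ≤ (S.d 0).quad q
      rw [NonnegForm.quad, hC.d_E θ hθ, NonnegForm.quad]
    · change ((S.d 0).toForm (R₀ q) q).re - δ * (S.d 0).quad q ≤
        ((S.d θ).toForm (R (E θ q)) (E θ q)).re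
      have h1 := (abs_le.1 (hest' (E θ q))).1
      rw [LinearEquiv.symm_apply_apply, hPid, NonnegForm.quad, hC.d_E θ hθ] at h1
      rw [NonnegForm.quad]
      linarith

omit hC in
-- 𝓗_0 is a finite-dimensional image of V_⋆ ∔ Z, so beyond index N the defining set is empty and its
-- infimum takes the default value 0.
theorem eigenvalue_limitOp_eq_zero {N k : ℕ} {ξ : Param n}
    (hN : Module.rank ℂ (S.sumSpace Vstar Z) = N) (hk : N < k) :
    eigenvalue (S.limitOp Vstar Z a₁ a₂ ξ) k = 0 := by
  have : FiniteDimensional ℂ (S.sumSpace Vstar Z) :=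
    Module.rank_lt_aleph0_iff.1 (by rw [hN]; exact Cardinal.natCast_lt_aleph0)
  have hfin : Module.finrank ℂ (S.sumSpace Vstar Z) = N := Module.finrank_eq_of_rank_eq hN
  have hle : Module.finrank ℂ ((S.sumSpace Vstar Z).map S.ι.toLinearMap) ≤ N := by
    rw [← hfin]; exact Submodule.finrank_map_le _ _
  have heq : S.limitSpace Vstar Z = (S.sumSpace Vstar Z).map S.ι.toLinearMap :=
    (Submodule.closed_of_finiteDimensional _).submodule_topologicalClosure_eq
  have : FiniteDimensional ℂ (S.limitSpace Vstar Z) := by rw [heq]; infer_instance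
  have hempty : eigenvalueSet (S.limitOp Vstar Z a₁ a₂ ξ) k = ∅ := by
    rw [Set.eq_empty_iff_forall_notMem]
    intro t ht
    rw [eigenvalueSet, Set.mem_ofPred_eq] at ht
    have h1 := ht.trans (Submodule.rank_le _)
    rw [← Module.finrank_eq_rank, heq] at h1
    have h2 : k ≤ Module.finrank ℂ ((S.sumSpace Vstar Z).map S.ι.toLinearMap) := by
      exact_mod_cast h1
    omega
  change sInf (eigenvalueSet (S.limitOp Vstar Z a₁ a₂ ξ) k) = 0
  rw [hempty, Real.sInf_empty]

end Bounds
end Setting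

end

end AbstractHom

/-! ### Assembly of the operator and eigenvalue estimates -/

theorem mainTheorem6 (n : ℕ) (hn : 1 ≤ n) (H 𝓗 : Type*)
    [NormedAddCommGroup H] [InnerProductSpace ℂ H] [CompleteSpace H]
    [TopologicalSpace.SeparableSpace H]
    [NormedAddCommGroup 𝓗] [InnerProductSpace ℂ 𝓗] [CompleteSpace 𝓗]
    [TopologicalSpace.SeparableSpace 𝓗]
    (S : AbstractHom.Setting n H 𝓗)
    (Vstar : Submodule ℂ H) (Z : Submodule ℂ (S.V 0))
    (a₁ : S.V 0 →ₗ[ℂ] H →ₗ⋆[ℂ] (Fin n → ℂ))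
    (a₂ : S.V 0 →ₗ[ℂ] S.V 0 →ₗ⋆[ℂ] Matrix (Fin n) (Fin n) ℂ)
    (E : AbstractHom.Param n → 𝓗 ≃ₗ[ℂ] 𝓗)
    (h1 : S.GapCondition)
    (h2 : S.RemovableSingularity Vstar)
    (hZ : S.IsDefectSpace Vstar Z)
    (h3 : S.QuadraticGap)
    (h4 : S.RegularAtZero a₁ a₂)
    (h5 : S.LipschitzB)
    (h6 : S.UnitaryTransfer Vstar Z E) :
    ∃ C > 0, ∀ ε : ℝ, 0 < ε → ε < 1 → ∀ θ ∈ S.Θ,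
      -- the operator estimate in `(𝓗, d_θ)`
      (∃ (R : 𝓗 →ₗ[ℂ] 𝓗) (R₀ : S.limitSpace Vstar Z →ₗ[ℂ] S.limitSpace Vstar Z)
          (P : 𝓗 →ₗ[ℂ] S.limitSpace Vstar Z),
        AbstractHom.IsInverse (S.op ε θ) R ∧
        AbstractHom.IsInverse (S.limitOp Vstar Z a₁ a₂ (ε⁻¹ • θ)) R₀ ∧
        AbstractHom.IsOrthProj (S.d 0).toForm (S.limitSpace Vstar Z) P ∧
        ∀ g : 𝓗, (S.d θ).nrm (R g - E θ (R₀ (P ((E θ).symm g)))) ≤ C * ε * (S.d θ).nrm g) ∧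
      -- the eigenvalues, if `V_⋆ ∔ Z` is infinite-dimensional
      (¬ FiniteDimensional ℂ (S.sumSpace Vstar Z) → ∀ k : ℕ, 1 ≤ k →
        |1 / AbstractHom.eigenvalue (S.op ε θ) k
          - 1 / AbstractHom.eigenvalue (S.limitOp Vstar Z a₁ a₂ (ε⁻¹ • θ)) k| ≤ C * ε) ∧
      -- the eigenvalues, if `V_⋆ ∔ Z` has dimension `N`
      (∀ N : ℕ, Module.rank ℂ (S.sumSpace Vstar Z) = N →
        (∀ k : ℕ, 1 ≤ k → k ≤ N →
          |1 / AbstractHom.eigenvalue (S.op ε θ) k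
            - 1 / AbstractHom.eigenvalue (S.limitOp Vstar Z a₁ a₂ (ε⁻¹ • θ)) k| ≤ C * ε) ∧
        (∀ p : ℕ, N + 1 ≤ p → (p : Cardinal) ≤ Module.rank ℂ 𝓗 →
          |1 / AbstractHom.eigenvalue (S.op ε θ) p| ≤ C * ε)) := by
  obtain ⟨C, hC⟩ := AbstractHom.Setting.exists_bounds h1 h2 hZ h3 h4 h5 h6
  obtain ⟨D, hD, hsol⟩ := hC.exists_solution_estimate
  refine ⟨D + 1, by positivity, fun ε hε hε1 θ hθ => ?_⟩
  obtain ⟨N, hN, hR, hRs, hRc⟩ := hC.exists_op_inverse hε hε1 hθ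
  obtain ⟨N₀, hN₀, hR₀, hR₀s, hR₀c⟩ := hC.exists_limit_inverse (ε⁻¹ • θ)
  obtain ⟨P, hP⟩ := AbstractHom.Setting.exists_isOrthProj (Vstar := Vstar) (Z := Z) hC.zero_mem
  have hest : ∀ g : 𝓗, (S.d θ).nrm ((S.ι.toLinearMap ∘ₗ N) g -
      E θ ((S.limitEmbedding Vstar Z ∘ₗ N₀) (P ((E θ).symm g)))) ≤
        (D + 1) * ε * (S.d θ).nrm g := by
    intro g
    have hg := (S.d θ).nrm_nonneg g
    refine (hsol ε hε hε1 θ hθ g (N g) (N₀ (P ((E θ).symm g))) (hN g) fun q => ?_).trans ?_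
    -- Test elements lie in 𝓗_0, so P𝓔_θ⁻¹g and 𝓔_θ⁻¹g give the same right-hand side.
    · have h := hP ((E θ).symm g) _ (S.limitEmbedding Vstar Z q).2
      rw [map_sub, LinearMap.sub_apply, sub_eq_zero] at h
      rw [hN₀]
      exact h.symm
    · gcongr
      linarith
  -- This holds for every k regardless of dimension. For k > N the reciprocal of the limit
  -- eigenvalue is 1/0 = 0, which yields the last claim.
  have heig : ∀ k : ℕ, 1 ≤ k → |1 / AbstractHom.eigenvalue (S.op ε θ) k
      - 1 / AbstractHom.eigenvalue (S.limitOp Vstar Z a₁ a₂ (ε⁻¹ • θ)) k| ≤ (D + 1) * ε :=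
    fun k hk => hC.abs_inv_eigenvalue_sub_le hθ hR hRs hRc hR₀ hR₀s hR₀c hP (by positivity) hest hk
  refine ⟨⟨_, _, P, hR, hR₀, hP, hest⟩, fun _ => heig, fun M hM => ⟨fun k hk _ => heig k hk,
    fun p hp _ => ?_⟩⟩
  have h := heig p (by omega)
  rwa [AbstractHom.Setting.Bounds.eigenvalue_limitOp_eq_zero hM (by omega), div_zero,
    sub_zero] at h
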